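/- **Setting.** Let $\mathbb H=\mathbb R^3$ be the Heisenberg group with the law $(x,y,z)*(x',y',z')=(x+x',y+y',z+z'+xy')$, let $K\ge 1$ be an integer, $\Gamma_K=\{(a,b,c/K):a,b,c\in\mathbb Z\}$ and $M=\Gamma_K\backslash\mathbb H$. Let $Z$ be the left-invariant vector field with $\exp(tZ)=(0,0,t)$, and let $V,W$ be left-invariant vector fields with $[V,W]=Z$. Let $\Phi:M\to M$ be the map induced by a Lie group automorphism of $\mathbb H$ that maps $\Gamma_K$ onto itself, such that for some $\lambda>1$ $$\Phi_*V=\lambda^{-1}V,\qquad \Phi_*W=\lambda W,\qquad \Phi_*Z=Z .$$ For $N\in\mathbb Z$ let $\mathcal C_N^\infty=\{h\in\mathcal C^\infty(M,\mathbb C): Zh=2\pi i NK\,h\}$. Fix $\delta>0$. With $\varphi^W_t(m)=m*\exp(tW)$, put, for $p\in\{0,1,2,\dots\}$ and $q\in\{1,2,\dots\}$, $$\|h\|_{p,q}=\sup\Big\{\Big|\int_{-\delta}^{\delta}\eta(t)\,(V^jh)(\varphi^W_t(m))\,dt\Big| : 0\le j\le p,\ m\in M,\ \eta\in\mathcal C_c^\infty((-\delta,\delta),\mathbb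 C),\ \|\eta\|_{\mathcal C^q}\le 1\Big\},$$ where $\|\eta\|_{\mathcal C^q}=\sup_{j\le q}2^{q-j}|\eta^{(j)}|_\infty$. Let $\mathcal B_N^{p,q}$ be the completion of $\mathcal C_N^\infty$ with respect to $\|\cdot\|_{p,q}$. For $p\ge 1$ the operator $V$ extends continuously to $V:\mathcal B_N^{p,q}\to\mathcal B_N^{p-1,q}$; let $\ker_N(V)=\{h\in\mathcal B_N^{p,q}:Vh=0\}$. **Lemma.** Let $N\neq 0$ and $p,q\ge 1$. The operator $h\mapsto h\circ\Phi$ on $\mathcal C_N^\infty$ extends to a bounded operator $\mathcal L$ on $\mathcal B_N^{p,q}$, which maps $\ker_N(V)$ into itself, and for every integer $k$ with $0\le k<\min\{p,q\}$ $$\operatorname{spec}(\mathcal L)\cap\{z\in\mathbb C:\lambda^{-(k+1)}<|z|\le\lambda^{-k}\}=\{z\in\mathbb C:\lambda^kz\in\operatorname{spec}(\mathcal L|_{\ker_N(V)})\}.$$ -/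

import Mathlib

open scoped ContDiff

/-! The (polarised) three-dimensional Heisenberg group. -/

/-- The Heisenberg group: `(x, y, z)` stands for the upper triangular unipotent matrix with
entries `x`, `y` next to the diagonal and `z` in the corner. -/
@[ext]
structure Heis where
  x : ℝ
  y : ℝ
  z : ℝ

namespace Heis

instance : Mul Heis := ⟨fun g h => ⟨g.x + h.x, g.y + h.y, g.z + h.z + g.x * h.y⟩⟩
instance : One Heis := ⟨⟨0, 0, 0⟩⟩
instance : Inv Heis := ⟨fun g => ⟨-g.x, -g.y, -g.z + g.x * g.y⟩⟩

@[simp] theorem mul_x (g h : Heis) : (g * h).x = g.x + h.x := rfl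
@[simp] theorem mul_y (g h : Heis) : (g * h).y = g.y + h.y := rfl
@[simp] theorem mul_z (g h : Heis) : (g * h).z = g.z + h.z + g.x * h.y := rfl
@[simp] theorem one_x : (1 : Heis).x = 0 := rfl
@[simp] theorem one_y : (1 : Heis).y = 0 := rfl
@[simp] theorem one_z : (1 : Heis).z = 0 := rfl
@[simp] theorem inv_x (g : Heis) : (g⁻¹).x = -g.x := rfl
@[simp] theorem inv_y (g : Heis) : (g⁻¹).y = -g.y := rfl
@[simp] theorem inv_z (g : Heis) : (g⁻¹).z = -g.z + g.x * g.y := rfl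

instance : Group Heis :=
  Group.ofLeftAxioms
    (fun a b c => by ext <;> simp <;> ring)
    (fun a => by ext <;> simp)
    (fun a => by ext <;> simp)

/-- Global coordinates on the Heisenberg group. -/
def ofCoords (u : ℝ × ℝ × ℝ) : Heis := ⟨u.1, u.2.1, u.2.2⟩

/-- Global coordinates on the Heisenberg group. -/
def coords (g : Heis) : ℝ × ℝ × ℝ := (g.x, g.y, g.z)

/-- The exponential map of the Heisenberg group. The vector `(a, b, c)` stands for the element
`a X + b Y + c Z` of the Lie algebra, that is, for the strictly upper triangular matrix with entries
`a`, `b` next to the diagonal and `c` in the corner. -/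
noncomputable def exp (v : ℝ × ℝ × ℝ) : Heis := ⟨v.1, v.2.1, v.2.2 + v.1 * v.2.1 / 2⟩

/-- The Lie bracket of the Heisenberg Lie algebra (the commutator of matrices). -/
def bracket (v w : ℝ × ℝ × ℝ) : ℝ × ℝ × ℝ := (0, 0, v.1 * w.2.1 - w.1 * v.2.1)

/-- The standard generator `Z` of the centre of the Heisenberg Lie algebra. -/
def dz : ℝ × ℝ × ℝ := (0, 0, 1)

/-- The lattice `Γ_K = {(a, b, c / K) : a, b, c ∈ ℤ}`. -/
def lattice (K : ℕ+) : Subgroup Heis where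
  carrier := {g | ∃ a b c : ℤ, g = ⟨a, b, c / ((K : ℕ) : ℝ)⟩}
  one_mem' := ⟨0, 0, 0, by ext <;> simp⟩
  mul_mem' := by
    rintro _ _ ⟨a, b, c, rfl⟩ ⟨a', b', c', rfl⟩
    have hK : ((K : ℕ) : ℝ) ≠ 0 := by exact_mod_cast K.ne_zero
    refine ⟨a + a', b + b', c + c' + a * b' * (K : ℕ), ?_⟩
    ext <;> simp
    field_simp
  inv_mem' := by
    rintro _ ⟨a, b, c, rfl⟩
    have hK : ((K : ℕ) : ℝ) ≠ 0 := by exact_mod_cast K.ne_zero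
    refine ⟨-a, -b, -c + a * b * (K : ℕ), ?_⟩
    ext <;> simp
    field_simp

end Heis

/-- The Heisenberg nilmanifold `M = Γ_K \ ℍ` (classes `Γ_K g`). -/
def Nil (K : ℕ+) : Type := Quotient (QuotientGroup.rightRel (Heis.lattice K))

namespace Nil

variable {K : ℕ+}

/-- The projection `ℍ → M`. -/
def mk (g : Heis) : Nil K := Quotient.mk (QuotientGroup.rightRel (Heis.lattice K)) g

theorem mk_surj (m : Nil K) : ∃ g : Heis, mk g = m := Quotient.exists_rep m

theorem mk_mul_left {γ : Heis} (hγ : γ ∈ Heis.lattice K) (g : Heis) :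
    (mk (γ * g) : Nil K) = mk g := by
  refine Quotient.sound ?_
  change QuotientGroup.rightRel (Heis.lattice K) (γ * g) g
  rw [QuotientGroup.rightRel_apply]
  simpa using hγ

/-- The right translation `Γ g ↦ Γ g a` of `M`. -/
def act (m : Nil K) (a : Heis) : Nil K :=
  Quotient.map (sa := QuotientGroup.rightRel (Heis.lattice K))
    (sb := QuotientGroup.rightRel (Heis.lattice K)) (fun g => g * a)
    (by
      intro g h hgh
      have hgh' : QuotientGroup.rightRel (Heis.lattice K) g h := hgh
      change QuotientGroup.rightRel (Heis.lattice K) (g * a) (h * a)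
      rw [QuotientGroup.rightRel_apply] at hgh' ⊢
      simpa [mul_assoc] using hgh') m

theorem act_mk (g a : Heis) : (mk g : Nil K).act a = mk (g * a) := rfl

theorem act_act (m : Nil K) (a b : Heis) : (m.act a).act b = m.act (a * b) := by
  obtain ⟨g, rfl⟩ := mk_surj m
  simp only [act_mk, mul_assoc]

/-- The flow generated by the left-invariant vector field `v`, namely `m ↦ m * exp (t v)`. -/
noncomputable def flow (v : ℝ × ℝ × ℝ) (t : ℝ) (m : Nil K) : Nil K := m.act (Heis.exp (t • v))

/-- A function on `M` in the global coordinates of the universal cover `ℍ = ℝ³`. -/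
def lift (h : Nil K → ℂ) (u : ℝ × ℝ × ℝ) : ℂ := h (mk (Heis.ofCoords u))

/-- Smooth functions on `M`: the projection `ℍ → M` is a smooth covering. -/
def Smooth (h : Nil K → ℂ) : Prop := ContDiff ℝ ∞ (lift h)

/-- The derivative of a function on `M` in the direction of the left-invariant vector
field `v`. -/
noncomputable def lieDeriv (v : ℝ × ℝ × ℝ) (h : Nil K → ℂ) (m : Nil K) : ℂ :=
  deriv (fun t : ℝ => h (flow v t m)) 0

/-- The flow in coordinates. -/
noncomputable def flowCoords (v : ℝ × ℝ × ℝ) (u : ℝ × ℝ × ℝ) (t : ℝ) : ℝ × ℝ × ℝ :=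
  (u.1 + t * v.1, u.2.1 + t * v.2.1,
    u.2.2 + (t * v.2.2 + t * v.1 * (t * v.2.1) / 2) + u.1 * (t * v.2.1))

theorem flow_mk (v u : ℝ × ℝ × ℝ) (t : ℝ) :
    flow v t (mk (Heis.ofCoords u) : Nil K) = mk (Heis.ofCoords (flowCoords v u t)) := rfl

theorem exists_coords (m : Nil K) : ∃ u, mk (Heis.ofCoords u) = m := by
  obtain ⟨g, rfl⟩ := mk_surj m
  exact ⟨g.coords, rfl⟩

theorem hasDerivAt_flowCoords (v u : ℝ × ℝ × ℝ) :
    HasDerivAt (flowCoords v u) (v.1, v.2.1, v.2.2 + u.1 * v.2.1) 0 := by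
  unfold flowCoords
  refine HasDerivAt.prodMk ?_ (HasDerivAt.prodMk ?_ ?_)
  · simpa using ((hasDerivAt_id (0 : ℝ)).mul_const v.1).const_add u.1
  · simpa using ((hasDerivAt_id (0 : ℝ)).mul_const v.2.1).const_add u.2.1
  · have h1 := (hasDerivAt_id (0 : ℝ)).mul_const v.1
    have h2 := (hasDerivAt_id (0 : ℝ)).mul_const v.2.1
    have h3 := (hasDerivAt_id (0 : ℝ)).mul_const v.2.2
    have h4 := ((h3.add ((h1.mul h2).div_const 2)).const_add u.2.2).add (h2.const_mul u.1)
    convert h4 using 1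
    · funext t
      simp
    · simp

theorem flowCoords_zero (v u : ℝ × ℝ × ℝ) : flowCoords v u 0 = u := by
  simp [flowCoords]

theorem flow_zero (v : ℝ × ℝ × ℝ) (m : Nil K) : flow v 0 m = m := by
  obtain ⟨u, rfl⟩ := exists_coords m
  rw [flow_mk, flowCoords_zero]

theorem flow_add (v : ℝ × ℝ × ℝ) (s t : ℝ) (m : Nil K) :
    flow v (s + t) m = flow v t (flow v s m) := by
  unfold flow
  rw [act_act]
  congr 1
  ext <;> simp [Heis.exp] <;> ring

theorem flow_dz_comm (v : ℝ × ℝ × ℝ) (s t : ℝ) (m : Nil K) :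
    flow v t (flow Heis.dz s m) = flow Heis.dz s (flow v t m) := by
  unfold flow
  rw [act_act, act_act]
  congr 1
  ext <;> simp [Heis.exp, Heis.dz]
  ring

theorem contDiff_flowCoords (v u : ℝ × ℝ × ℝ) : ContDiff ℝ ∞ (flowCoords v u) := by
  unfold flowCoords
  fun_prop

theorem Smooth.comp_flow {h : Nil K → ℂ} (hh : Smooth h) (v : ℝ × ℝ × ℝ) (m : Nil K) :
    ContDiff ℝ ∞ (fun t : ℝ => h (flow v t m)) := by
  obtain ⟨u, rfl⟩ := exists_coords m
  exact hh.comp (contDiff_flowCoords v u)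

theorem Smooth.hasDerivAt {h : Nil K → ℂ} (hh : Smooth h) (v : ℝ × ℝ × ℝ) (m : Nil K) :
    HasDerivAt (fun t : ℝ => h (flow v t m)) (lieDeriv v h m) 0 :=
  ((hh.comp_flow v m).differentiable (by simp) 0).hasDerivAt

theorem Smooth.hasDerivAt' {h : Nil K → ℂ} (hh : Smooth h) (v : ℝ × ℝ × ℝ) (m : Nil K) (s : ℝ) :
    HasDerivAt (fun t : ℝ => h (flow v t m)) (lieDeriv v h (flow v s m)) s := by
  have h1 : HasDerivAt (fun t : ℝ => h (flow v t (flow v s m)))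
      (lieDeriv v h (flow v s m)) (s - s) := by
    rw [sub_self]; exact hh.hasDerivAt v (flow v s m)
  have h2 := HasDerivAt.comp_sub_const s s h1
  refine h2.congr_of_eventuallyEq (Filter.Eventually.of_forall fun t => ?_)
  change h (flow v t m) = h (flow v (t - s) (flow v s m))
  rw [← flow_add]
  congr 2
  ring

theorem lieDeriv_add {f h : Nil K → ℂ} (hf : Smooth f) (hh : Smooth h) (v : ℝ × ℝ × ℝ) :
    lieDeriv v (f + h) = lieDeriv v f + lieDeriv v h := by
  funext m
  exact ((hf.hasDerivAt v m).add (hh.hasDerivAt v m)).deriv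

theorem lieDeriv_smul {h : Nil K → ℂ} (hh : Smooth h) (c : ℂ) (v : ℝ × ℝ × ℝ) :
    lieDeriv v (c • h) = c • lieDeriv v h := by
  funext m
  exact ((hh.hasDerivAt v m).const_mul c).deriv

theorem Smooth.lieDeriv {h : Nil K → ℂ} (hh : Smooth h) (v : ℝ × ℝ × ℝ) :
    Smooth (lieDeriv v h) := by
  have key : lift (Nil.lieDeriv v h) =
      fun u => fderiv ℝ (lift h) u (v.1, v.2.1, v.2.2 + u.1 * v.2.1) := by
    funext u
    have h1 : HasFDerivAt (lift h) (fderiv ℝ (lift h) u) (flowCoords v u 0) := by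
      rw [flowCoords_zero]
      exact (ContDiff.differentiable hh (by simp) u).hasFDerivAt
    exact (h1.comp_hasDerivAt 0 (hasDerivAt_flowCoords v u)).deriv
  unfold Smooth
  rw [key]
  refine ContDiff.clm_apply (ContDiff.fderiv_right hh (by simp)) ?_
  fun_prop

/-- Smooth functions on the compact manifold `M` are bounded. -/
theorem Smooth.bounded {h : Nil K → ℂ} (hh : Smooth h) : ∃ C : ℝ, ∀ m, ‖h m‖ ≤ C := by
  have hK : (0 : ℝ) < ((K : ℕ) : ℝ) := by exact_mod_cast K.pos
  have hc : IsCompact (Set.Icc (0 : ℝ) 1 ×ˢ (Set.Icc (0 : ℝ) 1 ×ˢ Set.Icc (0 : ℝ) 1)) :=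
    isCompact_Icc.prod (isCompact_Icc.prod isCompact_Icc)
  obtain ⟨C, hC⟩ := hc.exists_bound_of_continuousOn (ContDiff.continuous hh).continuousOn
  refine ⟨C, fun m => ?_⟩
  obtain ⟨g, rfl⟩ := mk_surj m
  set a : ℤ := -⌊g.x⌋ with ha
  set b : ℤ := -⌊g.y⌋ with hb
  set c : ℤ := -⌊((K : ℕ) : ℝ) * (g.z + a * g.y)⌋ with hcdef
  have hmem : (⟨a, b, c / ((K : ℕ) : ℝ)⟩ : Heis) ∈ Heis.lattice K := ⟨a, b, c, rfl⟩
  rw [← mk_mul_left hmem g]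
  refine hC (Heis.coords (⟨a, b, c / ((K : ℕ) : ℝ)⟩ * g)) ?_
  have hz : (c : ℝ) / ((K : ℕ) : ℝ) + g.z + a * g.y =
      Int.fract (((K : ℕ) : ℝ) * (g.z + a * g.y)) / ((K : ℕ) : ℝ) := by
    rw [Int.fract, hcdef]
    push_cast
    field_simp
    ring
  have hK1 : (1 : ℝ) ≤ ((K : ℕ) : ℝ) := by exact_mod_cast K.pos
  have e1 := Int.fract_nonneg g.x
  have e2 := (Int.fract_lt_one g.x).le
  have e3 := Int.fract_nonneg g.y
  have e4 := (Int.fract_lt_one g.y).le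
  have e5 := Int.fract_nonneg (((K : ℕ) : ℝ) * (g.z + a * g.y))
  have e6 := (Int.fract_lt_one (((K : ℕ) : ℝ) * (g.z + a * g.y))).le
  refine ⟨⟨?_, ?_⟩, ⟨?_, ?_⟩, ⟨?_, ?_⟩⟩
  · simp only [Heis.coords, Heis.mul_x, ha]; push_cast; rw [Int.fract] at e1; linarith
  · simp only [Heis.coords, Heis.mul_x, ha]; push_cast; rw [Int.fract] at e2; linarith
  · simp only [Heis.coords, Heis.mul_y, hb]; push_cast; rw [Int.fract] at e3; linarith
  · simp only [Heis.coords, Heis.mul_y, hb]; push_cast; rw [Int.fract] at e4; linarith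
  · simp only [Heis.coords, Heis.mul_z]; rw [hz]; positivity
  · simp only [Heis.coords, Heis.mul_z]; rw [hz, div_le_one hK]; linarith

/-- The space `C_N^∞ = {h ∈ C^∞(M) : Z h = 2 π i N K h}`. -/
noncomputable def CN (K : ℕ+) (N : ℤ) : Submodule ℂ (Nil K → ℂ) where
  carrier := {h | Smooth h ∧
    ∀ m, lieDeriv Heis.dz h m = 2 * (Real.pi : ℂ) * Complex.I * N * (K : ℕ) * h m}
  zero_mem' := ⟨contDiff_const, fun m => by
    rw [Pi.zero_apply, mul_zero]
    exact (hasDerivAt_const (0 : ℝ) (0 : ℂ)).deriv⟩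
  add_mem' := by
    rintro f h ⟨hf, hf'⟩ ⟨hh, hh'⟩
    refine ⟨ContDiff.add hf hh, fun m => ?_⟩
    rw [lieDeriv_add hf hh, Pi.add_apply, hf', hh', Pi.add_apply]
    ring
  smul_mem' := by
    rintro c h ⟨hh, hh'⟩
    refine ⟨ContDiff.const_smul c hh, fun m => ?_⟩
    rw [lieDeriv_smul hh, Pi.smul_apply, hh', Pi.smul_apply, smul_eq_mul, smul_eq_mul]
    ring

theorem CN.flow_dz {N : ℤ} {h : Nil K → ℂ} (hh : h ∈ CN K N) (s : ℝ) (m : Nil K) :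
    h (flow Heis.dz s m) =
      Complex.exp ((2 * (Real.pi : ℂ) * Complex.I * N * (K : ℕ)) * s) * h m := by
  set c : ℂ := 2 * (Real.pi : ℂ) * Complex.I * N * (K : ℕ) with hc
  have hexp : ∀ t : ℝ, HasDerivAt (fun t : ℝ => Complex.exp (-c * t)) (Complex.exp (-c * t) * -c) t := by
    intro t
    have h0 : HasDerivAt (fun t : ℝ => -c * (t : ℂ)) (-c) t := by
      simpa using (Complex.ofRealCLM.hasDerivAt (x := t)).const_mul (-c)
    exact h0.cexp
  have hd : ∀ t : ℝ, HasDerivAt (fun t : ℝ => Complex.exp (-c * t) * h (flow Heis.dz t m)) 0 t := by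
    intro t
    have h1 := (hexp t).mul (hh.1.hasDerivAt' Heis.dz m t)
    rw [hh.2] at h1
    have h2 : Complex.exp (-c * t) * -c * h (flow Heis.dz t m) +
        Complex.exp (-c * t) * (c * h (flow Heis.dz t m)) = 0 := by ring
    exact h2 ▸ h1
  have hconst := is_const_of_deriv_eq_zero (fun t => (hd t).differentiableAt)
    (fun t => (hd t).deriv) s 0
  simp only [flow_zero, Complex.ofReal_zero, mul_zero, Complex.exp_zero, one_mul] at hconst
  rw [← hconst, ← mul_assoc, ← Complex.exp_add]
  simp

/-- A left-invariant vector field as an operator on `C_N^∞`. -/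
noncomputable def lieOp (v : ℝ × ℝ × ℝ) (N : ℤ) : CN K N →ₗ[ℂ] CN K N where
  toFun h := ⟨lieDeriv v h.1, h.2.1.lieDeriv v, fun m => by
    set c : ℂ := 2 * (Real.pi : ℂ) * Complex.I * N * (K : ℕ) with hc
    have h1 : (fun s : ℝ => lieDeriv v h.1 (flow Heis.dz s m)) =
        fun s : ℝ => Complex.exp (c * s) * lieDeriv v h.1 m := by
      funext s
      have h2 : HasDerivAt (fun t : ℝ => h.1 (flow v t (flow Heis.dz s m)))
          (Complex.exp (c * s) * lieDeriv v h.1 m) 0 := by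
        have h3 := (h.2.1.hasDerivAt v m).const_mul (Complex.exp (c * s))
        refine h3.congr_of_eventuallyEq (Filter.Eventually.of_forall fun t => ?_)
        change h.1 (flow v t (flow Heis.dz s m)) = _
        rw [flow_dz_comm, CN.flow_dz h.2]
      exact h2.deriv
    have h4 : HasDerivAt (fun s : ℝ => Complex.exp (c * s)) c 0 := by
      have h0 : HasDerivAt (fun t : ℝ => c * (t : ℂ)) c (0 : ℝ) := by
        simpa using (Complex.ofRealCLM.hasDerivAt (x := (0 : ℝ))).const_mul c
      simpa using h0.cexp
    change deriv (fun s : ℝ => lieDeriv v h.1 (flow Heis.dz s m)) 0 = _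
    rw [h1]
    exact (h4.mul_const _).deriv⟩
  map_add' f h := Subtype.ext (lieDeriv_add f.2.1 h.2.1 v)
  map_smul' c h := Subtype.ext (lieDeriv_smul h.2.1 c v)

end Nil

/-- A partially hyperbolic automorphism with neutral centre of `M = Γ_K \ ℍ`, together with its
adapted Heisenberg frame `V, W, Z` of left-invariant vector fields, `[V, W] = Z`.
`A` is the automorphism of the Lie group `ℍ` which induces the map `Φ` of `M`. A homomorphism
maps `exp (t V)` to `exp (t A_* V)`, so that `map_V` says `Φ_* V = λ⁻¹ V`, and so on. -/
structure PHAut (K : ℕ+) where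
  A : Heis ≃* Heis
  smooth : ContDiff ℝ ∞ (fun u : ℝ × ℝ × ℝ => (A (Heis.ofCoords u)).coords)
  map_lattice : (Heis.lattice K).map A.toMonoidHom = Heis.lattice K
  V : ℝ × ℝ × ℝ
  W : ℝ × ℝ × ℝ
  bracket_VW : Heis.bracket V W = Heis.dz
  lam : ℝ
  one_lt_lam : 1 < lam
  map_V : ∀ t : ℝ, A (Heis.exp (t • V)) = Heis.exp (t • lam⁻¹ • V)
  map_W : ∀ t : ℝ, A (Heis.exp (t • W)) = Heis.exp (t • lam • W)
  map_Z : ∀ t : ℝ, A (Heis.exp (t • Heis.dz)) = Heis.exp (t • Heis.dz)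

namespace PHAut

open Nil

variable {K : ℕ+} (S : PHAut K)

/-- The induced map `Φ : M → M`. -/
def Phi (m : Nil K) : Nil K :=
  Quotient.map (sa := QuotientGroup.rightRel (Heis.lattice K))
    (sb := QuotientGroup.rightRel (Heis.lattice K)) (fun g => S.A g)
    (by
      intro g h hgh
      have hgh' : QuotientGroup.rightRel (Heis.lattice K) g h := hgh
      change QuotientGroup.rightRel (Heis.lattice K) (S.A g) (S.A h)
      rw [QuotientGroup.rightRel_apply] at hgh' ⊢
      have h1 := Subgroup.mem_map_of_mem S.A.toMonoidHom hgh'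
      rw [S.map_lattice] at h1
      simpa using h1) m

theorem Phi_flow_dz (t : ℝ) (m : Nil K) : S.Phi (flow Heis.dz t m) = flow Heis.dz t (S.Phi m) := by
  obtain ⟨g, rfl⟩ := mk_surj m
  change (Nil.mk (S.A (g * Heis.exp (t • Heis.dz))) : Nil K) =
    Nil.mk (S.A g * Heis.exp (t • Heis.dz))
  rw [map_mul, S.map_Z]

/-- The transfer operator `h ↦ h ∘ Φ` on `C_N^∞`. -/
noncomputable def transfer (N : ℤ) : CN K N →ₗ[ℂ] CN K N where
  toFun h := ⟨fun m => h.1 (S.Phi m), ContDiff.comp (g := lift h.1) h.2.1 S.smooth, fun m => by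
    change deriv (fun t : ℝ => h.1 (S.Phi (flow Heis.dz t m))) 0 = _
    simp only [Phi_flow_dz]
    exact h.2.2 (S.Phi m)⟩
  map_add' _ _ := rfl
  map_smul' _ _ := rfl

/-- Test functions: smooth complex functions with compact support in `(-δ, δ)` whose norm
`‖η‖_{C^q} = sup_{j ≤ q} 2^(q-j) |η^(j)|_∞` is at most one. -/
def testFns (δ : ℝ) (q : ℕ) : Set (ℝ → ℂ) :=
  {η | ContDiff ℝ ∞ η ∧ HasCompactSupport η ∧ tsupport η ⊆ Set.Ioo (-δ) δ ∧
    ∀ j ≤ q, ∀ t : ℝ, 2 ^ (q - j) * ‖iteratedDeriv j η t‖ ≤ 1}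

/-- The functional `ℓ_{η,m}(h) = ∫_{-δ}^{δ} η(t) h(φ_t^W(m)) dt`. -/
noncomputable def ell (δ : ℝ) (η : ℝ → ℂ) (m : Nil K) (h : Nil K → ℂ) : ℂ :=
  ∫ t in (-δ)..δ, η t * h (flow S.W t m)

/-- The set of values `|ℓ_{η,m}(V^j h)|` whose supremum is the anisotropic norm. -/
def normSet (δ : ℝ) (N : ℤ) (p q : ℕ) (h : CN K N) : Set ℝ :=
  {r | ∃ j ≤ p, ∃ m : Nil K, ∃ η ∈ testFns δ q,
    r = ‖S.ell δ η m (((lieOp S.V N)^[j] h : CN K N) : Nil K → ℂ)‖}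

/-- The anisotropic norm `‖h‖_{p,q}` on `C_N^∞`. -/
noncomputable def aNorm (δ : ℝ) (N : ℤ) (p q : ℕ) (h : CN K N) : ℝ := sSup (S.normSet δ N p q h)

variable (δ : ℝ) (N : ℤ) (p q : ℕ)

theorem norm_testFn {δ : ℝ} {q : ℕ} {η : ℝ → ℂ} (hη : η ∈ testFns δ q) (t : ℝ) : ‖η t‖ ≤ 1 := by
  have h := hη.2.2.2 0 (Nat.zero_le _) t
  rw [iteratedDeriv_zero] at h
  have h2 : (1 : ℝ) ≤ 2 ^ (q - 0) := one_le_pow₀ (by norm_num)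
  nlinarith [norm_nonneg (η t)]

theorem ell_bound {δ : ℝ} {q : ℕ} {η : ℝ → ℂ} (hη : η ∈ testFns δ q) {h : Nil K → ℂ} {C : ℝ}
    (hC : ∀ m, ‖h m‖ ≤ C) (m : Nil K) : ‖S.ell δ η m h‖ ≤ C * |δ - -δ| := by
  refine intervalIntegral.norm_integral_le_of_norm_le_const fun t _ => ?_
  rw [norm_mul]
  have h1 := norm_testFn hη t
  have h2 := hC (flow S.W t m)
  nlinarith [norm_nonneg (η t), norm_nonneg (h (flow S.W t m))]

theorem normSet_bddAbove (h : CN K N) : BddAbove (S.normSet δ N p q h) := by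
  have hb : ∀ j : ℕ, ∃ C : ℝ, ∀ m, ‖(((lieOp S.V N)^[j] h : CN K N) : Nil K → ℂ) m‖ ≤ C :=
    fun j => ((lieOp S.V N)^[j] h).2.1.bounded
  choose C hC using hb
  refine ⟨∑ i ∈ Finset.range (p + 1), |C i| * |δ - -δ|, ?_⟩
  rintro r ⟨j, hj, m, η, hη, rfl⟩
  refine (S.ell_bound hη (hC j) m).trans ?_
  refine (mul_le_mul_of_nonneg_right (le_abs_self _) (abs_nonneg _)).trans ?_
  exact Finset.single_le_sum (f := fun i => |C i| * |δ - -δ|) (fun i _ => by positivity)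
    (Finset.mem_range.2 (Nat.lt_succ_of_le hj))

theorem aNorm_nonneg (h : CN K N) : 0 ≤ S.aNorm δ N p q h := by
  refine Real.sSup_nonneg ?_
  rintro r ⟨j, hj, m, η, hη, rfl⟩
  exact norm_nonneg _

theorem le_aNorm (h : CN K N) {j : ℕ} (hj : j ≤ p) (m : Nil K) {η : ℝ → ℂ} (hη : η ∈ testFns δ q) :
    ‖S.ell δ η m (((lieOp S.V N)^[j] h : CN K N) : Nil K → ℂ)‖ ≤ S.aNorm δ N p q h :=
  le_csSup (S.normSet_bddAbove δ N p q h) ⟨j, hj, m, η, hη, rfl⟩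

theorem aNorm_le (h : CN K N) {B : ℝ} (hB : 0 ≤ B)
    (H : ∀ j ≤ p, ∀ m : Nil K, ∀ η ∈ testFns δ q,
      ‖S.ell δ η m (((lieOp S.V N)^[j] h : CN K N) : Nil K → ℂ)‖ ≤ B) :
    S.aNorm δ N p q h ≤ B := by
  refine Real.sSup_le ?_ hB
  rintro r ⟨j, hj, m, η, hη, rfl⟩
  exact H j hj m η hη

theorem ell_add {δ : ℝ} {q : ℕ} {η : ℝ → ℂ} (hη : η ∈ testFns δ q) (m : Nil K) (f h : CN K N) :
    S.ell δ η m ((f + h : CN K N) : Nil K → ℂ) = S.ell δ η m f + S.ell δ η m h := by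
  unfold ell
  rw [← intervalIntegral.integral_add]
  · simp only [Submodule.coe_add, Pi.add_apply, mul_add]
  · exact (hη.1.continuous.mul (f.2.1.comp_flow S.W m).continuous).intervalIntegrable _ _
  · exact (hη.1.continuous.mul (h.2.1.comp_flow S.W m).continuous).intervalIntegrable _ _

theorem ell_smul (δ : ℝ) (η : ℝ → ℂ) (m : Nil K) (c : ℂ) (h : CN K N) :
    S.ell δ η m ((c • h : CN K N) : Nil K → ℂ) = c * S.ell δ η m h := by
  unfold ell
  rw [← intervalIntegral.integral_const_mul]
  congr 1
  funext t
  simp only [Submodule.coe_smul, Pi.smul_apply, smul_eq_mul]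
  ring

theorem aNorm_add_le (f h : CN K N) :
    S.aNorm δ N p q (f + h) ≤ S.aNorm δ N p q f + S.aNorm δ N p q h := by
  refine S.aNorm_le δ N p q _ (add_nonneg (S.aNorm_nonneg ..) (S.aNorm_nonneg ..)) ?_
  intro j hj m η hη
  rw [iterate_map_add, S.ell_add N hη]
  exact (norm_add_le _ _).trans (add_le_add (S.le_aNorm δ N p q f hj m hη)
    (S.le_aNorm δ N p q h hj m hη))

theorem aNorm_smul_le (c : ℂ) (h : CN K N) :
    S.aNorm δ N p q (c • h) ≤ ‖c‖ * S.aNorm δ N p q h := by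
  refine S.aNorm_le δ N p q _ (mul_nonneg (norm_nonneg _) (S.aNorm_nonneg ..)) ?_
  intro j hj m η hη
  have h1 : (lieOp S.V N)^[j] (c • h) = c • (lieOp S.V N)^[j] h := by
    rw [← Module.End.pow_apply, map_smul, Module.End.pow_apply]
  rw [h1, S.ell_smul, norm_mul]
  exact mul_le_mul_of_nonneg_left (S.le_aNorm δ N p q h hj m hη) (norm_nonneg _)

theorem aNorm_smul (c : ℂ) (h : CN K N) :
    S.aNorm δ N p q (c • h) = ‖c‖ * S.aNorm δ N p q h := by
  refine le_antisymm (S.aNorm_smul_le ..) ?_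
  by_cases hc : c = 0
  · subst hc
    simpa using S.aNorm_nonneg δ N p q _
  · have h1 := S.aNorm_smul_le δ N p q c⁻¹ (c • h)
    rw [inv_smul_smul₀ hc, norm_inv] at h1
    have h2 : 0 < ‖c‖ := norm_pos_iff.2 hc
    calc ‖c‖ * S.aNorm δ N p q h ≤ ‖c‖ * (‖c‖⁻¹ * S.aNorm δ N p q (c • h)) :=
          mul_le_mul_of_nonneg_left h1 h2.le
      _ = S.aNorm δ N p q (c • h) := by field_simp

/-- The space `C_N^∞`, regarded as a normed space with the norm `‖·‖_{p,q}`. -/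
def Pre (_S : PHAut K) (_δ : ℝ) (N : ℤ) (_p _q : ℕ) : Type := CN K N

noncomputable instance : AddCommGroup (S.Pre δ N p q) := inferInstanceAs (AddCommGroup (CN K N))
noncomputable instance : Module ℂ (S.Pre δ N p q) := inferInstanceAs (Module ℂ (CN K N))
noncomputable instance : Norm (S.Pre δ N p q) := ⟨fun h => S.aNorm δ N p q h⟩

theorem core : SeminormedSpace.Core ℂ (S.Pre δ N p q) where
  norm_nonneg := S.aNorm_nonneg δ N p q
  norm_smul := S.aNorm_smul δ N p q
  norm_triangle := S.aNorm_add_le δ N p q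

noncomputable instance : SeminormedAddCommGroup (S.Pre δ N p q) :=
  SeminormedAddCommGroup.ofCore (S.core δ N p q)

noncomputable instance : NormedSpace ℂ (S.Pre δ N p q) where
  norm_smul_le c h := (S.aNorm_smul δ N p q c h).le

/-- The identity map from `C_N^∞` to `C_N^∞` with the norm `‖·‖_{p,q}`. -/
noncomputable def toPre : CN K N ≃ₗ[ℂ] S.Pre δ N p q := LinearEquiv.refl ℂ (CN K N)

/-- The anisotropic Banach space `B_N^{p,q}`: the completion of `C_N^∞` for `‖·‖_{p,q}`. -/
abbrev B : Type := UniformSpace.Completion (S.Pre δ N p q)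

/-- The canonical map from `C_N^∞` to `B_N^{p,q}`. -/
noncomputable def emb (h : CN K N) : S.B δ N p q := (S.toPre δ N p q h : S.Pre δ N p q)

theorem aNorm_lieOp_le {p : ℕ} (hp : 1 ≤ p) (h : CN K N) :
    S.aNorm δ N (p - 1) q (lieOp S.V N h) ≤ S.aNorm δ N p q h := by
  refine S.aNorm_le δ N (p - 1) q _ (S.aNorm_nonneg δ N p q h) ?_
  intro j hj m η hη
  rw [← Function.iterate_succ_apply]
  exact S.le_aNorm δ N p q h (by omega) m hη

/-- The operator `V : C_N^∞ → C_N^∞`, bounded from `‖·‖_{p,q}` to `‖·‖_{p-1,q}`. -/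
noncomputable def VPre {p : ℕ} (hp : 1 ≤ p) : S.Pre δ N p q →L[ℂ] S.Pre δ N (p - 1) q :=
  LinearMap.mkContinuous
    ((S.toPre δ N (p - 1) q).toLinearMap ∘ₗ lieOp S.V N ∘ₗ (S.toPre δ N p q).symm.toLinearMap) 1
    (fun h => (one_mul ‖h‖).symm ▸ S.aNorm_lieOp_le δ N q hp ((S.toPre δ N p q).symm h))

/-- The continuous extension `V : B_N^{p,q} → B_N^{p-1,q}`. -/
noncomputable def VOp {p : ℕ} (hp : 1 ≤ p) : S.B δ N p q →L[ℂ] S.B δ N (p - 1) q :=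
  (S.VPre δ N q hp).completion

/-- `ker_N(V) = {h ∈ B_N^{p,q} : V h = 0}`. -/
noncomputable def kerV {p : ℕ} (hp : 1 ≤ p) : Submodule ℂ (S.B δ N p q) :=
  LinearMap.ker (S.VOp δ N q hp).toLinearMap

end PHAut

/-! Write L for the extended transfer operator (`koop`). Everything rests on the relation V L = λ⁻¹
L V (`lieOp_transfer`, `VPow_koop`): V turns an eigenvector of L for z into one for λz, or kills it.
Four facts about L make this a bijection between annuli and the spectrum on ker V.

Bounded powers. The substitution t ↦ λⁿt along W-orbits stretches test functions, and its Jacobian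
λ⁻ⁿ cancels the growth of their supports. Hence all powers of L are uniformly bounded
(`exists_aNorm_transfer_pow_le`) and eigenvalues have modulus at most 1. Taylor expansion of the
stretched test functions gives a Lasota–Yorke inequality (`exists_lasotaYorke`) with contraction
λ^(-min(p,q)n) up to finitely many functionals, so Riesz theory applies outside that radius.

Eigenvalues on ker V are larger than λ⁻¹ in modulus (`inv_lam_lt_norm_of_eigen`). The flows of V and
W commute up to the centre, which acts on C_N^∞ by a nontrivial character as N ≠ 0; so translating
along V is modulating along W. For x in ker V, Fourier inversion writes every pairing as a
superposition of V-translates of the pairing with one fixed cutoff. These translates are almost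
orthogonal on W-orbits, so pairings with test functions ψ(at) have mean square O(a^(-1/2)). If |z| ≤
λ⁻¹, the eigenvalue equation transports this smallness to all pairings of x, averaged over W-orbits
of length λⁿ; by translation invariance on the torus they vanish. The same representation shows that
ker V is finite-dimensional (`finiteDimensional_kerV`).

V has dense range (`denseRange_VOp`): f differs from an element of V(C_N^∞) by a far V-translate of
f, which is small by oscillation.

Elements of ker V have arbitrary regularity along V, so eigenvectors in ker V pass between different
p (`exists_eigen_kerV_lift`).

Conclusion. If z is in the spectrum and in the k-th annulus, it has an eigenvector x. V^(k+1)x = 0,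
since |λ^(k+1) z| > 1, and the last nonzero V^j x lies in ker V with |λ^j z| > λ⁻¹, forcing j = k.
Conversely, let λ^k z be an eigenvalue on ker V and suppose L - z is onto. Applying V^k shows that L
- λ^k z has dense range on B^{p-k,q}; outside the essential radius dense range implies injectivity,
contradicting the eigenvector in ker V. -/

open scoped ContDiff

/-! Riesz theory for operators whose powers are small up to finitely many functionals. -/

section Riesz

open Filter Topology

variable {X : Type*} [NormedAddCommGroup X] [NormedSpace ℂ X]

/-- The essential spectral radius of `L` is at most `r`, in the form of a bound on all powers of
`L` up to finitely many functionals. -/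
def QuasiCompact (L : X →L[ℂ] X) (r : ℝ) : Prop :=
  ∃ C : ℝ, ∀ n : ℕ, ∃ (ι : Type) (_ : Fintype ι) (l : X →L[ℂ] (ι → ℂ)),
    ∀ x, ‖(L ^ n) x‖ ≤ C * r ^ n * ‖x‖ + ‖l x‖

theorem QuasiCompact.exists_pow_le {L : X →L[ℂ] X} {r : ℝ} (h : QuasiCompact L r) (hr : 0 ≤ r)
    {z : ℂ} (hz : r < ‖z‖) {ε : ℝ} (hε : 0 < ε) :
    ∃ (n : ℕ) (ι : Type) (_ : Fintype ι) (l : X →L[ℂ] (ι → ℂ)),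
      ∀ x, ‖(L ^ n) x‖ ≤ ε * ‖z‖ ^ n * ‖x‖ + ‖l x‖ := by
  obtain ⟨C, hC⟩ := h
  have hz0 : 0 < ‖z‖ := hr.trans_lt hz
  -- The gap r < |z| makes C (r/|z|)ⁿ as small as desired; one such n is enough for all the Riesz
  -- arguments.
  have h1 : Tendsto (fun n : ℕ => |C| * (r / ‖z‖) ^ n) atTop (𝓝 (|C| * 0)) :=
    (tendsto_pow_atTop_nhds_zero_of_lt_one (by positivity) ((div_lt_one hz0).2 hz)).const_mul _
  rw [mul_zero] at h1
  obtain ⟨n, hn⟩ := (h1.eventually_lt_const hε).exists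
  obtain ⟨ι, hι, l, hl⟩ := hC n
  refine ⟨n, ι, hι, l, fun x => (hl x).trans ?_⟩
  rw [div_pow, mul_div_assoc', div_lt_iff₀ (by positivity)] at hn
  have h2 : C * r ^ n ≤ ε * ‖z‖ ^ n :=
    (mul_le_mul_of_nonneg_right (le_abs_self C) (by positivity)).trans hn.le
  gcongr

theorem exists_subseq_tendsto_of_bounded {ι : Type*} [Fintype ι] (l : X →L[ℂ] (ι → ℂ))
    {x : ℕ → X} {R : ℝ} (hx : ∀ n, ‖x n‖ ≤ R) :
    ∃ φ : ℕ → ℕ, StrictMono φ ∧ CauchySeq fun n => l (x (φ n)) := by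
  have h1 : Bornology.IsBounded (Set.range fun n => l (x n)) := by
    rw [isBounded_iff_forall_norm_le]
    refine ⟨‖l‖ * R, ?_⟩
    rintro _ ⟨n, rfl⟩
    exact (l.le_opNorm _).trans (mul_le_mul_of_nonneg_left (hx n) (norm_nonneg _))
  obtain ⟨a, -, φ, hφ, ha⟩ := tendsto_subseq_of_bounded h1 (fun n => Set.mem_range_self n)
  exact ⟨φ, hφ, ha.cauchySeq⟩

/-- The geometric sum lets the estimate for `L ^ n` be used for `L - z`: modulo the image of `L -
z`, the power acts as the scalar zⁿ. -/
theorem exists_factor_pow_sub (L : X →L[ℂ] X) (z : ℂ) (n : ℕ) :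
    ∃ Q : X →L[ℂ] X, Commute Q (L - z • 1) ∧ L ^ n - z ^ n • 1 = Q * (L - z • 1) := by
  have hc : Commute L (z • (1 : X →L[ℂ] X)) := (Commute.one_right L).smul_right z
  refine ⟨∑ i ∈ Finset.range n, L ^ i * (z • (1 : X →L[ℂ] X)) ^ (n - 1 - i), ?_, ?_⟩
  · have h1 : Commute L (L - z • 1) := (Commute.refl L).sub_right hc
    have h2 : Commute (z • (1 : X →L[ℂ] X)) (L - z • 1) := (Commute.one_left _).smul_left z
    exact Commute.sum_left _ _ _ fun i _ => (h1.pow_left i).mul_left (h2.pow_left _)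
  · rw [hc.geom_sum₂_mul, smul_pow, one_pow]

/-- `L - z` is proper on bounded sets outside the essential spectral radius. -/
theorem QuasiCompact.exists_subseq [CompleteSpace X] {L : X →L[ℂ] X} {r : ℝ}
    (h : QuasiCompact L r) (hr : 0 ≤ r) {z : ℂ} (hz : r < ‖z‖) {x : ℕ → X} {R : ℝ}
    (hx : ∀ n, ‖x n‖ ≤ R) (hT : CauchySeq fun n => (L - z • 1) (x n)) :
    ∃ φ : ℕ → ℕ, StrictMono φ ∧ ∃ a, Tendsto (fun n => x (φ n)) atTop (𝓝 a) := by
  have hz0 : 0 < ‖z‖ := hr.trans_lt hz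
  -- In |z|ⁿ‖y‖ ≤ ‖Lⁿy‖ + ‖(Lⁿ - zⁿ)y‖ half of the left side is absorbed; the finitely many
  -- functionals and the image under `L - z` are Cauchy along the subsequence and account for a
  -- quarter each.
  obtain ⟨n, ι, hι, l, hl⟩ := h.exists_pow_le hr hz (ε := 1 / 2) (by norm_num)
  obtain ⟨φ, hφ, hc⟩ := exists_subseq_tendsto_of_bounded l hx
  refine ⟨φ, hφ, cauchySeq_tendsto_of_complete ?_⟩
  obtain ⟨Q, -, hQ⟩ := exists_factor_pow_sub L z n
  have hT' : CauchySeq fun m => (L - z • 1) (x (φ m)) := hT.comp_tendsto hφ.tendsto_atTop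
  have hw : CauchySeq fun m => (L ^ n - z ^ n • 1) (x (φ m)) := by
    rw [hQ]
    exact Q.uniformContinuous.comp_cauchySeq hT'
  rw [Metric.cauchySeq_iff] at hc hw ⊢
  intro ε hε
  have hp : 0 < ‖z‖ ^ n := pow_pos hz0 n
  obtain ⟨N1, hN1⟩ := hc (ε * ‖z‖ ^ n / 4) (by positivity)
  obtain ⟨N2, hN2⟩ := hw (ε * ‖z‖ ^ n / 4) (by positivity)
  refine ⟨max N1 N2, fun i hi j hj => ?_⟩
  have h1 := hN1 i (le_of_max_le_left hi) j (le_of_max_le_left hj)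
  have h2 := hN2 i (le_of_max_le_right hi) j (le_of_max_le_right hj)
  rw [dist_eq_norm, ← map_sub] at h1 h2
  rw [dist_eq_norm]
  set y := x (φ i) - x (φ j)
  have h3 := hl y
  have h4 : z ^ n • y = (L ^ n) y - (L ^ n - z ^ n • 1) y := by simp
  have h5 : ‖z‖ ^ n * ‖y‖ ≤ ‖(L ^ n) y‖ + ‖(L ^ n - z ^ n • 1) y‖ := by
    rw [← norm_pow, ← norm_smul, h4]
    exact norm_sub_le _ _
  by_contra! hcon
  nlinarith [mul_le_mul_of_nonneg_left hcon hp.le]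

/-- A substitute for compactness of `L ^ n`: it contradicts any bounded sequence whose images under
`L ^ n` stay |z|ⁿ apart. Riesz' lemma produces such sequences from strictly monotone chains of
kernels or ranges. -/
theorem QuasiCompact.exists_dist_lt {L : X →L[ℂ] X} {r : ℝ}
    (h : QuasiCompact L r) (hr : 0 ≤ r) {z : ℂ} (hz : r < ‖z‖) {R : ℝ} (hR : 0 < R) :
    ∃ n : ℕ, ∀ x : ℕ → X, (∀ m, ‖x m‖ ≤ R) →
      ∃ i j, i < j ∧ ‖(L ^ n) (x i - x j)‖ < ‖z‖ ^ n := by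
  have hz0 : 0 < ‖z‖ := hr.trans_lt hz
  -- Differences have norm at most 2R, so this ε contributes |z|ⁿ/2; the functionals contribute less
  -- than |z|ⁿ/4.
  obtain ⟨n, ι, hι, l, hl⟩ := h.exists_pow_le hr hz (ε := 1 / (4 * R)) (by positivity)
  refine ⟨n, fun x hx => ?_⟩
  obtain ⟨φ, hφ, hc⟩ := exists_subseq_tendsto_of_bounded l hx
  rw [Metric.cauchySeq_iff] at hc
  have hp : 0 < ‖z‖ ^ n := pow_pos hz0 n
  obtain ⟨N, hN⟩ := hc (‖z‖ ^ n / 4) (by positivity)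
  refine ⟨φ N, φ (N + 1), hφ (Nat.lt_succ_self N), ?_⟩
  have h1 := hN N le_rfl (N + 1) (Nat.le_succ N)
  rw [dist_eq_norm, ← map_sub] at h1
  have h2 : ‖x (φ N) - x (φ (N + 1))‖ ≤ 2 * R := by
    have := norm_sub_le (x (φ N)) (x (φ (N + 1)))
    linarith [hx (φ N), hx (φ (N + 1))]
  calc ‖(L ^ n) (x (φ N) - x (φ (N + 1)))‖
      ≤ 1 / (4 * R) * ‖z‖ ^ n * (2 * R) + ‖z‖ ^ n / 4 :=
        (hl _).trans (add_le_add (mul_le_mul_of_nonneg_left h2 (by positivity)) h1.le)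
    _ = ‖z‖ ^ n * (3 / 4) := by field_simp; ring
    _ < ‖z‖ ^ n := by linarith

/-- Otherwise there are vectors, at normalised distance one from the kernel, whose images tend to
zero. A subsequence converges to a kernel element, which brings the vectors closer to the kernel
than their distance from it. -/
theorem QuasiCompact.exists_preimage_le [CompleteSpace X] {L : X →L[ℂ] X} {r : ℝ}
    (h : QuasiCompact L r) (hr : 0 ≤ r) {z : ℂ} (hz : r < ‖z‖) :
    ∃ C : ℝ, ∀ x, ∃ e, (L - z • 1) e = (L - z • 1) x ∧ ‖e‖ ≤ C * ‖(L - z • 1) x‖ := by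
  by_contra! hcon
  set T := L - z • (1 : X →L[ℂ] X) with hTdef
  choose x hx using fun m : ℕ => hcon m
  set E : Set X := {e | T e = 0} with hE
  have hEc : IsClosed E := isClosed_singleton.preimage T.continuous
  have hE0 : E.Nonempty := ⟨0, map_zero T⟩
  have hpos : ∀ m, 0 < Metric.infDist (x m) E := by
    intro m
    rw [← hEc.notMem_iff_infDist_pos hE0]
    intro hmem
    have h0 : T (x m) = 0 := hmem
    have := hx m 0 (by rw [map_zero, h0])
    rw [h0] at this
    simp at this
  have hle : ∀ m : ℕ, (m : ℝ) * ‖T (x m)‖ ≤ Metric.infDist (x m) E := by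
    intro m
    refine (Metric.le_infDist hE0).2 fun e he => ?_
    rw [dist_eq_norm]
    have he' : T e = 0 := he
    exact (hx m (x m - e) (by rw [map_sub, he', sub_zero])).le
  have hex : ∀ m, ∃ e ∈ E, dist (x m) e < 2 * Metric.infDist (x m) E := fun m =>
    (Metric.infDist_lt_iff hE0).1 (by linarith [hpos m])
  choose e he hde using hex
  set d := fun m => Metric.infDist (x m) E with hd
  set y : ℕ → X := fun m => ((d m)⁻¹ : ℂ) • (x m - e m) with hy
  have hTy : ∀ m, T (y m) = ((d m)⁻¹ : ℂ) • T (x m) := by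
    intro m
    have he' : T (e m) = 0 := he m
    rw [hy, map_smul, map_sub, he', sub_zero]
  have hnorm : ∀ m, ‖((d m)⁻¹ : ℂ)‖ = (d m)⁻¹ := by
    intro m
    rw [norm_inv, Complex.norm_of_nonneg (hpos m).le]
  have hyb : ∀ m, ‖y m‖ ≤ 2 := by
    intro m
    rw [hy, norm_smul, hnorm, inv_mul_le_iff₀ (hpos m), ← dist_eq_norm]
    linarith [hde m]
  have hT0 : Tendsto (fun m => T (y m)) atTop (𝓝 0) := by
    refine squeeze_zero_norm' (a := fun m : ℕ => ((m : ℝ))⁻¹) ?_ tendsto_inv_atTop_nhds_zero_nat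
    filter_upwards [eventually_gt_atTop 0] with m hm
    have hm' : (0 : ℝ) < m := by exact_mod_cast hm
    rw [hTy, norm_smul, hnorm, inv_mul_le_iff₀ (hpos m), ← div_eq_mul_inv, le_div_iff₀ hm']
    linarith [hle m, mul_comm (m : ℝ) ‖T (x m)‖]
  obtain ⟨φ, hφ, a, ha⟩ := h.exists_subseq hr hz hyb hT0.cauchySeq
  have hTa : T a = 0 :=
    tendsto_nhds_unique ((T.continuous.tendsto a).comp ha) (hT0.comp hφ.tendsto_atTop)
  obtain ⟨m, hm⟩ := ((Metric.tendsto_nhds.1 ha) 1 one_pos).exists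
  -- This kernel element is at distance `d (φ m) * ‖y (φ m) - a‖ < d (φ m)` from `x (φ m)`, against
  -- the definition of d.
  have hmem : e (φ m) + (d (φ m) : ℂ) • a ∈ E := by
    have he' : T (e (φ m)) = 0 := he (φ m)
    change T _ = 0
    rw [map_add, map_smul, he', hTa]
    simp
  have h1 := Metric.infDist_le_dist_of_mem (x := x (φ m)) hmem
  have hne : (d (φ m) : ℂ) ≠ 0 := by exact_mod_cast (hpos (φ m)).ne'
  have h2 : x (φ m) - (e (φ m) + (d (φ m) : ℂ) • a) = (d (φ m) : ℂ) • (y (φ m) - a) := by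
    rw [smul_sub, hy, smul_inv_smul₀ hne]
    abel
  rw [dist_eq_norm, h2, norm_smul, Complex.norm_of_nonneg (hpos _).le, ← dist_eq_norm] at h1
  change d (φ m) ≤ _ at h1
  have := hpos (φ m)
  change 0 < d (φ m) at this
  nlinarith

/-- The range of `L - z` is closed outside the essential spectral radius. -/
theorem QuasiCompact.surjective_of_dense [CompleteSpace X] {L : X →L[ℂ] X} {r : ℝ}
    (h : QuasiCompact L r) (hr : 0 ≤ r) {z : ℂ} (hz : r < ‖z‖)
    (hd : DenseRange (L - z • (1 : X →L[ℂ] X))) :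
    Function.Surjective (L - z • (1 : X →L[ℂ] X)) := by
  intro y
  obtain ⟨C, hC⟩ := h.exists_preimage_le hr hz
  obtain ⟨w, hw, hwy⟩ := mem_closure_iff_seq_limit.1 (hd y)
  choose x hx using hw
  choose e he heC using hC
  obtain ⟨B, hB⟩ := hwy.norm.bddAbove_range
  have hb : ∀ n, ‖e (x n)‖ ≤ |C| * B := by
    intro n
    refine (heC (x n)).trans (mul_le_mul (le_abs_self C) ?_ (norm_nonneg _) (abs_nonneg _))
    rw [hx]
    exact hB ⟨n, rfl⟩
  have hc : CauchySeq fun n => (L - z • (1 : X →L[ℂ] X)) (e (x n)) := by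
    simp only [he, hx]
    exact hwy.cauchySeq
  obtain ⟨φ, hφ, a, ha⟩ := h.exists_subseq hr hz hb hc
  refine ⟨a, tendsto_nhds_unique
    (((L - z • (1 : X →L[ℂ] X)).continuous.tendsto a).comp ha) ?_⟩
  have h3 : ((L - z • (1 : X →L[ℂ] X)) ∘ fun n => e (x (φ n))) = fun n => w (φ n) := by
    funext n
    simp only [Function.comp, he, hx]
  rw [h3]
  exact hwy.comp hφ.tendsto_atTop

/-- Outside the essential spectral radius, `L - z` is injective if its range is dense. -/
theorem QuasiCompact.injective_of_dense [CompleteSpace X] {L : X →L[ℂ] X} {r : ℝ}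
    (h : QuasiCompact L r) (hr : 0 ≤ r) {z : ℂ} (hz : r < ‖z‖)
    (hd : DenseRange (L - z • (1 : X →L[ℂ] X))) :
    Function.Injective (L - z • (1 : X →L[ℂ] X)) := by
  have hs := h.surjective_of_dense hr hz hd
  set T := L - z • (1 : X →L[ℂ] X) with hTdef
  rw [injective_iff_map_eq_zero]
  by_contra! hcon
  obtain ⟨u, hu, hu0⟩ := hcon
  have hpow : ∀ m : ℕ, Function.Surjective (T ^ m : X →L[ℂ] X) := by
    intro m
    rw [FunLike.coe_pow_eq_iterate]
    exact hs.iterate m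
  -- Riesz' lemma with the scalar 2 yields vectors of norm at most R for any R > 2.
  obtain ⟨n, hn⟩ := h.exists_dist_lt hr hz (R := 3) (by norm_num)
  obtain ⟨Q, hQc, hQ⟩ := exists_factor_pow_sub L z n
  have hp : 0 < ‖z‖ ^ n := pow_pos (hr.trans_lt hz) n
  have hzn : z ^ n ≠ 0 := pow_ne_zero n (norm_pos_iff.1 (hr.trans_lt hz))
  let K : ℕ → Submodule ℂ X := fun m => LinearMap.ker (T ^ m : X →L[ℂ] X).toLinearMap
  have hKmem : ∀ m v, v ∈ K m ↔ (T ^ m) v = 0 := fun m v => Iff.rfl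
  have hKmono : ∀ {i j v}, i ≤ j → v ∈ K i → v ∈ K j := by
    intro i j v hij hv
    rw [hKmem] at hv ⊢
    rw [← Nat.sub_add_cancel hij, pow_add, mul_apply_eq_comp, hv, map_zero]
  -- Surjectivity of T provides preimages of the kernel vector u under every power, so the kernels
  -- of the powers increase strictly.
  have hx : ∀ m, ∃ x ∈ K (m + 1), ‖x‖ ≤ 3 ∧ ∀ y ∈ K m, 1 ≤ ‖x - y‖ := by
    intro m
    have hcl : IsClosed ((K m).comap (K (m + 1)).subtype : Set (K (m + 1))) :=
      (isClosed_singleton.preimage (T ^ m).continuous).preimage continuous_subtype_val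
    have hne : ∃ x : K (m + 1), x ∉ (K m).comap (K (m + 1)).subtype := by
      obtain ⟨v, hv⟩ := hpow m u
      refine ⟨⟨v, ?_⟩, ?_⟩
      · rw [hKmem, pow_succ', mul_apply_eq_comp, hv, hu]
      · change ¬ (T ^ m) v = 0
        rwa [hv]
    obtain ⟨x, hx3, hx1⟩ := riesz_lemma_of_norm_lt (c := (2 : ℂ)) (by norm_num) (R := 3)
      (by norm_num) hcl hne
    exact ⟨x, x.2, hx3, fun y hy => hx1 ⟨y, hKmono (Nat.le_succ m) hy⟩ hy⟩
  choose x hxK hx3 hx1 using hx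
  obtain ⟨i, j, hij, hlt⟩ := hn x hx3
  have hQmem : ∀ v, v ∈ K (j + 1) → (L ^ n - z ^ n • 1) v ∈ K j := by
    intro v hv
    rw [hKmem] at hv ⊢
    rw [hQ, ← mul_apply_eq_comp, ← mul_assoc, ← (hQc.pow_right j).eq, mul_assoc,
      ← pow_succ, mul_apply_eq_comp, hv, map_zero]
  have hxi : x i ∈ K (j + 1) := hKmono (by omega) (hxK i)
  have hw : (z ^ n)⁻¹ • ((L ^ n - z ^ n • 1) (x i - x j)) + x i ∈ K j :=
    (K j).add_mem ((K j).smul_mem _ (hQmem _ ((K (j + 1)).sub_mem hxi (hxK j))))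
      (hKmono (by omega) (hxK i))
  have h1 := hx1 j _ hw
  -- Modulo `K j` the power acts on `K (j + 1)` as zⁿ, so the left side is -zⁿ times `x j` minus an
  -- element of `K j`, and has norm at least |z|ⁿ.
  have h2 : (L ^ n) (x i - x j) =
      -(z ^ n • (x j - ((z ^ n)⁻¹ • ((L ^ n - z ^ n • 1) (x i - x j)) + x i))) := by
    rw [smul_sub, smul_add, smul_inv_smul₀ hzn]
    simp only [sub_apply, smul_apply,
      one_apply_eq_self, smul_sub]
    abel
  rw [h2, norm_neg, norm_smul, norm_pow] at hlt
  nlinarith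

/-- Outside the essential spectral radius, `L - z` is bijective if it is injective. -/
theorem QuasiCompact.surjective_of_injective [CompleteSpace X] {L : X →L[ℂ] X} {r : ℝ}
    (h : QuasiCompact L r) (hr : 0 ≤ r) {z : ℂ} (hz : r < ‖z‖)
    (hi : Function.Injective (L - z • (1 : X →L[ℂ] X))) :
    Function.Surjective (L - z • (1 : X →L[ℂ] X)) := by
  obtain ⟨C, hC⟩ := h.exists_preimage_le hr hz
  set T := L - z • (1 : X →L[ℂ] X) with hTdef
  -- Injectivity turns the bounded choice of preimages into a lower bound for T; this makes the
  -- ranges of all powers closed, as Riesz' lemma requires.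
  have hanti : AntilipschitzWith C.toNNReal T := by
    refine ContinuousLinearMap.antilipschitz_of_bound T fun x => ?_
    obtain ⟨e, he, heC⟩ := hC x
    rw [hi he] at heC
    exact heC.trans (mul_le_mul_of_nonneg_right (Real.le_coe_toNNReal C) (norm_nonneg _))
  by_contra hcon
  obtain ⟨u, hu⟩ : ∃ u, ∀ v, T v ≠ u := by
    simpa [Function.Surjective] using hcon
  obtain ⟨n, hn⟩ := h.exists_dist_lt hr hz (R := 3) (by norm_num)
  obtain ⟨Q, hQc, hQ⟩ := exists_factor_pow_sub L z n
  have hp : 0 < ‖z‖ ^ n := pow_pos (hr.trans_lt hz) n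
  have hzn : z ^ n ≠ 0 := pow_ne_zero n (norm_pos_iff.1 (hr.trans_lt hz))
  let K : ℕ → Submodule ℂ X := fun m => LinearMap.range (T ^ m : X →L[ℂ] X).toLinearMap
  have hKmem : ∀ m v, v ∈ K m ↔ ∃ w, (T ^ m) w = v := fun m v => Iff.rfl
  have hKmono : ∀ {i j v}, i ≤ j → v ∈ K j → v ∈ K i := by
    intro i j v hij hv
    rw [hKmem] at hv ⊢
    obtain ⟨w, rfl⟩ := hv
    refine ⟨(T ^ (j - i)) w, ?_⟩
    rw [← mul_apply_eq_comp, ← pow_add, Nat.add_sub_cancel' hij]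
  have hKcl : ∀ m, IsClosed (K m : Set X) := by
    intro m
    have h1 : (K m : Set X) = Set.range T^[m] := by
      ext v
      simp only [SetLike.mem_coe, hKmem, Set.mem_range, FunLike.coe_pow_eq_iterate]
    have h2 : ∃ c, AntilipschitzWith c T^[m] := by
      induction m with
      | zero => exact ⟨1, AntilipschitzWith.id⟩
      | succ m ih =>
        obtain ⟨c, hc⟩ := ih (by ext v; simp only [SetLike.mem_coe, hKmem, Set.mem_range,
          FunLike.coe_pow_eq_iterate])
        exact ⟨_, hc.comp hanti⟩
    obtain ⟨c, hc⟩ := h2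
    rw [h1]
    exact hc.isClosed_range (UniformContinuous.iterate T m T.uniformContinuous)
  have hx : ∀ m, ∃ x ∈ K m, ‖x‖ ≤ 3 ∧ ∀ y ∈ K (m + 1), 1 ≤ ‖x - y‖ := by
    intro m
    have hcl : IsClosed ((K (m + 1)).comap (K m).subtype : Set (K m)) :=
      (hKcl (m + 1)).preimage continuous_subtype_val
    have hne : ∃ x : K m, x ∉ (K (m + 1)).comap (K m).subtype := by
      refine ⟨⟨(T ^ m) u, u, rfl⟩, ?_⟩
      rintro ⟨w, hw⟩
      have hw' : (T ^ (m + 1)) w = (T ^ m) u := hw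
      rw [pow_succ, mul_apply_eq_comp] at hw'
      rw [FunLike.coe_pow_eq_iterate] at hw'
      exact hu w (hi.iterate m hw')
    obtain ⟨x, hx3, hx1⟩ := riesz_lemma_of_norm_lt (c := (2 : ℂ)) (by norm_num) (R := 3)
      (by norm_num) hcl hne
    exact ⟨x, x.2, hx3, fun y hy => hx1 ⟨y, hKmono (Nat.le_succ m) hy⟩ hy⟩
  choose x hxK hx3 hx1 using hx
  obtain ⟨i, j, hij, hlt⟩ := hn x hx3
  have hQmem : ∀ v, v ∈ K i → (L ^ n - z ^ n • 1) v ∈ K (i + 1) := by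
    intro v hv
    rw [hKmem] at hv ⊢
    obtain ⟨w, rfl⟩ := hv
    refine ⟨Q w, ?_⟩
    rw [hQ, ← mul_apply_eq_comp, ← mul_apply_eq_comp,
      ← (hQc.pow_right (i + 1)).eq, mul_assoc, ← pow_succ']
  have hxj : x j ∈ K i := hKmono hij.le (hxK j)
  have hw : x j - (z ^ n)⁻¹ • ((L ^ n - z ^ n • 1) (x i - x j)) ∈ K (i + 1) :=
    (K (i + 1)).sub_mem (hKmono hij (hxK j))
      ((K (i + 1)).smul_mem _ (hQmem _ ((K i).sub_mem (hxK i) hxj)))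
  have h1 := hx1 i _ hw
  -- Dual to the chain of kernels: modulo `K (i + 1)` the power acts on `K i` as zⁿ, and `x i` is at
  -- distance at least one from `K (i + 1)`.
  have h2 : (L ^ n) (x i - x j) =
      z ^ n • (x i - (x j - (z ^ n)⁻¹ • ((L ^ n - z ^ n • 1) (x i - x j)))) := by
    rw [smul_sub, smul_sub, smul_inv_smul₀ hzn]
    simp only [sub_apply, smul_apply,
      one_apply_eq_self, smul_sub]
    abel
  rw [h2, norm_smul, norm_pow] at hlt
  nlinarith

/-- Outside the essential spectral radius, the spectrum consists of eigenvalues. -/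
theorem QuasiCompact.exists_eigenvector [CompleteSpace X] {L : X →L[ℂ] X} {r : ℝ}
    (h : QuasiCompact L r) (hr : 0 ≤ r) {z : ℂ} (hz : r < ‖z‖) (hs : z ∈ spectrum ℂ L) :
    ∃ u : X, u ≠ 0 ∧ L u = z • u := by
  by_contra! hcon
  have hi : Function.Injective (L - z • (1 : X →L[ℂ] X)) := by
    rw [injective_iff_map_eq_zero]
    intro u hu
    by_contra hu0
    exact hcon u hu0 (sub_eq_zero.1 (by simpa using hu))
  refine (spectrum.mem_iff.1 hs) ?_
  rw [← IsUnit.neg_iff, neg_sub, Algebra.algebraMap_eq_smul_one,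
    ContinuousLinearMap.isUnit_iff_bijective]
  exact ⟨hi, h.surjective_of_injective hr hz hi⟩

end Riesz

/-! ### Parametric integrals and bounds for derivatives -/

section Calculus

open MeasureTheory

theorem hasFDerivAt_intervalIntegral_param {E F : Type} [NormedAddCommGroup E] [NormedSpace ℝ E]
    [ProperSpace E] [NormedAddCommGroup F] [NormedSpace ℝ F] [CompleteSpace F]
    {f : E × ℝ → F} (hf : ContDiff ℝ 1 f) (a b : ℝ) (u : E) :
    HasFDerivAt (fun u => ∫ t in a..b, f (u, t))
      (∫ t in a..b, (fderiv ℝ f (u, t)).comp (ContinuousLinearMap.inl ℝ E ℝ)) u := by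
  have hc : Continuous fun y : E × ℝ =>
      (fderiv ℝ f y).comp (ContinuousLinearMap.inl ℝ E ℝ) :=
    (hf.continuous_fderiv (by simp)).clm_comp continuous_const
  have hK : IsCompact (Metric.closedBall u 1 ×ˢ Set.uIcc a b) :=
    (isCompact_closedBall u 1).prod isCompact_uIcc
  obtain ⟨C, hC⟩ := hK.exists_bound_of_continuousOn hc.continuousOn
  refine (intervalIntegral.hasFDerivAt_integral_of_dominated_of_fderiv_le
    (s := Metric.closedBall u 1)
    (F' := fun x t => (fderiv ℝ f (x, t)).comp (ContinuousLinearMap.inl ℝ E ℝ))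
    (bound := fun _ => C) (Metric.closedBall_mem_nhds u one_pos)
    (Filter.Eventually.of_forall fun x => ?_) ?_ ?_ ?_ ?_ ?_)
  · exact (hf.continuous.comp (by fun_prop : Continuous fun t : ℝ => (x, t))).aestronglyMeasurable
  · exact (hf.continuous.comp
      (by fun_prop : Continuous fun t : ℝ => (u, t))).intervalIntegrable _ _
  · exact (hc.comp (by fun_prop : Continuous fun t : ℝ => (u, t))).aestronglyMeasurable
  · exact Filter.Eventually.of_forall fun t ht x hx => hC (x, t) ⟨hx, Set.uIoc_subset_uIcc ht⟩
  · exact intervalIntegrable_const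
  · refine Filter.Eventually.of_forall fun t _ x _ => ?_
    have h1 : HasFDerivAt f (fderiv ℝ f (x, t)) (x, t) :=
      (hf.differentiable (by simp) _).hasFDerivAt
    exact h1.comp x (hasFDerivAt_prodMk_left x t)

theorem contDiff_intervalIntegral_param {E F : Type} [NormedAddCommGroup E] [NormedSpace ℝ E]
    [ProperSpace E] [NormedAddCommGroup F] [NormedSpace ℝ F] [CompleteSpace F]
    {f : E × ℝ → F} (hf : ContDiff ℝ ∞ f) (a b : ℝ) :
    ContDiff ℝ ∞ (fun u => ∫ t in a..b, f (u, t)) := by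
  rw [contDiff_infty]
  intro n
  -- The target space varies because the derivative is again a parametric integral, with values in
  -- continuous linear maps.
  induction n generalizing F with
  | zero =>
    refine contDiff_zero.2 (continuous_iff_continuousAt.2 fun u => ?_)
    exact (hasFDerivAt_intervalIntegral_param (hf.of_le (by exact_mod_cast le_top)) a b u).continuousAt
  | succ n ih =>
    push_cast
    rw [contDiff_succ_iff_fderiv]
    have h1 : ∀ u, HasFDerivAt (fun u => ∫ t in a..b, f (u, t))
      (∫ t in a..b, (fderiv ℝ f (u, t)).comp (ContinuousLinearMap.inl ℝ E ℝ)) u := fun u =>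
        hasFDerivAt_intervalIntegral_param (hf.of_le (by exact_mod_cast le_top)) a b u
    refine ⟨fun u => (h1 u).differentiableAt, by simp, ?_⟩
    have h2 : (fderiv ℝ fun u => ∫ t in a..b, f (u, t)) =
        fun u => ∫ t in a..b, (fderiv ℝ f (u, t)).comp (ContinuousLinearMap.inl ℝ E ℝ) :=
      funext fun u => (h1 u).fderiv
    rw [h2]
    exact ih (f := fun y => (fderiv ℝ f y).comp (ContinuousLinearMap.inl ℝ E ℝ))
      ((hf.fderiv_right (by simp)).clm_comp contDiff_const)

/-- Differentiation under the integral sign in one real parameter. -/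
theorem hasDerivAt_intervalIntegral_param {f : ℝ × ℝ → ℂ} (hf : ContDiff ℝ ∞ f) {f' : ℝ → ℂ}
    {s : ℝ} (a b : ℝ) (h' : ∀ t, HasDerivAt (fun s => f (s, t)) (f' t) s) :
    HasDerivAt (fun s => ∫ t in a..b, f (s, t)) (∫ t in a..b, f' t) s := by
  have hf1 : ContDiff ℝ 1 f := hf.of_le (by exact_mod_cast le_top)
  have h1 := (hasFDerivAt_intervalIntegral_param hf1 a b s).hasDerivAt
  refine h1.congr_deriv ?_
  rw [ContinuousLinearMap.intervalIntegral_apply]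
  · refine intervalIntegral.integral_congr fun t _ => ?_
    have h2 : HasFDerivAt f (fderiv ℝ f (s, t)) (s, t) :=
      (hf1.differentiable (by simp) _).hasFDerivAt
    exact ((h2.comp s (hasFDerivAt_prodMk_left s t)).hasDerivAt).unique (h' t)
  · exact Continuous.intervalIntegrable (((hf1.continuous_fderiv (by simp)).clm_comp
      continuous_const).comp (by fun_prop : Continuous fun t : ℝ => (s, t))) _ _

/-- All derivatives of `ψ` up to order `q` are bounded by `B`. -/
def DerivBound (q : ℕ) (B : ℝ) (ψ : ℝ → ℂ) : Prop :=
  ∀ j ≤ q, ∀ t, ‖iteratedDeriv j ψ t‖ ≤ B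

theorem DerivBound.nonneg {q : ℕ} {B : ℝ} {ψ : ℝ → ℂ} (h : DerivBound q B ψ) : 0 ≤ B :=
  (norm_nonneg _).trans (h 0 (Nat.zero_le q) 0)

theorem DerivBound.norm_le {q : ℕ} {B : ℝ} {ψ : ℝ → ℂ} (h : DerivBound q B ψ) (t : ℝ) :
    ‖ψ t‖ ≤ B := by
  simpa using h 0 (Nat.zero_le q) t

theorem norm_iteratedDeriv_mul_le {ψ φ : ℝ → ℂ} (hψ : ContDiff ℝ ∞ ψ) (hφ : ContDiff ℝ ∞ φ)
    {j : ℕ} {t A B : ℝ} (hA : ∀ i ≤ j, ‖iteratedDeriv i ψ t‖ ≤ A)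
    (hB : ∀ i ≤ j, ‖iteratedDeriv i φ t‖ ≤ B) :
    ‖iteratedDeriv j (fun t => ψ t * φ t) t‖ ≤ 2 ^ j * A * B := by
  have hle : (j : WithTop ℕ∞) ≤ ∞ := by exact_mod_cast le_top
  have hA0 : 0 ≤ A := (norm_nonneg _).trans (hA 0 (Nat.zero_le _))
  rw [iteratedDeriv_fun_mul (hψ.of_le hle).contDiffAt (hφ.of_le hle).contDiffAt]
  calc _ ≤ ∑ i ∈ Finset.range (j + 1), (j.choose i : ℝ) * (A * B) := by
        refine norm_sum_le_of_le _ fun i hi => ?_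
        rw [norm_mul, norm_mul, mul_assoc, Complex.norm_natCast]
        have hi' : i ≤ j := Nat.lt_succ_iff.1 (Finset.mem_range.1 hi)
        gcongr
        · exact hA i hi'
        · exact hB _ (Nat.sub_le _ _)
    _ = 2 ^ j * A * B := by
        rw [← Finset.sum_mul, ← Nat.cast_sum, Nat.sum_range_choose]
        push_cast
        ring

theorem DerivBound.mul {q : ℕ} {A B : ℝ} {ψ φ : ℝ → ℂ} (hψ : ContDiff ℝ ∞ ψ)
    (hφ : ContDiff ℝ ∞ φ) (h1 : DerivBound q A ψ) (h2 : DerivBound q B φ) :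
    DerivBound q (2 ^ q * A * B) (fun t => ψ t * φ t) := by
  intro j hj t
  refine (norm_iteratedDeriv_mul_le hψ hφ (fun i hi => h1 i (hi.trans hj) t)
    fun i hi => h2 i (hi.trans hj) t).trans ?_
  have := h1.nonneg
  have := h2.nonneg
  gcongr
  norm_num

theorem DerivBound.exists_of_hasCompactSupport {ψ : ℝ → ℂ} (hψ : ContDiff ℝ ∞ ψ)
    (hc : HasCompactSupport ψ) (q : ℕ) : ∃ B, DerivBound q B ψ := by
  have h : ∀ j : ℕ, ∃ B, ∀ t, ‖iteratedDeriv j ψ t‖ ≤ B := by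
    intro j
    have h1 : HasCompactSupport (iteratedDeriv j ψ) := by
      induction j with
      | zero => simpa using hc
      | succ j ih => rw [iteratedDeriv_succ]; exact ih.deriv
    exact (hψ.continuous_iteratedDeriv j (by exact_mod_cast le_top)).bounded_above_of_compact_support h1
  choose B hB using h
  refine ⟨∑ j ∈ Finset.range (q + 1), B j, fun j hj t => (hB j t).trans ?_⟩
  exact Finset.single_le_sum (f := B) (fun i _ => (norm_nonneg _).trans (hB i 0))
    (Finset.mem_range.2 (Nat.lt_succ_of_le hj))

theorem DerivBound.comp_add {q : ℕ} {B : ℝ} {ψ : ℝ → ℂ} (h : DerivBound q B ψ) (a : ℝ) :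
    DerivBound q B (fun t => ψ (t + a)) := by
  intro j hj t
  rw [iteratedDeriv_comp_add_const]
  exact h j hj _

theorem iteratedDeriv_comp_mul (ψ : ℝ → ℂ) (hψ : ContDiff ℝ ∞ ψ) (c : ℝ) (j : ℕ) (t : ℝ) :
    iteratedDeriv j (fun t => ψ (c * t)) t = (c : ℂ) ^ j * iteratedDeriv j ψ (c * t) := by
  rw [iteratedDeriv_comp_const_smul (hψ.of_le (by exact_mod_cast le_top))]
  simp

/-- A function whose derivatives of order less than `q` vanish at the origin is small near the
origin. -/
theorem norm_iteratedDeriv_le_of_eq_zero {f : ℝ → ℂ} (hf : ContDiff ℝ ∞ f) {q : ℕ} {B R : ℝ}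
    (hR : 1 ≤ R) (h0 : ∀ j < q, iteratedDeriv j f 0 = 0)
    (hB : ∀ t, ‖iteratedDeriv q f t‖ ≤ B) {t : ℝ} (ht : |t| ≤ R) {j : ℕ} (hj : j ≤ q) :
    ‖iteratedDeriv j f t‖ ≤ B * R ^ q := by
  have hB0 : 0 ≤ B := (norm_nonneg _).trans (hB 0)
  -- The mean value inequality is applied i = q - j times, each costing a factor R.
  have key : ∀ i j : ℕ, i + j = q → ∀ t, |t| ≤ R → ‖iteratedDeriv j f t‖ ≤ B * R ^ i := by
    intro i
    induction i with
    | zero =>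
      intro j hj t _
      obtain rfl : j = q := by omega
      simpa using hB t
    | succ i ih =>
      intro j hj t ht
      have h1 : ∀ x ∈ Set.Icc (-R) R, HasDerivWithinAt (iteratedDeriv j f)
          (iteratedDeriv (j + 1) f x) (Set.Icc (-R) R) x := by
        intro x _
        rw [iteratedDeriv_succ]
        exact ((hf.differentiable_iteratedDeriv j (by exact_mod_cast WithTop.coe_lt_top _)) x
          ).hasDerivAt.hasDerivWithinAt
      have h2 := (convex_Icc (-R) R).norm_image_sub_le_of_norm_hasDerivWithin_le h1
        (fun x hx => ih (j + 1) (by omega) x (abs_le.2 hx)) (x := 0) (y := t)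
        ⟨by linarith, by linarith⟩ (abs_le.1 ht)
      rw [h0 j (by omega), sub_zero, sub_zero, Real.norm_eq_abs] at h2
      calc _ ≤ B * R ^ i * |t| := h2
        _ ≤ B * R ^ i * R := by gcongr
        _ = B * R ^ (i + 1) := by ring
  refine (key (q - j) j (by omega) t ht).trans ?_
  gcongr
  exact Nat.sub_le q j

end Calculus

/-! ### Noncommuting flows and orbit integrals on C_N^∞ -/

namespace Nil

variable {K : ℕ+}

/-- On C_N^∞ the central factor becomes the scalar exp(`freq` s t). This is the only source of
oscillation in the proof, and it is nontrivial exactly when N ≠ 0. -/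
theorem flow_comm {v w : ℝ × ℝ × ℝ} (hb : Heis.bracket v w = Heis.dz) (s t : ℝ) (m : Nil K) :
    flow w t (flow v s m) = flow Heis.dz (s * t) (flow v s (flow w t m)) := by
  have h := congrArg (fun x : ℝ × ℝ × ℝ => x.2.2) hb
  simp only [Heis.bracket, Heis.dz] at h
  unfold flow
  rw [act_act, act_act, act_act]
  congr 1
  ext
  · simp [Heis.exp, Heis.dz]; ring
  · simp [Heis.exp, Heis.dz]; ring
  · simp [Heis.exp, Heis.dz]
    linear_combination s * t * h

/-- The weighted orbit integral `∫_a^b w(t) h(m exp(tv)) dt`. -/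
noncomputable def flowInt (v : ℝ × ℝ × ℝ) (w : ℝ → ℂ) (a b : ℝ) (h : Nil K → ℂ) (m : Nil K) : ℂ :=
  ∫ t in a..b, w t * h (flow v t m)

theorem contDiff_flowCoords_prod (v : ℝ × ℝ × ℝ) :
    ContDiff ℝ ∞ (fun y : (ℝ × ℝ × ℝ) × ℝ => flowCoords v y.1 y.2) := by
  unfold flowCoords
  fun_prop

theorem Smooth.flowInt {h : Nil K → ℂ} (hh : Smooth h) (v : ℝ × ℝ × ℝ) {w : ℝ → ℂ}
    (hw : ContDiff ℝ ∞ w) (a b : ℝ) : Smooth (flowInt v w a b h) := by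
  have h1 : ContDiff ℝ ∞ (fun y : (ℝ × ℝ × ℝ) × ℝ => w y.2 * lift h (flowCoords v y.1 y.2)) :=
    (hw.comp contDiff_snd).mul (ContDiff.comp (g := lift h) hh (contDiff_flowCoords_prod v))
  exact contDiff_intervalIntegral_param h1 a b

/-- The constant `c` with `Z = c` on `C_N^∞`. -/
noncomputable def freq (K : ℕ+) (N : ℤ) : ℂ := 2 * (Real.pi : ℂ) * Complex.I * N * (K : ℕ)

theorem CN.map_flow_dz {N : ℤ} {h : Nil K → ℂ} (hh : h ∈ CN K N) (s : ℝ) (m : Nil K) :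
    h (flow Heis.dz s m) = Complex.exp (freq K N * s) * h m := CN.flow_dz hh s m

theorem norm_exp_freq (K : ℕ+) (N : ℤ) (s : ℝ) : ‖Complex.exp (freq K N * s)‖ = 1 := by
  have h : freq K N * s = ((2 * Real.pi * N * (K : ℕ) * s : ℝ) : ℂ) * Complex.I := by
    unfold freq; push_cast; ring
  rw [h, Complex.norm_exp_ofReal_mul_I]

theorem freq_ne_zero (K : ℕ+) {N : ℤ} (hN : N ≠ 0) : freq K N ≠ 0 := by
  unfold freq
  have h1 : ((K : ℕ) : ℂ) ≠ 0 := by exact_mod_cast K.ne_zero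
  have h2 : (N : ℂ) ≠ 0 := by exact_mod_cast hN
  simp [Real.pi_ne_zero, h1, h2]

theorem hasDerivAt_exp_freq (K : ℕ+) (N : ℤ) (r s : ℝ) :
    HasDerivAt (fun s : ℝ => Complex.exp (freq K N * (s * r)))
      (freq K N * r * Complex.exp (freq K N * (s * r))) s := by
  have h0 : HasDerivAt (fun s : ℝ => freq K N * ((s : ℂ) * r)) (freq K N * r) s := by
    simpa using ((Complex.ofRealCLM.hasDerivAt (x := s)).mul_const (r : ℂ)).const_mul (freq K N)
  simpa [mul_comm] using h0.cexp

theorem CN.of_map_flow_dz {N : ℤ} {h : Nil K → ℂ} (hh : Smooth h)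
    (h1 : ∀ (s : ℝ) m, h (flow Heis.dz s m) = Complex.exp (freq K N * s) * h m) : h ∈ CN K N := by
  refine ⟨hh, fun m => ?_⟩
  have h2 : HasDerivAt (fun s : ℝ => h (flow Heis.dz s m)) (freq K N * h m) 0 := by
    have h3 := (hasDerivAt_exp_freq K N 1 0).mul_const (h m)
    simp only [Complex.ofReal_one, mul_one, Complex.ofReal_zero, mul_zero, Complex.exp_zero] at h3
    exact h3.congr_of_eventuallyEq (Filter.Eventually.of_forall fun s => h1 s m)
  exact h2.deriv

/-- Weighted orbit integrals as operators on `C_N^∞`. -/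
noncomputable def flowIntOp (v : ℝ × ℝ × ℝ) {w : ℝ → ℂ} (hw : ContDiff ℝ ∞ w) (a b : ℝ) (N : ℤ) :
    CN K N →ₗ[ℂ] CN K N where
  toFun h := ⟨flowInt v w a b h.1, CN.of_map_flow_dz (h.2.1.flowInt v hw a b) fun s m => by
    unfold flowInt
    rw [← intervalIntegral.integral_const_mul]
    refine intervalIntegral.integral_congr fun t _ => ?_
    simp only [flow_dz_comm, CN.map_flow_dz h.2]
    ring⟩
  map_add' f h := by
    ext m
    change flowInt v w a b (f.1 + h.1) m = flowInt v w a b f.1 m + flowInt v w a b h.1 m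
    unfold flowInt
    rw [← intervalIntegral.integral_add]
    · simp only [Pi.add_apply, mul_add]
    · exact (hw.continuous.mul (f.2.1.comp_flow v m).continuous).intervalIntegrable _ _
    · exact (hw.continuous.mul (h.2.1.comp_flow v m).continuous).intervalIntegrable _ _
  map_smul' c h := by
    ext m
    change flowInt v w a b (c • h.1) m = c * flowInt v w a b h.1 m
    unfold flowInt
    rw [← intervalIntegral.integral_const_mul]
    refine intervalIntegral.integral_congr fun t _ => ?_
    simp only [Pi.smul_apply, smul_eq_mul]
    ring

theorem flowIntOp_apply (v : ℝ × ℝ × ℝ) {w : ℝ → ℂ} (hw : ContDiff ℝ ∞ w) (a b : ℝ) {N : ℤ}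
    (h : CN K N) (m : Nil K) : (flowIntOp v hw a b N h).1 m = ∫ t in a..b, w t * h.1 (flow v t m) :=
  rfl

/-- Smoothness in the parameters of a flow followed by another flow. -/
theorem Smooth.contDiff_flow_flow {h : Nil K → ℂ} (hh : Smooth h) (v w : ℝ × ℝ × ℝ) (m : Nil K) :
    ContDiff ℝ ∞ (fun y : ℝ × ℝ => h (flow w y.2 (flow v y.1 m))) := by
  obtain ⟨u, rfl⟩ := exists_coords m
  have h1 : ContDiff ℝ ∞ (fun y : ℝ × ℝ => flowCoords w (flowCoords v u y.1) y.2) :=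
    (contDiff_flowCoords_prod w).comp
      (((contDiff_flowCoords v u).comp contDiff_fst).prodMk contDiff_snd)
  exact ContDiff.comp (g := lift h) hh h1

theorem hasDerivAt_flow (v : ℝ × ℝ × ℝ) {N : ℤ} (h : CN K N) (m : Nil K) (s : ℝ) :
    HasDerivAt (fun t : ℝ => h.1 (flow v t m)) ((lieOp v N h).1 (flow v s m)) s :=
  h.2.1.hasDerivAt' v m s

theorem lieOp_flowIntOp_self (v : ℝ × ℝ × ℝ) {w : ℝ → ℂ} (hw : ContDiff ℝ ∞ w) (a b : ℝ) {N : ℤ}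
    (h : CN K N) : lieOp v N (flowIntOp v hw a b N h) = flowIntOp v hw a b N (lieOp v N h) := by
  ext m
  have h1 := hasDerivAt_intervalIntegral_param
    (f := fun y : ℝ × ℝ => w y.2 * h.1 (flow v y.2 (flow v y.1 m)))
    ((hw.comp contDiff_snd).mul (h.2.1.contDiff_flow_flow v v m)) (s := 0)
    (f' := fun t => w t * (lieOp v N h).1 (flow v t m)) a b (fun t => by
      have h2 := (hasDerivAt_flow v h (flow v t m) 0).const_mul (w t)
      rw [flow_zero] at h2
      refine h2.congr_of_eventuallyEq (Filter.Eventually.of_forall fun s => ?_)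
      change _ * h.1 (flow v t (flow v s m)) = _ * h.1 (flow v s (flow v t m))
      rw [← flow_add, ← flow_add, add_comm])
  exact h1.deriv

/-- Moving the v-flow past the w-flow costs the phase exp(`freq` s t); its derivative at s = 0
produces the additional weight t. -/
theorem lieOp_flowIntOp {v w : ℝ × ℝ × ℝ} (hb : Heis.bracket v w = Heis.dz) {ψ : ℝ → ℂ}
    (hψ : ContDiff ℝ ∞ ψ) (hψ' : ContDiff ℝ ∞ fun t : ℝ => (t : ℂ) * ψ t) (a b : ℝ) {N : ℤ}
    (h : CN K N) :
    lieOp v N (flowIntOp w hψ a b N h) =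
      flowIntOp w hψ a b N (lieOp v N h) + freq K N • flowIntOp w hψ' a b N h := by
  ext m
  have h1 := hasDerivAt_intervalIntegral_param
    (f := fun y : ℝ × ℝ => ψ y.2 * h.1 (flow w y.2 (flow v y.1 m)))
    ((hψ.comp contDiff_snd).mul (h.2.1.contDiff_flow_flow v w m)) (s := 0)
    (f' := fun t => ψ t * (lieOp v N h).1 (flow w t m) +
      freq K N * ((t * ψ t) * h.1 (flow w t m))) a b (fun t => by
      have h2 := ((hasDerivAt_exp_freq K N t 0).mul
        (hasDerivAt_flow v h (flow w t m) 0)).const_mul (ψ t)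
      rw [flow_zero] at h2
      simp only [Complex.ofReal_zero, zero_mul, mul_zero, Complex.exp_zero, mul_one, one_mul] at h2
      refine (h2.congr_of_eventuallyEq (Filter.Eventually.of_forall fun s => ?_)).congr_deriv
        (by ring)
      change ψ t * h.1 (flow w t (flow v s m)) = ψ t * (_ * h.1 (flow v s (flow w t m)))
      rw [flow_comm hb, CN.map_flow_dz h.2]
      push_cast
      rfl)
  refine h1.deriv.trans ?_
  rw [intervalIntegral.integral_add, intervalIntegral.integral_const_mul]
  · rfl
  · exact (hψ.continuous.mul ((lieOp v N h).2.1.comp_flow w m).continuous).intervalIntegrable _ _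
  · exact (continuous_const.mul
      (hψ'.continuous.mul (h.2.1.comp_flow w m).continuous)).intervalIntegrable _ _

/-- Integration by parts along an orbit. -/
theorem flowIntOp_lieOp_self (v : ℝ × ℝ × ℝ) {w w' : ℝ → ℂ} (hw : ContDiff ℝ ∞ w)
    (hw' : ContDiff ℝ ∞ w') (hd : ∀ t, HasDerivAt w (w' t) t) (a b : ℝ) {N : ℤ}
    (h : CN K N) (m : Nil K) :
    (flowIntOp v hw a b N (lieOp v N h)).1 m =
      w b * h.1 (flow v b m) - w a * h.1 (flow v a m) - (flowIntOp v hw' a b N h).1 m :=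
  intervalIntegral.integral_mul_deriv_eq_deriv_mul (fun t _ => hd t)
    (fun t _ => hasDerivAt_flow v h m t) (hw'.continuous.intervalIntegrable _ _)
    (((lieOp v N h).2.1.comp_flow v m).continuous.intervalIntegrable _ _)

theorem norm_flow_sub_le (v : ℝ × ℝ × ℝ) {N : ℤ} (h : CN K N) {C : ℝ} {s : ℝ} {m : Nil K}
    (hC : ∀ t, |t| ≤ |s| → ‖(lieOp v N h).1 (flow v t m)‖ ≤ C) :
    ‖h.1 (flow v s m) - h.1 m‖ ≤ C * |s| := by
  have h1 := (convex_Icc (-|s|) |s|).norm_image_sub_le_of_norm_hasDerivWithin_le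
    (f := fun t => h.1 (flow v t m)) (f' := fun t => (lieOp v N h).1 (flow v t m)) (C := C)
    (fun t _ => (hasDerivAt_flow v h m t).hasDerivWithinAt)
    (fun t ht => hC t (abs_le.2 ht)) (x := 0) (y := s)
    ⟨neg_nonpos.2 (abs_nonneg s), abs_nonneg s⟩ (abs_le.1 le_rfl)
  simpa [flow_zero] using h1

end Nil

/-! ### Intertwining of the transfer operator with the flows -/

namespace PHAut

open Nil

variable {K : ℕ+} (S : PHAut K)

theorem lam_pos : 0 < S.lam := zero_lt_one.trans S.one_lt_lam

theorem Phi_flow_V (t : ℝ) (m : Nil K) : S.Phi (flow S.V t m) = flow S.V (S.lam⁻¹ * t) (S.Phi m) := by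
  obtain ⟨g, rfl⟩ := mk_surj m
  change (Nil.mk (S.A (g * Heis.exp (t • S.V))) : Nil K) =
    Nil.mk (S.A g * Heis.exp ((S.lam⁻¹ * t) • S.V))
  rw [map_mul, S.map_V, smul_smul, mul_comm]

theorem Phi_flow_W (t : ℝ) (m : Nil K) : S.Phi (flow S.W t m) = flow S.W (S.lam * t) (S.Phi m) := by
  obtain ⟨g, rfl⟩ := mk_surj m
  change (Nil.mk (S.A (g * Heis.exp (t • S.W))) : Nil K) =
    Nil.mk (S.A g * Heis.exp ((S.lam * t) • S.W))
  rw [map_mul, S.map_W, smul_smul, mul_comm]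

theorem Phi_iterate_flow_W (n : ℕ) (t : ℝ) (m : Nil K) :
    S.Phi^[n] (flow S.W t m) = flow S.W (S.lam ^ n * t) (S.Phi^[n] m) := by
  induction n generalizing t m with
  | zero => simp
  | succ n ih => rw [Function.iterate_succ_apply, Phi_flow_W, ih, Function.iterate_succ_apply,
      pow_succ, mul_assoc]

theorem Phi_surjective : Function.Surjective (S.Phi : Nil K → Nil K) := by
  intro m
  obtain ⟨g, rfl⟩ := mk_surj m
  refine ⟨Nil.mk (S.A.symm g), ?_⟩
  change Nil.mk (S.A (S.A.symm g)) = _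
  rw [MulEquiv.apply_symm_apply]

theorem transfer_apply {N : ℤ} (h : CN K N) (m : Nil K) : (S.transfer N h).1 m = h.1 (S.Phi m) := rfl

theorem transfer_pow_apply {N : ℤ} (n : ℕ) (h : CN K N) (m : Nil K) :
    ((S.transfer N ^ n) h).1 m = h.1 (S.Phi^[n] m) := by
  induction n generalizing m with
  | zero => rfl
  | succ n ih =>
    rw [pow_succ', Module.End.mul_apply, transfer_apply, ih, Function.iterate_succ_apply]

/-- Chain rule for Φ, which slows the V-flow down by λ. This relation moves eigenvalues from one
annulus to the next. -/
theorem lieOp_transfer {N : ℤ} (h : CN K N) :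
    lieOp S.V N (S.transfer N h) = ((S.lam : ℂ)⁻¹) • S.transfer N (lieOp S.V N h) := by
  ext m
  have h1 := hasDerivAt_flow S.V h (S.Phi m) (S.lam⁻¹ * 0)
  have h2 := h1.scomp (0 : ℝ) ((hasDerivAt_id (0 : ℝ)).const_mul S.lam⁻¹)
  rw [mul_zero, flow_zero, mul_one] at h2
  have h3 : HasDerivAt (fun t => (S.transfer N h).1 (flow S.V t m))
      (S.lam⁻¹ • (lieOp S.V N h).1 (S.Phi m)) 0 := by
    refine h2.congr_of_eventuallyEq (Filter.Eventually.of_forall fun t => ?_)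
    change h.1 (S.Phi (flow S.V t m)) = h.1 (flow S.V (S.lam⁻¹ * t) (S.Phi m))
    rw [Phi_flow_V]
  refine h3.deriv.trans ?_
  change S.lam⁻¹ • _ = (S.lam : ℂ)⁻¹ * _
  rw [← Complex.ofReal_inv, Complex.real_smul]
  rfl

theorem lieOp_pow_transfer {N : ℤ} (j : ℕ) (h : CN K N) :
    (lieOp S.V N)^[j] (S.transfer N h) =
      ((S.lam : ℂ)⁻¹ ^ j) • S.transfer N ((lieOp S.V N)^[j] h) := by
  induction j generalizing h with
  | zero => simp
  | succ j ih =>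
    rw [Function.iterate_succ_apply, lieOp_transfer, ← Module.End.pow_apply, map_smul,
      Module.End.pow_apply, ih, smul_smul, Function.iterate_succ_apply, pow_succ, mul_comm]

theorem lieOp_pow_transfer_pow {N : ℤ} (j n : ℕ) (h : CN K N) :
    (lieOp S.V N)^[j] ((S.transfer N ^ n) h) =
      ((S.lam : ℂ)⁻¹ ^ (j * n)) • (S.transfer N ^ n) ((lieOp S.V N)^[j] h) := by
  induction n with
  | zero => simp
  | succ n ih =>
    rw [pow_succ', Module.End.mul_apply, lieOp_pow_transfer, ih, map_smul, smul_smul,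
      Module.End.mul_apply, ← pow_add, Nat.mul_succ, add_comm]

end PHAut

/-! ### Continuous partitions of unity and cutoffs on the line -/

section Partition

open MeasureTheory

theorem norm_integral_le_of_eq_zero {f : ℝ → ℂ} {A C : ℝ} (hA : 0 ≤ A) (hC : ∀ a, ‖f a‖ ≤ C)
    (h0 : ∀ a, A < |a| → f a = 0) : ‖∫ a, f a‖ ≤ 2 * A * C := by
  have h1 : ∫ a in Set.Icc (-A) A, f a = ∫ a, f a := by
    refine setIntegral_eq_integral_of_forall_compl_eq_zero fun a ha => h0 a ?_
    rw [Set.mem_Icc, ← abs_le] at ha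
    exact not_le.1 ha
  rw [← h1]
  refine (norm_setIntegral_le_of_norm_le_const (by simp) fun a _ => hC a).trans ?_
  rw [Measure.real, Real.volume_Icc, ENNReal.toReal_ofReal (by linarith)]
  apply le_of_eq; ring

/-- A continuous partition of unity on the line. -/
theorem integral_eq_integral_localized {χ Ψ : ℝ → ℂ} (hχ : Continuous χ)
    (hχc : HasCompactSupport χ) (hχ1 : ∫ t, χ t = 1) (hΨ : Continuous Ψ)
    (hΨc : HasCompactSupport Ψ) : ∫ t, Ψ t = ∫ a, ∫ t, χ t * Ψ (t + a) := by
  have hcomp : HasCompactSupport (Function.uncurry fun t a => χ t * Ψ (t + a)) := by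
    obtain ⟨K1, hK1, h1⟩ := exists_compact_iff_hasCompactSupport.2 hχc
    obtain ⟨K2, hK2, h2⟩ := exists_compact_iff_hasCompactSupport.2 hΨc
    refine HasCompactSupport.intro ((hK1.prod (hK2.add hK1.neg))) ?_
    rintro ⟨t, a⟩ hta
    change χ t * Ψ (t + a) = 0
    by_cases ht : t ∈ K1
    · rw [h2 (t + a), mul_zero]
      intro hta'
      refine hta ⟨ht, ⟨t + a, hta', -t, by simpa using ht, ?_⟩⟩
      simp
    · rw [h1 t ht, zero_mul]
  have hcont : Continuous (Function.uncurry fun t a => χ t * Ψ (t + a)) := by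
    change Continuous fun y : ℝ × ℝ => χ y.1 * Ψ (y.1 + y.2)
    fun_prop
  rw [← integral_integral_swap_of_hasCompactSupport hcont hcomp]
  simp_rw [integral_const_mul, integral_add_left_eq_self, integral_mul_const, hχ1, one_mul]

theorem exists_smooth_bump {δ : ℝ} (hδ : 0 < δ) : ∃ χ : ℝ → ℂ, ContDiff ℝ ∞ χ ∧
    HasCompactSupport χ ∧ tsupport χ ⊆ Set.Ioo (-δ) δ ∧ ∫ t, χ t = 1 := by
  let f : ContDiffBump (0 : ℝ) := ⟨δ / 4, δ / 2, by linarith, by linarith⟩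
  have h1 : tsupport (fun t => ((f.normed volume t : ℝ) : ℂ)) ⊆ tsupport (f.normed volume) :=
    tsupport_comp_subset Complex.ofReal_zero _
  have h2 : tsupport (f.normed volume) ⊆ Set.Ioo (-δ) δ := by
    rw [f.tsupport_normed_eq, Real.closedBall_eq_Icc]
    intro t ht
    have h3 : t ∈ Set.Icc (0 - δ / 2) (0 + δ / 2) := ht
    exact ⟨by linarith [h3.1], by linarith [h3.2]⟩
  refine ⟨fun t => ((f.normed volume t : ℝ) : ℂ), ?_, ?_, h1.trans h2, ?_⟩
  · exact Complex.ofRealCLM.contDiff.comp f.contDiff_normed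
  · exact f.hasCompactSupport_normed.comp_left Complex.ofReal_zero
  · rw [integral_complex_ofReal, f.integral_normed]
    simp

/-- A smooth function which equals one on `[-δ, δ]` and is supported in `(-2δ, 2δ)`. -/
theorem exists_smooth_cutoff {δ : ℝ} (hδ : 0 < δ) : ∃ χ : ℝ → ℂ, ContDiff ℝ ∞ χ ∧
    HasCompactSupport χ ∧ tsupport χ ⊆ Set.Ioo (-(2 * δ)) (2 * δ) ∧ ∀ t, |t| ≤ δ → χ t = 1 := by
  let f : ContDiffBump (0 : ℝ) := ⟨δ, 3 * δ / 2, by linarith, by linarith⟩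
  have h1 : tsupport (fun t => ((f t : ℝ) : ℂ)) ⊆ tsupport f :=
    tsupport_comp_subset Complex.ofReal_zero _
  have h2 : tsupport f ⊆ Set.Ioo (-(2 * δ)) (2 * δ) := by
    rw [f.tsupport_eq, Real.closedBall_eq_Icc]
    intro t ht
    have h3 : t ∈ Set.Icc (0 - 3 * δ / 2) (0 + 3 * δ / 2) := ht
    exact ⟨by linarith [h3.1], by linarith [h3.2]⟩
  refine ⟨fun t => ((f t : ℝ) : ℂ), ?_, ?_, h1.trans h2, fun t ht => ?_⟩
  · exact Complex.ofRealCLM.contDiff.comp f.contDiff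
  · exact f.hasCompactSupport.comp_left Complex.ofReal_zero
  · change ((f t : ℝ) : ℂ) = 1
    rw [f.one_of_mem_closedBall (by simpa using ht)]
    simp

theorem hasCompactSupport_of_tsupport_subset_Ioo {ψ : ℝ → ℂ} {R : ℝ}
    (h : tsupport ψ ⊆ Set.Ioo (-R) R) : HasCompactSupport ψ :=
  (isCompact_Icc (a := -R) (b := R)).of_isClosed_subset (isClosed_tsupport ψ)
    (h.trans Set.Ioo_subset_Icc_self)

theorem eq_zero_of_tsupport_subset_Ioo {ψ : ℝ → ℂ} {R : ℝ}
    (h : tsupport ψ ⊆ Set.Ioo (-R) R) {t : ℝ} (ht : R ≤ |t|) : ψ t = 0 := by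
  refine image_eq_zero_of_notMem_tsupport fun hmem => ?_
  exact absurd (abs_lt.2 (h hmem)) (not_lt.2 ht)

theorem tsupport_mul_subset_Ioo {ψ φ : ℝ → ℂ} {R : ℝ} (h : tsupport ψ ⊆ Set.Ioo (-R) R) :
    tsupport (fun t => ψ t * φ t) ⊆ Set.Ioo (-R) R :=
  (tsupport_mul_subset_left (f := ψ) (g := φ)).trans h

end Partition

/-! ### Pairings along W-orbits and bounded powers -/

namespace PHAut

open Nil MeasureTheory

variable {K : ℕ+} (S : PHAut K)

/-- The pairing of a test function on the line with `h` along the orbit of `m` under `W`. -/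
noncomputable def pair (ψ : ℝ → ℂ) (m : Nil K) (h : Nil K → ℂ) : ℂ :=
  ∫ t, ψ t * h (flow S.W t m)

theorem ell_eq_pair {R : ℝ} {ψ : ℝ → ℂ} (h0 : ∀ t, R < |t| → ψ t = 0) (m : Nil K)
    (h : Nil K → ℂ) : S.ell R ψ m h = S.pair ψ m h := by
  unfold ell pair
  by_cases hR : 0 ≤ R
  · rw [intervalIntegral.integral_of_le (by linarith), ← integral_Icc_eq_integral_Ioc]
    refine setIntegral_eq_integral_of_forall_compl_eq_zero fun t ht => ?_
    rw [Set.mem_Icc, ← abs_le] at ht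
    rw [h0 t (not_le.1 ht), zero_mul]
  · have h1 : ∀ t, ψ t = 0 := fun t => h0 t ((not_le.1 hR).trans_le (abs_nonneg t))
    simp [h1]

theorem ell_eq_pair_of_tsupport {R : ℝ} {ψ : ℝ → ℂ} (h : tsupport ψ ⊆ Set.Ioo (-R) R) (m : Nil K)
    (g : Nil K → ℂ) : S.ell R ψ m g = S.pair ψ m g :=
  S.ell_eq_pair (fun _ ht => eq_zero_of_tsupport_subset_Ioo h ht.le) m g

/-- Rescaling by 2^q B makes ψ admissible, since every weight 2^(q-j) is at most 2^q. -/
theorem norm_ell_le {δ : ℝ} {N : ℤ} {p q : ℕ} {ψ : ℝ → ℂ} (hψ : ContDiff ℝ ∞ ψ)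
    (hs : tsupport ψ ⊆ Set.Ioo (-δ) δ) {B : ℝ} (hB : DerivBound q B ψ) (h : CN K N) {j : ℕ}
    (hj : j ≤ p) (m : Nil K) :
    ‖S.ell δ ψ m ((lieOp S.V N)^[j] h : CN K N).1‖ ≤ 2 ^ q * B * S.aNorm δ N p q h := by
  -- For B = 0 rescaling is impossible, but then ψ vanishes.
  rcases hB.nonneg.eq_or_lt with hB0 | hB0
  · have h1 : ∀ t, ψ t = 0 := fun t => norm_le_zero_iff.1 (hB0 ▸ hB.norm_le t)
    simp [ell, h1, ← hB0]
  · set r : ℝ := 2 ^ q * B with hr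
    have hr0 : 0 < r := by positivity
    have hη : (fun t => (r : ℂ)⁻¹ * ψ t) ∈ testFns δ q := by
      refine ⟨contDiff_const.mul hψ, ?_, ?_, ?_⟩
      · exact (hasCompactSupport_of_tsupport_subset_Ioo hs).mul_left
      · exact (tsupport_mul_subset_right (f := fun _ => (r : ℂ)⁻¹) (g := ψ)).trans hs
      · intro i hi t
        rw [iteratedDeriv_const_mul_field, norm_mul, norm_inv, Complex.norm_of_nonneg hr0.le]
        have h2 := hB i hi t
        have h3 : (2 : ℝ) ^ (q - i) ≤ 2 ^ q := pow_le_pow_right₀ (by norm_num) (Nat.sub_le _ _)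
        calc 2 ^ (q - i) * (r⁻¹ * ‖iteratedDeriv i ψ t‖) ≤ 2 ^ q * (r⁻¹ * B) := by gcongr
          _ = r⁻¹ * r := by rw [hr]; ring
          _ = 1 := inv_mul_cancel₀ hr0.ne'
    have h4 := S.le_aNorm δ N p q h hj m hη
    have h5 : S.ell δ (fun t => (r : ℂ)⁻¹ * ψ t) m ((lieOp S.V N)^[j] h : CN K N).1 =
        (r : ℂ)⁻¹ * S.ell δ ψ m ((lieOp S.V N)^[j] h : CN K N).1 := by
      unfold ell
      rw [← intervalIntegral.integral_const_mul]
      simp only [mul_assoc]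
    rw [h5, norm_mul, norm_inv, Complex.norm_of_nonneg hr0.le, inv_mul_le_iff₀ hr0] at h4
    exact h4

/-- The pairing is the integral over a of its pieces seen through the window χ placed at a. Only
windows with |a| ≤ R + δ meet the support of ψ, whence the factor 2(R + δ). -/
theorem norm_pair_le_of_localized {δ R C : ℝ} (hδ : 0 < δ) (hR : 0 ≤ R) {χ ψ : ℝ → ℂ}
    (hχ : Continuous χ) (hχs : tsupport χ ⊆ Set.Ioo (-δ) δ) (hχ1 : ∫ t, χ t = 1)
    (hψ : Continuous ψ) (hψ0 : ∀ t, R < |t| → ψ t = 0) {N : ℤ} (g : CN K N) (m : Nil K)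
    (hC : ∀ a, ‖S.pair (fun t => χ t * ψ (t + a)) (flow S.W a m) g.1‖ ≤ C) :
    ‖S.pair ψ m g.1‖ ≤ 2 * (R + δ) * C := by
  have hψc : HasCompactSupport ψ :=
    HasCompactSupport.intro (isCompact_Icc (a := -R) (b := R)) fun t ht => hψ0 t (by
      rw [Set.mem_Icc, ← abs_le] at ht
      exact not_le.1 ht)
  have h1 := integral_eq_integral_localized hχ (hasCompactSupport_of_tsupport_subset_Ioo hχs) hχ1
    (Ψ := fun t => ψ t * g.1 (flow S.W t m)) (hψ.mul (g.2.1.comp_flow S.W m).continuous)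
    hψc.mul_right
  have h2 : ∀ a, (∫ t, χ t * (ψ (t + a) * g.1 (flow S.W (t + a) m))) =
      S.pair (fun t => χ t * ψ (t + a)) (flow S.W a m) g.1 := by
    intro a
    unfold pair
    congr 1
    funext t
    rw [mul_assoc, add_comm t a, flow_add]
  unfold pair
  rw [h1]
  refine norm_integral_le_of_eq_zero (by linarith) (fun a => by rw [h2]; exact hC a) fun a ha => ?_
  have h3 : ∀ t, χ t * (ψ (t + a) * g.1 (flow S.W (t + a) m)) = 0 := by
    intro t
    by_cases ht : δ ≤ |t|
    · rw [eq_zero_of_tsupport_subset_Ioo hχs ht, zero_mul]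
    · rw [hψ0 (t + a), zero_mul, mul_zero]
      have := abs_sub_abs_le_abs_sub a (-t)
      rw [abs_neg, sub_neg_eq_add, add_comm a t] at this
      linarith
  simp [h3]

/-- Test functions of arbitrary support. -/
theorem exists_norm_pair_le {δ : ℝ} (hδ : 0 < δ) (q : ℕ) :
    ∃ C : ℝ, 0 ≤ C ∧ ∀ {N : ℤ} {p : ℕ} {ψ : ℝ → ℂ} {R B : ℝ}, 0 ≤ R → ContDiff ℝ ∞ ψ →
      (∀ t, R < |t| → ψ t = 0) → DerivBound q B ψ → ∀ (h : CN K N) {j : ℕ}, j ≤ p → ∀ m : Nil K,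
      ‖S.pair ψ m ((lieOp S.V N)^[j] h : CN K N).1‖ ≤
        C * (R + δ) * B * S.aNorm δ N p q h := by
  obtain ⟨χ, hχ, hχc, hχs, hχ1⟩ := exists_smooth_bump hδ
  obtain ⟨A, hA⟩ := DerivBound.exists_of_hasCompactSupport hχ hχc q
  have hA0 := hA.nonneg
  refine ⟨2 * (2 ^ q * (2 ^ q * A)), by positivity, ?_⟩
  intro N p ψ R B hR hψ hψ0 hB h j hj m
  refine (S.norm_pair_le_of_localized hδ hR hχ.continuous hχs hχ1 hψ.continuous hψ0 _ m
    (C := 2 ^ q * (2 ^ q * A * B) * S.aNorm δ N p q h) fun a => ?_).trans (le_of_eq (by ring))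
  have hs := tsupport_mul_subset_Ioo (φ := fun t => ψ (t + a)) hχs
  have hψa : ContDiff ℝ ∞ fun t => ψ (t + a) := hψ.comp (contDiff_id.add contDiff_const)
  rw [← S.ell_eq_pair_of_tsupport hs]
  exact S.norm_ell_le (hχ.mul hψa) hs (hA.mul hχ hψa (hB.comp_add a)) h hj _

/-- The transfer operator in terms of stretched test functions. -/
theorem pair_transfer_pow {N : ℤ} (n : ℕ) (ψ : ℝ → ℂ) (h : CN K N) (m : Nil K) :
    S.pair ψ m ((S.transfer N ^ n) h).1 =
      ((S.lam ^ n)⁻¹ : ℝ) * S.pair (fun t => ψ ((S.lam ^ n)⁻¹ * t)) (S.Phi^[n] m) h.1 := by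
  have hl : 0 < S.lam ^ n := pow_pos S.lam_pos n
  unfold pair
  have h1 := Measure.integral_comp_mul_left
    (fun t => ψ ((S.lam ^ n)⁻¹ * t) * h.1 (flow S.W t (S.Phi^[n] m))) (S.lam ^ n)
  rw [abs_of_pos (inv_pos.2 hl), Complex.real_smul] at h1
  rw [← h1]
  congr 1
  funext t
  rw [transfer_pow_apply, Phi_iterate_flow_W, inv_mul_cancel_left₀ hl.ne']

theorem norm_lam_pow (j : ℕ) : ‖((S.lam : ℂ)⁻¹ ^ j)‖ = (S.lam ^ j)⁻¹ := by
  rw [norm_pow, norm_inv, Complex.norm_of_nonneg S.lam_pos.le, inv_pow]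

theorem ell_lieOp_pow_transfer_pow {δ : ℝ} {N : ℤ} (j n : ℕ) (η : ℝ → ℂ)
    (hs : tsupport η ⊆ Set.Ioo (-δ) δ) (h : CN K N) (m : Nil K) :
    ‖S.ell δ η m ((lieOp S.V N)^[j] ((S.transfer N ^ n) h) : CN K N).1‖ =
      (S.lam ^ (j * n))⁻¹ * ((S.lam ^ n)⁻¹ *
        ‖S.pair (fun t => η ((S.lam ^ n)⁻¹ * t)) (S.Phi^[n] m) ((lieOp S.V N)^[j] h : CN K N).1‖) := by
  have hl : 0 < S.lam ^ n := pow_pos S.lam_pos n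
  rw [lieOp_pow_transfer_pow, ell_smul, norm_mul, norm_lam_pow, ell_eq_pair_of_tsupport S hs,
    pair_transfer_pow, norm_mul, Complex.norm_of_nonneg (inv_pos.2 hl).le]

theorem DerivBound_of_mem_testFns {δ : ℝ} {q : ℕ} {η : ℝ → ℂ} (hη : η ∈ testFns δ q) :
    DerivBound q 1 η := by
  intro j hj t
  have h1 := hη.2.2.2 j hj t
  have h2 : (1 : ℝ) ≤ 2 ^ (q - j) := one_le_pow₀ (by norm_num)
  nlinarith [norm_nonneg (iteratedDeriv j η t)]

theorem derivBound_comp_inv_mul {q : ℕ} {B : ℝ} {η : ℝ → ℂ} (hη : ContDiff ℝ ∞ η)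
    (hB : DerivBound q B η) (n : ℕ) : DerivBound q B (fun t => η ((S.lam ^ n)⁻¹ * t)) := by
  intro j hj t
  have h1 : (S.lam ^ n)⁻¹ ≤ 1 := inv_le_one_of_one_le₀ (one_le_pow₀ S.one_lt_lam.le)
  have h0 : 0 ≤ (S.lam ^ n)⁻¹ := inv_nonneg.2 (pow_nonneg S.lam_pos.le n)
  rw [iteratedDeriv_comp_mul η hη, norm_mul, norm_pow, Complex.norm_of_nonneg h0]
  have h2 := hB j hj ((S.lam ^ n)⁻¹ * t)
  have h3 : ((S.lam ^ n)⁻¹) ^ j ≤ 1 := pow_le_one₀ h0 h1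
  nlinarith [norm_nonneg (iteratedDeriv j η ((S.lam ^ n)⁻¹ * t)), pow_nonneg h0 j]

theorem eq_zero_comp_inv_mul {δ : ℝ} {η : ℝ → ℂ} (hs : tsupport η ⊆ Set.Ioo (-δ) δ) (n : ℕ) (t : ℝ)
    (ht : S.lam ^ n * δ < |t|) : η ((S.lam ^ n)⁻¹ * t) = 0 := by
  have hl : 0 < S.lam ^ n := pow_pos S.lam_pos n
  refine eq_zero_of_tsupport_subset_Ioo hs ?_
  rw [abs_mul, abs_of_pos (inv_pos.2 hl), le_inv_mul_iff₀ hl]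
  exact ht.le

/-- The powers of the transfer operator are uniformly bounded; moreover they contract the part of
the norm which involves `j` derivatives along `V`. -/
theorem exists_norm_ell_transfer_pow_le {δ : ℝ} (hδ : 0 < δ) (q : ℕ) :
    ∃ C : ℝ, 0 ≤ C ∧ ∀ {N : ℤ} {p : ℕ} (n : ℕ) (h : CN K N) {j : ℕ}, j ≤ p → ∀ (m : Nil K),
      ∀ η ∈ testFns δ q, ‖S.ell δ η m ((lieOp S.V N)^[j] ((S.transfer N ^ n) h) : CN K N).1‖ ≤
        (S.lam ^ (j * n))⁻¹ * (C * S.aNorm δ N p q h) := by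
  obtain ⟨C, hC0, hC⟩ := S.exists_norm_pair_le hδ q
  refine ⟨C * (2 * δ), by positivity, ?_⟩
  intro N p n h j hj m η hη
  have hl : 1 ≤ S.lam ^ n := one_le_pow₀ S.one_lt_lam.le
  have hl' : 0 < S.lam ^ (j * n) := pow_pos S.lam_pos _
  rw [S.ell_lieOp_pow_transfer_pow j n η hη.2.2.1]
  refine mul_le_mul_of_nonneg_left ?_ (inv_pos.2 hl').le
  rw [inv_mul_le_iff₀ (by linarith)]
  refine (hC (R := S.lam ^ n * δ) (by positivity) (hη.1.comp (contDiff_const.mul contDiff_id))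
    (S.eq_zero_comp_inv_mul hη.2.2.1 n)
    (S.derivBound_comp_inv_mul hη.1 (DerivBound_of_mem_testFns hη) n) h hj _).trans ?_
  have := S.aNorm_nonneg δ N p q h
  -- Stretching by λⁿ ≥ 1 does not increase derivative bounds; the support grows to radius λⁿδ, and
  -- this is exactly compensated by the Jacobian λ⁻ⁿ.
  calc C * (S.lam ^ n * δ + δ) * 1 * S.aNorm δ N p q h
      ≤ C * (S.lam ^ n * δ + S.lam ^ n * δ) * 1 * S.aNorm δ N p q h := by
        gcongr
        nlinarith
    _ = S.lam ^ n * (C * (2 * δ) * S.aNorm δ N p q h) := by ring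

theorem exists_aNorm_transfer_pow_le {δ : ℝ} (hδ : 0 < δ) (q : ℕ) :
    ∃ C : ℝ, 0 ≤ C ∧ ∀ {N : ℤ} {p : ℕ} (n : ℕ) (h : CN K N),
      S.aNorm δ N p q ((S.transfer N ^ n) h) ≤ C * S.aNorm δ N p q h := by
  obtain ⟨C, hC0, hC⟩ := S.exists_norm_ell_transfer_pow_le hδ q
  refine ⟨C, hC0, fun {N p} n h => ?_⟩
  have h0 := S.aNorm_nonneg δ N p q h
  refine S.aNorm_le δ N p q _ (by positivity) fun j hj m η hη => (hC n h hj m η hη).trans ?_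
  have h1 : (S.lam ^ (j * n))⁻¹ ≤ 1 := inv_le_one_of_one_le₀ (one_le_pow₀ S.one_lt_lam.le)
  exact mul_le_of_le_one_left (by positivity) h1

end PHAut

/-! ### Taylor expansion with controlled derivatives of the remainder -/

section Taylor

theorem contDiff_ofReal_pow (i : ℕ) : ContDiff ℝ ∞ (fun t : ℝ => (t : ℂ) ^ i) :=
  Complex.ofRealCLM.contDiff.pow i

theorem iteratedDeriv_ofReal_pow (i j : ℕ) (t : ℝ) :
    iteratedDeriv j (fun t : ℝ => (t : ℂ) ^ i) t = (i.descFactorial j : ℂ) * (t : ℂ) ^ (i - j) := by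
  induction j generalizing t with
  | zero => simp
  | succ j ih =>
    rw [iteratedDeriv_succ, funext ih]
    have h1 : HasDerivAt (fun t : ℝ => (t : ℂ) ^ (i - j)) (((i - j : ℕ) : ℂ) * (t : ℂ) ^ (i - j - 1)) t := by
      simpa using (Complex.ofRealCLM.hasDerivAt (x := t)).fun_pow (i - j)
    rw [(h1.const_mul _).deriv, Nat.descFactorial_succ, Nat.sub_sub]
    push_cast
    ring

/-- Taylor expansion with a remainder which is small together with its derivatives. -/
theorem exists_taylor {φ : ℝ → ℂ} (hφ : ContDiff ℝ ∞ φ) {q : ℕ} {B R : ℝ} (hR : 1 ≤ R)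
    (hB : ∀ t, ‖iteratedDeriv q φ t‖ ≤ B) :
    ∃ r : ℝ → ℂ, ContDiff ℝ ∞ r ∧
      (∀ t, φ t = ∑ i ∈ Finset.range q, iteratedDeriv i φ 0 / (i.factorial : ℂ) * (t : ℂ) ^ i + r t) ∧
      ∀ j ≤ q, ∀ t, |t| ≤ R → ‖iteratedDeriv j r t‖ ≤ B * R ^ q := by
  have hP : ContDiff ℝ ∞ fun t : ℝ =>
      ∑ i ∈ Finset.range q, iteratedDeriv i φ 0 / (i.factorial : ℂ) * (t : ℂ) ^ i :=
    ContDiff.sum fun i _ => contDiff_const.mul (contDiff_ofReal_pow i)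
  have hr : ContDiff ℝ ∞ fun t : ℝ => φ t -
      ∑ i ∈ Finset.range q, iteratedDeriv i φ 0 / (i.factorial : ℂ) * (t : ℂ) ^ i := hφ.sub hP
  have hle : ∀ j : ℕ, (j : WithTop ℕ∞) ≤ ∞ := fun j => by exact_mod_cast le_top
  have hd : ∀ (j : ℕ) (t : ℝ), iteratedDeriv j (fun t : ℝ => φ t -
      ∑ i ∈ Finset.range q, iteratedDeriv i φ 0 / (i.factorial : ℂ) * (t : ℂ) ^ i) t =
      iteratedDeriv j φ t - ∑ i ∈ Finset.range q, iteratedDeriv i φ 0 / (i.factorial : ℂ) *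
        ((i.descFactorial j : ℂ) * (t : ℂ) ^ (i - j)) := by
    intro j t
    rw [iteratedDeriv_fun_sub (hφ.of_le (hle j)).contDiffAt (hP.of_le (hle j)).contDiffAt,
      iteratedDeriv_fun_sum fun i _ =>
        ((contDiff_const.mul (contDiff_ofReal_pow i)).of_le (hle j)).contDiffAt]
    simp only [iteratedDeriv_const_mul_field, iteratedDeriv_ofReal_pow]
  refine ⟨_, hr, fun t => by ring, fun j hj t ht =>
    norm_iteratedDeriv_le_of_eq_zero hr hR (fun j hj => ?_) (fun t => ?_) ht hj⟩
  · rw [hd, Finset.sum_eq_single j]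
    · have : (j.factorial : ℂ) ≠ 0 := by exact_mod_cast j.factorial_ne_zero
      rw [Nat.descFactorial_self, Nat.sub_self, pow_zero, mul_one, div_mul_cancel₀ _ this, sub_self]
    · intro i _ hij
      rcases lt_or_gt_of_ne hij with h | h
      · rw [Nat.descFactorial_eq_zero_iff_lt.2 h]; simp
      · rw [Complex.ofReal_zero, zero_pow (by omega)]; simp
    · intro h
      exact absurd (Finset.mem_range.2 hj) h
  -- The Taylor polynomial has degree below q, so the q-th derivative of the remainder is that of φ.
  · rw [hd, Finset.sum_eq_zero, sub_zero]
    · exact hB t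
    · intro i hi
      rw [Nat.descFactorial_eq_zero_iff_lt.2 (Finset.mem_range.1 hi)]
      simp

end Taylor

/-! ### Reduction to finitely many base points -/

namespace PHAut

open Nil MeasureTheory

variable {K : ℕ+} (S : PHAut K)

/-- A finite grid of points in `M`, transversal to the centre. -/
noncomputable def gridPt (K : ℕ+) (D : ℕ) (i : Fin D × Fin D) : Nil K :=
  Nil.mk (Heis.ofCoords ((i.1 : ℕ) / (D : ℝ), (i.2 : ℕ) / (D : ℝ), 0))

theorem det_VW : S.V.1 * S.W.2.1 - S.W.1 * S.V.2.1 = 1 :=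
  congrArg (fun x : ℝ × ℝ × ℝ => x.2.2) S.bracket_VW

/-- The size of the frame. -/
noncomputable def frameSize : ℝ := |S.V.1| + |S.V.2.1| + |S.W.1| + |S.W.2.1|

theorem frameSize_nonneg : 0 ≤ S.frameSize := by unfold frameSize; positivity

theorem exists_fract (m : Nil K) : ∃ x y z : ℝ, 0 ≤ x ∧ x < 1 ∧ 0 ≤ y ∧ y < 1 ∧
    m = Nil.mk (Heis.ofCoords (x, y, z)) := by
  obtain ⟨g, rfl⟩ := mk_surj m
  have hmem : (⟨(-⌊g.x⌋ : ℤ), (-⌊g.y⌋ : ℤ), (0 : ℤ) / ((K : ℕ) : ℝ)⟩ : Heis) ∈ Heis.lattice K :=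
    ⟨_, _, _, rfl⟩
  refine ⟨Int.fract g.x, Int.fract g.y, g.z + (-⌊g.x⌋ : ℤ) * g.y, Int.fract_nonneg _,
    Int.fract_lt_one _, Int.fract_nonneg _, Int.fract_lt_one _, ?_⟩
  rw [← mk_mul_left hmem g]
  congr 1
  ext
  · simp only [Heis.ofCoords, Heis.mul_x, Int.fract]; push_cast; ring
  · simp only [Heis.ofCoords, Heis.mul_y, Int.fract]; push_cast; ring
  · simp [Heis.ofCoords]

/-- Since V and W have determinant one modulo the centre, Cramer's rule realises a horizontal
displacement of size 1/D by V- and W-times of order 1/D. No bound on the central time b is needed: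
it changes functions in C_N^∞ only by a unimodular factor. -/
theorem exists_gridPt {D : ℕ} (hD : 0 < D) (m : Nil K) :
    ∃ (i : Fin D × Fin D) (s a b : ℝ), |s| ≤ S.frameSize / D ∧ |a| ≤ S.frameSize / D ∧
      m = flow Heis.dz b (flow S.W a (flow S.V s (gridPt K D i))) := by
  obtain ⟨x, y, z, hx0, hx1, hy0, hy1, rfl⟩ := exists_fract m
  have hD' : (0 : ℝ) < D := by exact_mod_cast hD
  have hfl : ∀ x : ℝ, 0 ≤ x → x < 1 → ∃ i : Fin D, 0 ≤ x - (i : ℕ) / (D : ℝ) ∧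
      x - (i : ℕ) / (D : ℝ) ≤ 1 / D := by
    intro x h0 h1
    have h2 : 0 ≤ D * x := by positivity
    refine ⟨⟨⌊D * x⌋₊, (Nat.floor_lt h2).2 (by nlinarith)⟩, ?_, ?_⟩
    · rw [sub_nonneg, div_le_iff₀ hD']
      exact (Nat.floor_le h2).trans (mul_comm _ _).le
    · rw [sub_le_iff_le_add, ← add_div, le_div_iff₀ hD', add_comm]
      exact (mul_comm _ _).le.trans (Nat.lt_floor_add_one _).le
  obtain ⟨i, hi0, hi1⟩ := hfl x hx0 hx1
  obtain ⟨j, hj0, hj1⟩ := hfl y hy0 hy1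
  set dx := x - (i : ℕ) / (D : ℝ) with hdx
  set dy := y - (j : ℕ) / (D : ℝ) with hdy
  have hdet := S.det_VW
  have hdxa : |dx| ≤ 1 / D := by rw [abs_of_nonneg hi0]; exact hi1
  have hdya : |dy| ≤ 1 / D := by rw [abs_of_nonneg hj0]; exact hj1
  have hbound : ∀ u v : ℝ, |u| + |v| ≤ S.frameSize → |dx * u - dy * v| ≤ S.frameSize / D := by
    intro u v huv
    calc |dx * u - dy * v| ≤ |dx| * |u| + |dy| * |v| := by
          rw [← abs_mul, ← abs_mul]; exact abs_sub _ _
      _ ≤ 1 / D * |u| + 1 / D * |v| := by gcongr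
      _ = (|u| + |v|) / D := by ring
      _ ≤ S.frameSize / D := by gcongr
  set s := dx * S.W.2.1 - dy * S.W.1 with hs
  set a := dy * S.V.1 - dx * S.V.2.1 with ha
  have e1 : s * S.V.1 + a * S.W.1 = dx := by rw [hs, ha]; linear_combination dx * hdet
  have e2 : s * S.V.2.1 + a * S.W.2.1 = dy := by rw [hs, ha]; linear_combination dy * hdet
  set z0 := (flowCoords S.W (flowCoords S.V ((i : ℕ) / (D : ℝ), (j : ℕ) / (D : ℝ), 0) s) a).2.2
    with hz0
  refine ⟨(i, j), s, a, z - z0, hbound _ _ ?_, ?_, ?_⟩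
  · unfold frameSize
    linarith [abs_nonneg S.V.1, abs_nonneg S.V.2.1]
  · rw [ha, abs_sub_comm]
    refine hbound _ _ ?_
    unfold frameSize
    linarith [abs_nonneg S.W.1, abs_nonneg S.W.2.1]
  · unfold gridPt
    rw [flow_mk, flow_mk, flow_mk]
    congr 2
    ext
    · simp only [flowCoords, Heis.dz]; linarith
    · simp only [flowCoords, Heis.dz]; linarith
    · change z = z0 + ((z - z0) * 1 + (z - z0) * 0 * ((z - z0) * 0) / 2) + _ * ((z - z0) * 0)
      ring

theorem norm_flow_dz {N : ℤ} (h : CN K N) (s : ℝ) (m : Nil K) :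
    ‖h.1 (flow Heis.dz s m)‖ = ‖h.1 m‖ := by
  rw [CN.map_flow_dz h.2, norm_mul, norm_exp_freq, one_mul]

/-- The modulus of G is constant along Z, and G is C-Lipschitz along V and W, so the grid is dense
enough in the two remaining directions. -/
theorem exists_norm_le_gridPt {N : ℤ} (G : CN K N) {C : ℝ}
    (hV : ∀ m, ‖(lieOp S.V N G).1 m‖ ≤ C) (hW : ∀ m, ‖(lieOp S.W N G).1 m‖ ≤ C) {D : ℕ}
    (hD : 0 < D) (m : Nil K) : ∃ i, ‖G.1 m‖ ≤ ‖G.1 (gridPt K D i)‖ + 2 * C * S.frameSize / D := by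
  obtain ⟨i, s, a, b, hs, ha, rfl⟩ := S.exists_gridPt hD m
  refine ⟨i, ?_⟩
  rw [norm_flow_dz]
  have hC0 : 0 ≤ C := (norm_nonneg _).trans (hV (gridPt K D i))
  have h1 := norm_flow_sub_le S.W G (s := a) (m := flow S.V s (gridPt K D i)) (fun t _ => hW _)
  have h2 := norm_flow_sub_le S.V G (s := s) (m := gridPt K D i) (fun t _ => hV _)
  have h3 := norm_le_norm_add_norm_sub' (G.1 (flow S.W a (flow S.V s (gridPt K D i))))
    (G.1 (flow S.V s (gridPt K D i)))
  have h4 := norm_le_norm_add_norm_sub' (G.1 (flow S.V s (gridPt K D i))) (G.1 (gridPt K D i))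
  have h5 : C * |a| ≤ C * (S.frameSize / D) := by gcongr
  have h6 : C * |s| ≤ C * (S.frameSize / D) := by gcongr
  have h7 : 2 * C * S.frameSize / D = C * (S.frameSize / D) + C * (S.frameSize / D) := by ring
  linarith

/-- Smoothing along the orbits of `W`. -/
noncomputable def smoothW {ψ : ℝ → ℂ} (hψ : ContDiff ℝ ∞ ψ) (R : ℝ) (N : ℤ) : CN K N →ₗ[ℂ] CN K N :=
  flowIntOp S.W hψ (-R) R N

theorem smoothW_apply {ψ : ℝ → ℂ} (hψ : ContDiff ℝ ∞ ψ) {R : ℝ}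
    (hs : tsupport ψ ⊆ Set.Ioo (-R) R) {N : ℤ} (h : CN K N) (m : Nil K) :
    (S.smoothW hψ R N h).1 m = S.pair ψ m h.1 :=
  S.ell_eq_pair_of_tsupport hs m h.1

theorem contDiff_deriv_infty {ψ : ℝ → ℂ} (hψ : ContDiff ℝ ∞ ψ) : ContDiff ℝ ∞ (deriv ψ) := by
  have h : ContDiff ℝ (∞ + 1) ψ := by simpa using hψ
  exact (contDiff_succ_iff_deriv.1 h).2.2

theorem contDiff_ofReal_mul {ψ : ℝ → ℂ} (hψ : ContDiff ℝ ∞ ψ) :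
    ContDiff ℝ ∞ (fun t : ℝ => (t : ℂ) * ψ t) :=
  Complex.ofRealCLM.contDiff.mul hψ

theorem tsupport_ofReal_mul {ψ : ℝ → ℂ} {R : ℝ} (hs : tsupport ψ ⊆ Set.Ioo (-R) R) :
    tsupport (fun t : ℝ => (t : ℂ) * ψ t) ⊆ Set.Ioo (-R) R :=
  (tsupport_mul_subset_right (f := fun t : ℝ => (t : ℂ)) (g := ψ)).trans hs

theorem tsupport_deriv_subset_Ioo {ψ : ℝ → ℂ} {R : ℝ} (hs : tsupport ψ ⊆ Set.Ioo (-R) R) :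
    tsupport (deriv ψ) ⊆ Set.Ioo (-R) R :=
  (closure_minimal support_deriv_subset (isClosed_tsupport ψ)).trans hs

theorem lieOp_V_smoothW {ψ : ℝ → ℂ} (hψ : ContDiff ℝ ∞ ψ) {R : ℝ}
    (hs : tsupport ψ ⊆ Set.Ioo (-R) R) {N : ℤ} (h : CN K N) (m : Nil K) :
    (lieOp S.V N (S.smoothW hψ R N h)).1 m =
      S.pair ψ m (lieOp S.V N h).1 + freq K N * S.pair (fun t : ℝ => (t : ℂ) * ψ t) m h.1 := by
  unfold smoothW
  rw [lieOp_flowIntOp S.bracket_VW hψ (contDiff_ofReal_mul hψ)]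
  rw [← S.smoothW_apply hψ hs, ← S.smoothW_apply (contDiff_ofReal_mul hψ) (tsupport_ofReal_mul hs)]
  rfl

/-- Integration by parts; the boundary terms vanish by the support condition. -/
theorem lieOp_W_smoothW {ψ : ℝ → ℂ} (hψ : ContDiff ℝ ∞ ψ) {R : ℝ}
    (hs : tsupport ψ ⊆ Set.Ioo (-R) R) {N : ℤ} (h : CN K N) (m : Nil K) :
    (lieOp S.W N (S.smoothW hψ R N h)).1 m = -S.pair (deriv ψ) m h.1 := by
  unfold smoothW
  rw [lieOp_flowIntOp_self, flowIntOp_lieOp_self S.W hψ (contDiff_deriv_infty hψ)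
    (fun t => (hψ.differentiable (by simp) t).hasDerivAt),
    eq_zero_of_tsupport_subset_Ioo hs (le_abs_self R),
    eq_zero_of_tsupport_subset_Ioo hs (t := -R) (by rw [abs_neg]; exact le_abs_self R)]
  rw [← S.smoothW_apply (contDiff_deriv_infty hψ)
    (tsupport_deriv_subset_Ioo hs)]
  simp [smoothW]

/-- A derivative along W falls on ψ. A derivative along V raises the order from j to j + 1, which is
why j < p is needed, and adds a pairing with the weight tψ. -/
theorem exists_norm_lieOp_smoothW_le {δ : ℝ} (hδ : 0 < δ) (q : ℕ) (N : ℤ) {R : ℝ} (hR : 0 ≤ R)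
    {ψ : ℝ → ℂ} (hψ : ContDiff ℝ ∞ ψ) (hs : tsupport ψ ⊆ Set.Ioo (-R) R) :
    ∃ C : ℝ, 0 ≤ C ∧ ∀ {p : ℕ} (h : CN K N) {j : ℕ}, j < p → ∀ m,
      ‖(lieOp S.V N (S.smoothW hψ R N ((lieOp S.V N)^[j] h))).1 m‖ ≤ C * S.aNorm δ N p q h ∧
      ‖(lieOp S.W N (S.smoothW hψ R N ((lieOp S.V N)^[j] h))).1 m‖ ≤ C * S.aNorm δ N p q h := by
  obtain ⟨C, hC0, hC⟩ := S.exists_norm_pair_le hδ q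
  have hψc := hasCompactSupport_of_tsupport_subset_Ioo hs
  have hψ1 := contDiff_deriv_infty hψ
  have hs1 : tsupport (deriv ψ) ⊆ Set.Ioo (-R) R :=
    tsupport_deriv_subset_Ioo hs
  have hψ2 := contDiff_ofReal_mul hψ
  have hs2 := tsupport_ofReal_mul hs
  obtain ⟨B0, hB0⟩ := DerivBound.exists_of_hasCompactSupport hψ hψc q
  obtain ⟨B1, hB1⟩ := DerivBound.exists_of_hasCompactSupport hψ1 hψc.deriv q
  obtain ⟨B2, hB2⟩ := DerivBound.exists_of_hasCompactSupport hψ2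
    (hasCompactSupport_of_tsupport_subset_Ioo hs2) q
  have := hB0.nonneg
  have := hB1.nonneg
  have := hB2.nonneg
  refine ⟨C * (R + δ) * (B0 + B1 + ‖freq K N‖ * B2), by positivity, ?_⟩
  intro p h j hj m
  have h0 := S.aNorm_nonneg δ N p q h
  have hz : ∀ {φ : ℝ → ℂ}, tsupport φ ⊆ Set.Ioo (-R) R → ∀ t, R < |t| → φ t = 0 :=
    fun h t ht => eq_zero_of_tsupport_subset_Ioo h ht.le
  constructor
  · rw [S.lieOp_V_smoothW hψ hs, ← Function.iterate_succ_apply' (lieOp S.V N)]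
    have h1 := hC hR hψ (hz hs) hB0 h (j := j + 1) hj m
    have h2 := hC hR hψ2 (hz hs2) hB2 h (j := j) hj.le m
    calc _ ≤ C * (R + δ) * B0 * S.aNorm δ N p q h +
          ‖freq K N‖ * (C * (R + δ) * B2 * S.aNorm δ N p q h) := by
          refine (norm_add_le _ _).trans (add_le_add h1 ?_)
          rw [norm_mul]
          gcongr
      _ ≤ C * (R + δ) * (B0 + B1 + ‖freq K N‖ * B2) * S.aNorm δ N p q h := by
          have : 0 ≤ C * (R + δ) * B1 * S.aNorm δ N p q h := by positivity
          linarith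
  · rw [S.lieOp_W_smoothW hψ hs, norm_neg]
    refine (hC hR hψ1 (hz hs1) hB1 h hj.le m).trans ?_
    gcongr
    have : 0 ≤ ‖freq K N‖ * B2 := by positivity
    linarith

/-- The pairings with a fixed test function are controlled by finitely many of them. -/
theorem exists_norm_pair_le_gridPt {δ : ℝ} (hδ : 0 < δ) (q : ℕ) (N : ℤ) {R : ℝ} (hR : 0 ≤ R)
    {ψ : ℝ → ℂ} (hψ : ContDiff ℝ ∞ ψ) (hs : tsupport ψ ⊆ Set.Ioo (-R) R) :
    ∃ C : ℝ, 0 ≤ C ∧ ∀ {p : ℕ} (h : CN K N) {j : ℕ}, j < p → ∀ {D : ℕ}, 0 < D → ∀ m, ∃ i,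
      ‖S.pair ψ m ((lieOp S.V N)^[j] h : CN K N).1‖ ≤
        ‖S.pair ψ (gridPt K D i) ((lieOp S.V N)^[j] h : CN K N).1‖ +
          C / D * S.aNorm δ N p q h := by
  obtain ⟨C, hC0, hC⟩ := S.exists_norm_lieOp_smoothW_le hδ q N hR hψ hs
  have := S.frameSize_nonneg
  refine ⟨2 * C * S.frameSize, by positivity, ?_⟩
  intro p h j hj D hD m
  obtain ⟨i, hi⟩ := S.exists_norm_le_gridPt _ (fun m => (hC h hj m).1) (fun m => (hC h hj m).2) hD m
  rw [S.smoothW_apply hψ hs, S.smoothW_apply hψ hs] at hi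
  exact ⟨i, hi.trans (le_of_eq (by ring))⟩

end PHAut

/-! ### The Lasota–Yorke inequality -/

namespace PHAut

open Nil MeasureTheory

variable {K : ℕ+} (S : PHAut K)

theorem pair_add {ψ φ : ℝ → ℂ} (hψ : Continuous ψ) (hψc : HasCompactSupport ψ) (hφ : Continuous φ)
    (hφc : HasCompactSupport φ) (m : Nil K) {N : ℤ} (h : CN K N) :
    S.pair (fun t => ψ t + φ t) m h.1 = S.pair ψ m h.1 + S.pair φ m h.1 := by
  unfold pair
  rw [← integral_add]
  · simp only [add_mul]
  · exact (hψ.mul (h.2.1.comp_flow S.W m).continuous).integrable_of_hasCompactSupport hψc.mul_right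
  · exact (hφ.mul (h.2.1.comp_flow S.W m).continuous).integrable_of_hasCompactSupport hφc.mul_right

theorem pair_const_mul (c : ℂ) (ψ : ℝ → ℂ) (m : Nil K) (h : Nil K → ℂ) :
    S.pair (fun t => c * ψ t) m h = c * S.pair ψ m h := by
  unfold pair
  rw [← integral_const_mul]
  simp only [mul_assoc]

theorem pair_sum {ι : Type*} (s : Finset ι) {ψ : ι → ℝ → ℂ} (hψ : ∀ i, Continuous (ψ i))
    (hψc : ∀ i, HasCompactSupport (ψ i)) (m : Nil K) {N : ℤ} (h : CN K N) :
    S.pair (fun t => ∑ i ∈ s, ψ i t) m h.1 = ∑ i ∈ s, S.pair (ψ i) m h.1 := by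
  unfold pair
  rw [← integral_finsetSum]
  · simp only [Finset.sum_mul]
  · intro i _
    exact ((hψ i).mul (h.2.1.comp_flow S.W m).continuous).integrable_of_hasCompactSupport
      (hψc i).mul_right

/-- The monomial test functions `χ t^i`. -/
noncomputable def mono (χ : ℝ → ℂ) (i : ℕ) (t : ℝ) : ℂ := χ t * (t : ℂ) ^ i

theorem contDiff_mono {χ : ℝ → ℂ} (hχ : ContDiff ℝ ∞ χ) (i : ℕ) : ContDiff ℝ ∞ (mono χ i) :=
  hχ.mul (contDiff_ofReal_pow i)

theorem tsupport_mono {χ : ℝ → ℂ} {R : ℝ} (h : tsupport χ ⊆ Set.Ioo (-R) R) (i : ℕ) :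
    tsupport (mono χ i) ⊆ Set.Ioo (-R) R := tsupport_mul_subset_Ioo h

/-- A Taylor remainder is controlled only on a bounded interval; this suffices because χ vanishes,
with all derivatives, outside it. -/
theorem derivBound_mul_of_tsupport {χ r : ℝ → ℂ} (hχ : ContDiff ℝ ∞ χ) (hr : ContDiff ℝ ∞ r)
    {δ R A B : ℝ} (hs : tsupport χ ⊆ Set.Ioo (-δ) δ) (hδR : δ ≤ R) (hB0 : 0 ≤ B) {q : ℕ}
    (hA : DerivBound q A χ) (hB : ∀ j ≤ q, ∀ t, |t| ≤ R → ‖iteratedDeriv j r t‖ ≤ B) :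
    DerivBound q (2 ^ q * A * B) (fun t => χ t * r t) := by
  intro j hj t
  have hA0 := hA.nonneg
  by_cases ht : t ∈ tsupport χ
  · have h1 : |t| ≤ R := (abs_lt.2 (hs ht)).le.trans hδR
    refine (norm_iteratedDeriv_mul_le hχ hr (fun i hi => hA i (hi.trans hj) t)
      fun i hi => hB i (hi.trans hj) t h1).trans ?_
    gcongr
    norm_num
  · have h1 : (fun t => χ t * r t) =ᶠ[nhds t] fun _ => 0 := by
      filter_upwards [notMem_tsupport_iff_eventuallyEq.1 ht] with s hs
      rw [hs]; simp
    rw [h1.iteratedDeriv_eq]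
    simp only [iteratedDeriv_const]
    split_ifs <;> simp <;> positivity

/-- Localized pairings with a slowly varying test function are pairings with monomials, up to a
small error. -/
theorem norm_pair_localized_le {δ : ℝ} {N : ℤ} {p q : ℕ} {χ : ℝ → ℂ}
    (hχ : ContDiff ℝ ∞ χ) (hχs : tsupport χ ⊆ Set.Ioo (-δ) δ) {A : ℝ} (hA : DerivBound q A χ)
    {η : ℝ → ℂ} (hη : ContDiff ℝ ∞ η) (hB : DerivBound q 1 η) {c : ℝ} (hc0 : 0 ≤ c) (hc1 : c ≤ 1)
    (h : CN K N) {j : ℕ} (hj : j ≤ p) (a : ℝ) (m : Nil K) {P : ℕ → ℝ}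
    (hP : ∀ i < q, ‖S.pair (mono χ i) m ((lieOp S.V N)^[j] h : CN K N).1‖ ≤ P i) :
    ‖S.pair (fun t => χ t * η (c * (t + a))) m ((lieOp S.V N)^[j] h : CN K N).1‖ ≤
      ∑ i ∈ Finset.range q, P i +
        2 ^ q * (2 ^ q * A * (c ^ q * max 1 δ ^ q)) * S.aNorm δ N p q h := by
  have hsm : ContDiff ℝ ∞ fun t => η (c * (t + a)) :=
    hη.comp (contDiff_const.mul (contDiff_id.add contDiff_const))
  have hder : ∀ (i : ℕ) (t : ℝ), iteratedDeriv i (fun t => η (c * (t + a))) t =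
      (c : ℂ) ^ i * iteratedDeriv i η (c * (t + a)) := by
    intro i t
    rw [iteratedDeriv_comp_add_const (f := fun t => η (c * t))]
    exact iteratedDeriv_comp_mul η hη c i (t + a)
  -- The i-th derivative of η(c(t + a)) carries the factor c^i. Hence the Taylor coefficients are at
  -- most one, and the remainder has size c^q.
  obtain ⟨r, hr, hsum, hrB⟩ := exists_taylor hsm (q := q) (B := c ^ q) (R := max 1 δ)
    (le_max_left _ _) (fun t => by
      rw [hder, norm_mul, norm_pow, Complex.norm_of_nonneg hc0]
      exact mul_le_of_le_one_right (pow_nonneg hc0 q) (hB q le_rfl _))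
  set κ : ℕ → ℂ := fun i => iteratedDeriv i (fun t => η (c * (t + a))) 0 / (i.factorial : ℂ) with hκ
  have hκ1 : ∀ i < q, ‖κ i‖ ≤ 1 := by
    intro i hi
    rw [hκ]
    simp only
    rw [hder, norm_div, norm_mul, norm_pow, Complex.norm_of_nonneg hc0, Complex.norm_natCast]
    have h1 : (1 : ℝ) ≤ i.factorial := by exact_mod_cast Nat.succ_le_of_lt i.factorial_pos
    rw [div_le_one (by linarith)]
    have h2 := hB i hi.le (c * (0 + a))
    have h3 : c ^ i ≤ 1 := pow_le_one₀ hc0 hc1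
    calc c ^ i * ‖iteratedDeriv i η (c * (0 + a))‖ ≤ 1 * 1 := by gcongr
      _ ≤ i.factorial := by linarith
  have hcs : ∀ {f : ℝ → ℂ}, HasCompactSupport fun t => χ t * f t :=
    fun {f} => (hasCompactSupport_of_tsupport_subset_Ioo hχs).mul_right
  have heq : (fun t => χ t * η (c * (t + a))) =
      fun t => (∑ i ∈ Finset.range q, κ i * mono χ i t) + χ t * r t := by
    funext t
    rw [hsum t, mul_add, Finset.mul_sum]
    congr 1
    refine Finset.sum_congr rfl fun i _ => ?_
    unfold mono
    ring
  have hcont : ∀ i, Continuous fun t => κ i * mono χ i t := fun i =>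
    continuous_const.mul (contDiff_mono hχ i).continuous
  have hcs' : ∀ i, HasCompactSupport fun t => κ i * mono χ i t := fun i =>
    (hasCompactSupport_of_tsupport_subset_Ioo (tsupport_mono hχs i)).mul_left
  have hcs'' : HasCompactSupport fun t => ∑ i ∈ Finset.range q, κ i * mono χ i t := by
    have : (fun t => ∑ i ∈ Finset.range q, κ i * mono χ i t) =
        fun t => χ t * ∑ i ∈ Finset.range q, κ i * (t : ℂ) ^ i := by
      funext t
      rw [Finset.mul_sum]
      refine Finset.sum_congr rfl fun i _ => ?_
      unfold mono
      ring
    rw [this]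
    exact hcs
  rw [heq, S.pair_add (ψ := fun t => ∑ i ∈ Finset.range q, κ i * mono χ i t)
    (φ := fun t => χ t * r t) (continuous_finsetSum _ fun i _ => hcont i) hcs''
    (hχ.continuous.mul hr.continuous) hcs, S.pair_sum _ hcont hcs']
  refine (norm_add_le _ _).trans (add_le_add ?_ ?_)
  · refine norm_sum_le_of_le _ fun i hi => ?_
    rw [pair_const_mul, norm_mul]
    have hi' := Finset.mem_range.1 hi
    exact (mul_le_of_le_one_left (norm_nonneg _) (hκ1 i hi')).trans (hP i hi')
  · have hs := tsupport_mul_subset_Ioo (φ := r) hχs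
    rw [← S.ell_eq_pair_of_tsupport hs]
    exact S.norm_ell_le (hχ.mul hr) hs
      (derivBound_mul_of_tsupport hχ hr hχs (le_max_right _ _) (by positivity) hA hrB) h hj m

theorem pow_inv_min_le (p q n : ℕ) {a : ℕ} (ha : min p q ≤ a) :
    (S.lam ^ (a * n))⁻¹ ≤ (S.lam⁻¹ ^ min p q) ^ n := by
  rw [← pow_mul, inv_pow]
  exact inv_anti₀ (pow_pos S.lam_pos _)
    (pow_le_pow_right₀ S.one_lt_lam.le (Nat.mul_le_mul_right n ha))

/-- The Lasota–Yorke inequality, with finitely many functionals in place of a weak norm. -/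
theorem exists_lasotaYorke {δ : ℝ} (hδ : 0 < δ) (N : ℤ) (p q : ℕ) :
    ∃ C : ℝ, ∀ n : ℕ, ∃ (ι : Type) (_ : Fintype ι) (l : CN K N →ₗ[ℂ] (ι → ℂ)) (C' : ℝ),
      (∀ h, ‖l h‖ ≤ C' * S.aNorm δ N p q h) ∧
      ∀ h, S.aNorm δ N p q ((S.transfer N ^ n) h) ≤
        C * (S.lam⁻¹ ^ min p q) ^ n * S.aNorm δ N p q h + ‖l h‖ := by
  obtain ⟨χ, hχ, hχc, hχs, hχ1⟩ := exists_smooth_bump hδ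
  obtain ⟨A, hA⟩ := DerivBound.exists_of_hasCompactSupport hχ hχc q
  have hA0 := hA.nonneg
  obtain ⟨C1, hC10, hC1⟩ := S.exists_norm_ell_transfer_pow_le hδ q
  choose Cg hCg0 hCg using fun i : ℕ =>
    S.exists_norm_pair_le_gridPt hδ q N hδ.le (contDiff_mono hχ i) (tsupport_mono hχs i)
  obtain ⟨C2, hC20, hC2⟩ := S.exists_norm_pair_le hδ q
  choose Bm hBm using fun i : ℕ => DerivBound.exists_of_hasCompactSupport (contDiff_mono hχ i)
    (hasCompactSupport_of_tsupport_subset_Ioo (tsupport_mono hχs i)) q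
  have hBm0 : ∀ i, 0 ≤ Bm i := fun i => (hBm i).nonneg
  set E : ℝ := ∑ i ∈ Finset.range q, Cg i + 2 ^ q * (2 ^ q * A * max 1 δ ^ q) with hE
  have hE0 : 0 ≤ E := by
    have := Finset.sum_nonneg fun i (_ : i ∈ Finset.range q) => hCg0 i
    positivity
  refine ⟨C1 + 4 * δ * E, fun n => ?_⟩
  have hl1 : 1 ≤ S.lam ^ n := one_le_pow₀ S.one_lt_lam.le
  have hl0 : 0 < S.lam ^ n := by linarith
  set c : ℝ := (S.lam ^ n)⁻¹ with hc
  have hc0 : 0 < c := inv_pos.2 hl0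
  have hc1 : c ≤ 1 := inv_le_one_of_one_le₀ hl1
  -- The grid is so fine that its error O(1/D) is no larger than the Taylor error c^q = λ^(-qn). It
  -- depends on n, as do the functionals below.
  obtain ⟨D, hD⟩ := exists_nat_gt ((c ^ q)⁻¹)
  have hcq : 0 < c ^ q := pow_pos hc0 q
  have hDpos : (0 : ℝ) < D := (inv_pos.2 hcq).trans hD
  have hD0 : 0 < D := by exact_mod_cast hDpos
  have hDc : 1 / (D : ℝ) ≤ c ^ q := by
    rw [one_div]
    exact inv_le_of_inv_le₀ hcq hD.le
  -- One functional for each monomial degree below q, each order of V-derivative below p, and each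
  -- grid point.
  let l0 : CN K N →ₗ[ℂ] ((Fin q × Fin p) × (Fin D × Fin D) → ℂ) :=
    LinearMap.pi fun x => (LinearMap.proj (gridPt K D x.2)) ∘ₗ (CN K N).subtype ∘ₗ
      S.smoothW (contDiff_mono hχ x.1.1) δ N ∘ₗ (lieOp S.V N ^ (x.1.2 : ℕ))
  have hl0apply : ∀ (h : CN K N) x, l0 h x =
      S.pair (mono χ x.1.1) (gridPt K D x.2) ((lieOp S.V N)^[x.1.2] h : CN K N).1 := by
    intro h x
    rw [← S.smoothW_apply (contDiff_mono hχ x.1.1) (tsupport_mono hχs _), ← Module.End.pow_apply]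
    rfl
  have hz : ∀ (i : ℕ) (t : ℝ), δ < |t| → mono χ i t = 0 := fun i t ht =>
    eq_zero_of_tsupport_subset_Ioo (tsupport_mono hχs i) ht.le
  have hl0b : ∀ h, ‖l0 h‖ ≤ (∑ i ∈ Finset.range q, C2 * (δ + δ) * Bm i) * S.aNorm δ N p q h := by
    intro h
    have h0 := S.aNorm_nonneg δ N p q h
    have hs0 : 0 ≤ ∑ i ∈ Finset.range q, C2 * (δ + δ) * Bm i :=
      Finset.sum_nonneg fun i _ => mul_nonneg (by positivity) (hBm0 i)
    refine (pi_norm_le_iff_of_nonneg (mul_nonneg hs0 h0)).2 fun x => ?_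
    rw [hl0apply]
    refine (hC2 hδ.le (contDiff_mono hχ _) (hz _) (hBm _) h (p := p) x.1.2.2.le _).trans ?_
    gcongr
    exact Finset.single_le_sum (f := fun i => C2 * (δ + δ) * Bm i)
      (fun i _ => mul_nonneg (by positivity) (hBm0 i)) (Finset.mem_range.2 x.1.1.2)
  -- The factor 4δ bounds the Jacobian λ⁻ⁿ times the window length 2(λⁿδ + δ); q counts the
  -- monomials.
  refine ⟨_, inferInstance, ((4 * δ * q : ℝ) : ℂ) • l0,
    4 * δ * q * (∑ i ∈ Finset.range q, C2 * (δ + δ) * Bm i), fun h => ?_, fun h => ?_⟩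
  · rw [LinearMap.smul_apply, norm_smul, Complex.norm_of_nonneg (by positivity), mul_assoc (4 * δ * (q : ℝ))]
    exact mul_le_mul_of_nonneg_left (hl0b h) (by positivity)
  have h0 := S.aNorm_nonneg δ N p q h
  have hr0 : 0 ≤ S.lam⁻¹ ^ min p q := pow_nonneg (inv_nonneg.2 S.lam_pos.le) _
  rw [LinearMap.smul_apply, norm_smul, Complex.norm_of_nonneg (by positivity)]
  refine S.aNorm_le δ N p q _ (by positivity) fun j hj m η hη => ?_
  -- The top order j = p contracts by itself, by λ^(-pn). For j < p the contraction comes from the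
  -- Taylor remainder, and one spare V-derivative makes the grid argument available.
  rcases hj.eq_or_lt with rfl | hjp
  · refine (hC1 n h le_rfl m η hη).trans ?_
    have h1 := S.pow_inv_min_le j q n (min_le_left j q)
    calc (S.lam ^ (j * n))⁻¹ * (C1 * S.aNorm δ N j q h)
        ≤ (S.lam⁻¹ ^ min j q) ^ n * (C1 * S.aNorm δ N j q h) := by gcongr
      _ = C1 * (S.lam⁻¹ ^ min j q) ^ n * S.aNorm δ N j q h := by ring
      _ ≤ _ := by
        have : 0 ≤ 4 * δ * E * (S.lam⁻¹ ^ min j q) ^ n * S.aNorm δ N j q h := by positivity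
        have : 0 ≤ 4 * δ * q * ‖l0 h‖ := by positivity
        linarith
  · rw [S.ell_lieOp_pow_transfer_pow j n η hη.2.2.1]
    have hloc : ∀ a, ‖S.pair (fun t => χ t * η (c * (t + a)))
        (flow S.W a (S.Phi^[n] m)) ((lieOp S.V N)^[j] h : CN K N).1‖ ≤
        q * ‖l0 h‖ + E * c ^ q * S.aNorm δ N p q h := by
      intro a
      refine (S.norm_pair_localized_le hχ hχs hA hη.1 (DerivBound_of_mem_testFns hη) hc0.le hc1 h
        hj a _ (P := fun i => ‖l0 h‖ + Cg i / D * S.aNorm δ N p q h) fun i hi => ?_).trans ?_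
      · obtain ⟨x, hx⟩ := hCg i h hjp hD0 (flow S.W a (S.Phi^[n] m))
        refine hx.trans (add_le_add ?_ le_rfl)
        have := norm_le_pi_norm (l0 h) ((⟨i, hi⟩, ⟨j, hjp⟩), x)
        rwa [hl0apply] at this
      · rw [Finset.sum_add_distrib, Finset.sum_const, Finset.card_range, nsmul_eq_mul,
          ← Finset.sum_mul, ← Finset.sum_div, add_assoc]
        refine add_le_add le_rfl ?_
        have h2 : (∑ i ∈ Finset.range q, Cg i) / D ≤ (∑ i ∈ Finset.range q, Cg i) * c ^ q := by
          rw [div_eq_mul_one_div]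
          exact mul_le_mul_of_nonneg_left hDc (Finset.sum_nonneg fun i _ => hCg0 i)
        calc _ ≤ (∑ i ∈ Finset.range q, Cg i) * c ^ q * S.aNorm δ N p q h +
              2 ^ q * (2 ^ q * A * (c ^ q * max 1 δ ^ q)) * S.aNorm δ N p q h := by gcongr
          _ = E * c ^ q * S.aNorm δ N p q h := by rw [hE]; ring
    have h3 := S.norm_pair_le_of_localized hδ (R := S.lam ^ n * δ) (by positivity) hχ.continuous hχs
      hχ1 (ψ := fun t => η (c * t)) (hη.1.continuous.comp (continuous_const.mul continuous_id))
      (S.eq_zero_comp_inv_mul hη.2.2.1 n) _ _ hloc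
    have h4 : (S.lam ^ (j * n))⁻¹ ≤ 1 := inv_le_one_of_one_le₀ (one_le_pow₀ S.one_lt_lam.le)
    have h5 : c ^ q ≤ (S.lam⁻¹ ^ min p q) ^ n := by
      rw [hc, inv_pow, ← pow_mul, mul_comm]
      exact S.pow_inv_min_le p q n (min_le_right p q)
    have hM : 0 ≤ q * ‖l0 h‖ + E * c ^ q * S.aNorm δ N p q h := by positivity
    calc _ ≤ 1 * (c * (2 * (S.lam ^ n * δ + δ) * (q * ‖l0 h‖ + E * c ^ q * S.aNorm δ N p q h))) := by
          gcongr
      _ ≤ 1 * (c * (2 * (S.lam ^ n * δ + S.lam ^ n * δ) *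
            (q * ‖l0 h‖ + E * c ^ q * S.aNorm δ N p q h))) := by
          gcongr
          nlinarith
      _ = (c * S.lam ^ n) * (4 * δ * (q * ‖l0 h‖ + E * c ^ q * S.aNorm δ N p q h)) := by ring
      _ = 4 * δ * E * c ^ q * S.aNorm δ N p q h + 4 * δ * q * ‖l0 h‖ := by
          rw [hc, inv_mul_cancel₀ hl0.ne']; ring
      _ ≤ (C1 + 4 * δ * E) * (S.lam⁻¹ ^ min p q) ^ n * S.aNorm δ N p q h + 4 * δ * q * ‖l0 h‖ := by
          gcongr
          linarith

end PHAut

/-! ### Operators on the completions -/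

theorem continuous_smul_clm {X Y : Type*} [NormedAddCommGroup X] [NormedSpace ℂ X]
    [NormedAddCommGroup Y] [NormedSpace ℂ Y] (c : ℂ) (A : X →L[ℂ] Y) :
    Continuous fun x => c • A x := (c • A).continuous

namespace PHAut

open Nil MeasureTheory

variable {K : ℕ+} (S : PHAut K)

section Completion

variable {δ : ℝ} {N : ℤ} {p p' q : ℕ}

theorem norm_emb (h : CN K N) : ‖S.emb δ N p q h‖ = S.aNorm δ N p q h :=
  UniformSpace.Completion.norm_coe (E := S.Pre δ N p q) _

theorem denseRange_emb : DenseRange (S.emb δ N p q) :=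
  UniformSpace.Completion.denseRange_coe (α := S.Pre δ N p q)

theorem emb_sub (f h : CN K N) : S.emb δ N p q (f - h) = S.emb δ N p q f - S.emb δ N p q h :=
  UniformSpace.Completion.coe_sub _ _

theorem emb_smul (c : ℂ) (h : CN K N) : S.emb δ N p q (c • h) = c • S.emb δ N p q h :=
  UniformSpace.Completion.coe_smul (X := S.Pre δ N p q) c _

/-- The extension of a bounded linear map to the completions. -/
noncomputable def extOp (T : CN K N →ₗ[ℂ] CN K N)
    (hT : ∃ C, ∀ h, S.aNorm δ N p' q (T h) ≤ C * S.aNorm δ N p q h) :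
    S.B δ N p q →L[ℂ] S.B δ N p' q :=
  (LinearMap.mkContinuous
    ((S.toPre δ N p' q).toLinearMap ∘ₗ T ∘ₗ (S.toPre δ N p q).symm.toLinearMap) hT.choose
    (fun h => hT.choose_spec ((S.toPre δ N p q).symm h))).completion

theorem extOp_emb (T : CN K N →ₗ[ℂ] CN K N)
    (hT : ∃ C, ∀ h, S.aNorm δ N p' q (T h) ≤ C * S.aNorm δ N p q h) (h : CN K N) :
    S.extOp T hT (S.emb δ N p q h) = S.emb δ N p' q (T h) :=
  ContinuousLinearMap.completion_apply_coe _ _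

theorem VOp_emb (hp : 1 ≤ p) (h : CN K N) :
    S.VOp δ N q hp (S.emb δ N p q h) = S.emb δ N (p - 1) q (lieOp S.V N h) :=
  ContinuousLinearMap.completion_apply_coe _ _

variable {E : Type*} [NormedAddCommGroup E] [NormedSpace ℂ E]

/-- The extension of a bounded linear map with values in a Banach space. -/
noncomputable def extFun [CompleteSpace E] (l : CN K N →ₗ[ℂ] E)
    (hl : ∃ C, ∀ h, ‖l h‖ ≤ C * S.aNorm δ N p q h) : S.B δ N p q →L[ℂ] E :=
  (LinearMap.mkContinuous (l ∘ₗ (S.toPre δ N p q).symm.toLinearMap) hl.choose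
    (fun h => hl.choose_spec ((S.toPre δ N p q).symm h))).extend
      (UniformSpace.Completion.toComplL (𝕜 := ℂ) (E := S.Pre δ N p q))

theorem extFun_emb [CompleteSpace E] (l : CN K N →ₗ[ℂ] E)
    (hl : ∃ C, ∀ h, ‖l h‖ ≤ C * S.aNorm δ N p q h) (h : CN K N) :
    S.extFun l hl (S.emb δ N p q h) = l h :=
  ContinuousLinearMap.extend_eq _ UniformSpace.Completion.denseRange_coe
    (UniformSpace.Completion.isUniformInducing_coe _) _

theorem ext_emb {X : Type*} [TopologicalSpace X] [T2Space X] {f g : S.B δ N p q → X}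
    (hf : Continuous f) (hg : Continuous g)
    (h : ∀ h, f (S.emb δ N p q h) = g (S.emb δ N p q h)) (x : S.B δ N p q) : f x = g x :=
  congrFun (S.denseRange_emb.equalizer hf hg (funext h)) x

theorem le_of_emb {f g : S.B δ N p q → ℝ} (hf : Continuous f) (hg : Continuous g)
    (h : ∀ h, f (S.emb δ N p q h) ≤ g (S.emb δ N p q h)) (x : S.B δ N p q) : f x ≤ g x :=
  S.denseRange_emb.induction_on x (isClosed_le hf hg) h

end Completion

section Operators

variable {δ : ℝ} (N : ℤ) {p p' p'' q : ℕ}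

theorem aNorm_lieOp_pow_le {j : ℕ} (hj : p' + j ≤ p) (h : CN K N) :
    S.aNorm δ N p' q ((lieOp S.V N ^ j) h) ≤ S.aNorm δ N p q h := by
  refine S.aNorm_le δ N p' q _ (S.aNorm_nonneg δ N p q h) fun i hi m η hη => ?_
  rw [Module.End.pow_apply, ← Function.iterate_add_apply]
  exact S.le_aNorm δ N p q h (by omega) m hη

/-- The operator `V^j : B^{p,q} → B^{p',q}` for `p' + j ≤ p`. -/
noncomputable def VPow (δ : ℝ) (q : ℕ) (j : ℕ) (hj : p' + j ≤ p) :
    S.B δ N p q →L[ℂ] S.B δ N p' q :=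
  S.extOp (lieOp S.V N ^ j) ⟨1, fun h => by rw [one_mul]; exact S.aNorm_lieOp_pow_le N hj h⟩

theorem VPow_emb (j : ℕ) (hj : p' + j ≤ p) (h : CN K N) :
    S.VPow N δ q j hj (S.emb δ N p q h) = S.emb δ N p' q ((lieOp S.V N ^ j) h) := S.extOp_emb _ _ h

theorem norm_VPow_le (j : ℕ) (hj : p' + j ≤ p) (x : S.B δ N p q) : ‖S.VPow N δ q j hj x‖ ≤ ‖x‖ :=
  S.le_of_emb (f := fun x => ‖S.VPow N δ q j hj x‖) (g := fun x => ‖x‖) (by fun_prop) (by fun_prop)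
    (fun h => by rw [VPow_emb, norm_emb, norm_emb]; exact S.aNorm_lieOp_pow_le N hj h) x

theorem VPow_zero_self (x : S.B δ N p q) : S.VPow N δ q 0 (le_refl p) x = x :=
  S.ext_emb (f := fun x => S.VPow N δ q 0 (le_refl p) x) (by fun_prop) continuous_id
    (fun h => by rw [VPow_emb]; rfl) x

theorem VPow_VPow (i j : ℕ) (hi : p'' + i ≤ p') (hj : p' + j ≤ p) (x : S.B δ N p q) :
    S.VPow N δ q i hi (S.VPow N δ q j hj x) = S.VPow N δ q (i + j) (by omega) x :=
  S.ext_emb (f := fun x => S.VPow N δ q i hi (S.VPow N δ q j hj x)) (by fun_prop) (by fun_prop)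
    (fun h => by rw [VPow_emb, VPow_emb, VPow_emb, pow_add]; rfl) x

theorem VOp_eq_VPow (hp : 1 ≤ p) (x : S.B δ N p q) :
    S.VOp δ N q hp x = S.VPow N δ q 1 (by omega) x :=
  S.ext_emb (by fun_prop) (by fun_prop) (fun h => by rw [VOp_emb, VPow_emb, pow_one]) x

theorem mem_kerV (hp : 1 ≤ p) (x : S.B δ N p q) : x ∈ S.kerV δ N q hp ↔ S.VOp δ N q hp x = 0 :=
  LinearMap.mem_ker

/-- The transfer operator on `B^{p,q}`. -/
noncomputable def koop {δ : ℝ} (hδ : 0 < δ) (N : ℤ) (p q : ℕ) : S.B δ N p q →L[ℂ] S.B δ N p q :=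
  S.extOp (S.transfer N) (by
    obtain ⟨C, -, hC⟩ := S.exists_aNorm_transfer_pow_le hδ q
    exact ⟨C, fun h => by simpa using hC 1 h⟩)

variable (hδ : 0 < δ)

theorem koop_emb (h : CN K N) :
    S.koop hδ N p q (S.emb δ N p q h) = S.emb δ N p q (S.transfer N h) := S.extOp_emb _ _ h

theorem koop_pow_emb (n : ℕ) (h : CN K N) :
    (S.koop hδ N p q ^ n) (S.emb δ N p q h) = S.emb δ N p q ((S.transfer N ^ n) h) := by
  induction n with
  | zero => rfl
  | succ n ih => rw [pow_succ', mul_apply_eq_comp, ih, koop_emb, pow_succ', Module.End.mul_apply]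

theorem VPow_koop (j : ℕ) (hj : p' + j ≤ p) (x : S.B δ N p q) :
    S.VPow N δ q j hj (S.koop hδ N p q x) =
      ((S.lam : ℂ)⁻¹ ^ j) • S.koop hδ N p' q (S.VPow N δ q j hj x) :=
  S.ext_emb (f := fun x => S.VPow N δ q j hj (S.koop hδ N p q x))
    (g := fun x => ((S.lam : ℂ)⁻¹ ^ j) • S.koop hδ N p' q (S.VPow N δ q j hj x))
    (by fun_prop)
    (continuous_smul_clm _ ((S.koop hδ N p' q).comp (S.VPow N δ q j hj)))
    (fun h => by
      have h1 : (lieOp S.V N ^ j) (S.transfer N h) =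
          ((S.lam : ℂ)⁻¹ ^ j) • S.transfer N ((lieOp S.V N ^ j) h) := by
        rw [Module.End.pow_apply, Module.End.pow_apply]
        exact S.lieOp_pow_transfer j h
      rw [koop_emb, VPow_emb, VPow_emb, koop_emb, h1]
      exact S.emb_smul _ _) x

theorem exists_norm_koop_pow_le : ∃ C : ℝ, ∀ n (x : S.B δ N p q),
    ‖(S.koop hδ N p q ^ n) x‖ ≤ C * ‖x‖ := by
  obtain ⟨C, -, hC⟩ := S.exists_aNorm_transfer_pow_le hδ q
  refine ⟨C, fun n x => S.le_of_emb (f := fun x => ‖(S.koop hδ N p q ^ n) x‖)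
    (g := fun x => C * ‖x‖) (by fun_prop) (by fun_prop) (fun h => ?_) x⟩
  rw [koop_pow_emb, norm_emb, norm_emb]
  exact hC n h

theorem koop_pow_eigen {x : S.B δ N p q} {z : ℂ} (h : S.koop hδ N p q x = z • x) (n : ℕ) :
    (S.koop hδ N p q ^ n) x = z ^ n • x := by
  induction n with
  | zero => simp
  | succ n ih => rw [pow_succ', mul_apply_eq_comp, ih, map_smul, h, smul_smul, pow_succ]

/-- The vectors zⁿx = Lⁿx stay bounded. -/
theorem norm_le_one_of_eigen {x : S.B δ N p q} {z : ℂ} (h : S.koop hδ N p q x = z • x)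
    (hx : x ≠ 0) : ‖z‖ ≤ 1 := by
  obtain ⟨C, hC⟩ := S.exists_norm_koop_pow_le N (p := p) (q := q) hδ
  by_contra hz
  obtain ⟨n, hn⟩ := pow_unbounded_of_one_lt C (not_le.1 hz)
  have h1 := hC n x
  rw [S.koop_pow_eigen N hδ h, norm_smul, norm_pow] at h1
  exact absurd (le_of_mul_le_mul_right h1 (norm_pos_iff.2 hx)) (not_le.2 hn)

/-- The functionals in the Lasota–Yorke inequality are bounded for the anisotropic norm, so they
extend to the completion and the inequality follows by density. -/
theorem quasiCompact_koop : QuasiCompact (S.koop hδ N p q) (S.lam⁻¹ ^ min p q) := by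
  obtain ⟨C, hC⟩ := S.exists_lasotaYorke hδ N p q
  refine ⟨C, fun n => ?_⟩
  obtain ⟨ι, hι, l, C', hl, h⟩ := hC n
  refine ⟨ι, hι, S.extFun l ⟨C', hl⟩, fun x =>
    S.le_of_emb (f := fun x => ‖(S.koop hδ N p q ^ n) x‖)
      (g := fun x => C * (S.lam⁻¹ ^ min p q) ^ n * ‖x‖ + ‖S.extFun l ⟨C', hl⟩ x‖)
      (by fun_prop) (by fun_prop) (fun f => ?_) x⟩
  rw [koop_pow_emb, norm_emb, norm_emb, extFun_emb]
  exact h f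

variable {N} in
theorem koop_mem_kerV (hp : 1 ≤ p) (x : S.B δ N p q) (hx : x ∈ S.kerV δ N q hp) :
    S.koop hδ N p q x ∈ S.kerV δ N q hp := by
  rw [mem_kerV, VOp_eq_VPow] at hx ⊢
  rw [VPow_koop, hx, map_zero, smul_zero]

end Operators

/-! ### Test functionals on the completion -/

section Pairing

variable {δ : ℝ} (hδ : 0 < δ) (N : ℤ) (p q : ℕ)

theorem exists_norm_pair_const_le {δ : ℝ} (hδ : 0 < δ) (q : ℕ) {ψ : ℝ → ℂ} {R : ℝ}
    (hψ : ContDiff ℝ ∞ ψ) (hs : tsupport ψ ⊆ Set.Ioo (-R) R) : ∃ C : ℝ, 0 ≤ C ∧ ∀ {N : ℤ} {p : ℕ}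
      (h : CN K N) (m : Nil K), ‖S.pair ψ m h.1‖ ≤ C * S.aNorm δ N p q h := by
  obtain ⟨C, hC0, hC⟩ := S.exists_norm_pair_le hδ q
  obtain ⟨B, hB⟩ := DerivBound.exists_of_hasCompactSupport hψ
    (hasCompactSupport_of_tsupport_subset_Ioo hs) q
  have := hB.nonneg
  refine ⟨C * (|R| + δ) * B, by positivity, fun {N p} h m => ?_⟩
  refine hC (abs_nonneg R) hψ (fun t ht => eq_zero_of_tsupport_subset_Ioo hs ?_) hB h
    (j := 0) (Nat.zero_le p) m
  exact (le_abs_self R).trans ht.le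

/-- The extension of `h ↦ ∫ ψ(t) h(φ^W_t m) dt` to `B^{p,q}`. -/
noncomputable def pairB {ψ : ℝ → ℂ} {R : ℝ} (hψ : ContDiff ℝ ∞ ψ)
    (hs : tsupport ψ ⊆ Set.Ioo (-R) R) (m : Nil K) : S.B δ N p q →L[ℂ] ℂ :=
  S.extFun (LinearMap.proj m ∘ₗ (CN K N).subtype ∘ₗ S.smoothW hψ R N) (by
    obtain ⟨C, -, hC⟩ := S.exists_norm_pair_const_le hδ q hψ hs
    refine ⟨C, fun h => ?_⟩
    change ‖(S.smoothW hψ R N h).1 m‖ ≤ _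
    rw [S.smoothW_apply hψ hs]
    exact hC h m)

theorem pairB_emb {ψ : ℝ → ℂ} {R : ℝ} (hψ : ContDiff ℝ ∞ ψ)
    (hs : tsupport ψ ⊆ Set.Ioo (-R) R) (m : Nil K) (h : CN K N) :
    S.pairB hδ N p q hψ hs m (S.emb δ N p q h) = S.pair ψ m h.1 := by
  unfold pairB
  rw [extFun_emb, ← S.smoothW_apply hψ hs]
  rfl

theorem norm_pairB_le {η : ℝ → ℂ} (hη : η ∈ testFns δ q) (m : Nil K) (x : S.B δ N p q) :
    ‖S.pairB hδ N p q hη.1 hη.2.2.1 m x‖ ≤ ‖x‖ := by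
  refine S.le_of_emb (f := fun x => ‖S.pairB hδ N p q hη.1 hη.2.2.1 m x‖) (g := fun x => ‖x‖)
    (by fun_prop) (by fun_prop) (fun h => ?_) x
  rw [pairB_emb, norm_emb, ← S.ell_eq_pair_of_tsupport hη.2.2.1]
  exact S.le_aNorm δ N p q h (j := 0) (Nat.zero_le _) m hη

variable {N p q}

/-- Orders j ≥ 1 of h are orders j - 1 of Vh. On ker V the norm is therefore that of the image in
B^{0,q}. -/
theorem aNorm_le_max (hp : 1 ≤ p) (h : CN K N) :
    S.aNorm δ N p q h ≤ max (S.aNorm δ N 0 q h) (S.aNorm δ N (p - 1) q (lieOp S.V N h)) := by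
  refine S.aNorm_le δ N p q _ (le_max_of_le_left (S.aNorm_nonneg δ N 0 q h)) fun j hj m η hη => ?_
  cases j with
  | zero => exact le_max_of_le_left (S.le_aNorm δ N 0 q h le_rfl m hη)
  | succ j =>
    rw [Function.iterate_succ_apply]
    exact le_max_of_le_right (S.le_aNorm δ N (p - 1) q _ (by omega) m hη)

theorem norm_le_max (hp : 1 ≤ p) (x : S.B δ N p q) :
    ‖x‖ ≤ max ‖S.VPow N δ q 0 (Nat.zero_le p) x‖ ‖S.VOp δ N q hp x‖ := by
  refine S.le_of_emb (f := fun x => ‖x‖)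
    (g := fun x => max ‖S.VPow N δ q 0 (Nat.zero_le p) x‖ ‖S.VOp δ N q hp x‖)
    (by fun_prop) (by fun_prop) (fun h => ?_) x
  rw [VPow_emb, VOp_emb, norm_emb, norm_emb, norm_emb]
  exact S.aNorm_le_max hp h

/-- The supremum formula survives completion because all functionals with admissible η have norm at
most one. -/
theorem norm_le_of_pairB_zero {x : S.B δ N 0 q} {M : ℝ} (hM : 0 ≤ M)
    (h : ∀ m η, (hη : η ∈ testFns δ q) → ‖S.pairB hδ N 0 q hη.1 hη.2.2.1 m x‖ ≤ M) : ‖x‖ ≤ M := by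
  refine le_of_forall_pos_le_add fun ε hε => ?_
  obtain ⟨f, hf⟩ := S.denseRange_emb.exists_dist_lt x (half_pos hε)
  rw [dist_eq_norm] at hf
  have h1 : ‖S.emb δ N 0 q f‖ ≤ M + ε / 2 := by
    rw [norm_emb]
    refine S.aNorm_le δ N 0 q f (by positivity) fun j hj m η hη => ?_
    obtain rfl : j = 0 := by omega
    rw [S.ell_eq_pair_of_tsupport hη.2.2.1, Function.iterate_zero_apply,
      ← S.pairB_emb hδ N 0 q hη.1 hη.2.2.1]
    have h2 := S.norm_pairB_le hδ N 0 q hη m (S.emb δ N 0 q f - x)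
    rw [map_sub, norm_sub_rev (S.emb δ N 0 q f)] at h2
    have h3 := norm_le_norm_add_norm_sub' (S.pairB hδ N 0 q hη.1 hη.2.2.1 m (S.emb δ N 0 q f))
      (S.pairB hδ N 0 q hη.1 hη.2.2.1 m x)
    linarith [h m η hη]
  linarith [norm_le_norm_add_norm_sub' x (S.emb δ N 0 q f)]

theorem pairB_VPow_zero {ψ : ℝ → ℂ} {R : ℝ} (hψ : ContDiff ℝ ∞ ψ)
    (hs : tsupport ψ ⊆ Set.Ioo (-R) R) (m : Nil K) {p' : ℕ} (hp : p' + 0 ≤ p) (x : S.B δ N p q) :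
    S.pairB hδ N p' q hψ hs m (S.VPow N δ q 0 hp x) = S.pairB hδ N p q hψ hs m x :=
  S.ext_emb (f := fun x => S.pairB hδ N p' q hψ hs m (S.VPow N δ q 0 hp x)) (by fun_prop)
    (by fun_prop) (fun h => by rw [VPow_emb, pairB_emb, pairB_emb]; rfl) x

/-- On the kernel of `V` the norm is given by the functionals without derivatives. -/
theorem norm_le_of_mem_kerV {hp : 1 ≤ p} {x : S.B δ N p q} (hx : x ∈ S.kerV δ N q hp) {M : ℝ}
    (hM : 0 ≤ M)
    (h : ∀ m η, (hη : η ∈ testFns δ q) → ‖S.pairB hδ N p q hη.1 hη.2.2.1 m x‖ ≤ M) : ‖x‖ ≤ M := by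
  refine (S.norm_le_max hp x).trans (max_le ?_ ?_)
  · refine S.norm_le_of_pairB_zero hδ hM fun m η hη => ?_
    rw [pairB_VPow_zero]
    exact h m η hη
  · rw [(S.mem_kerV N hp x).1 hx, norm_zero]
    exact hM

/-- Inequalities up to an error controlled by `Vh` hold on the kernel of `V`. -/
theorem le_of_mem_kerV {hp : 1 ≤ p} {f g : S.B δ N p q → ℝ} (hf : Continuous f) (hg : Continuous g)
    {C : ℝ} (h : ∀ h, f (S.emb δ N p q h) ≤
      g (S.emb δ N p q h) + C * S.aNorm δ N (p - 1) q (lieOp S.V N h))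
    {x : S.B δ N p q} (hx : x ∈ S.kerV δ N q hp) : f x ≤ g x := by
  have h1 := S.le_of_emb hf (g := fun x => g x + C * ‖S.VOp δ N q hp x‖) (by fun_prop)
    (fun u => by rw [VOp_emb, norm_emb]; exact h u) x
  rwa [(S.mem_kerV N hp x).1 hx, norm_zero, mul_zero, add_zero] at h1

end Pairing

end PHAut

/-! ### Translations along V and density of the range of V -/

namespace Nil

variable {K : ℕ+}

/-- The character by which the flows of `V` and `W` fail to commute on `C_N^∞`. -/
noncomputable def twist (K : ℕ+) (N : ℤ) (s t : ℝ) : ℂ := Complex.exp (freq K N * ((-s * t : ℝ) : ℂ))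

theorem norm_twist (N : ℤ) (s t : ℝ) : ‖twist K N s t‖ = 1 := norm_exp_freq K N _

theorem hasDerivAt_twist (N : ℤ) (s t : ℝ) :
    HasDerivAt (twist K N s) (-(freq K N * s) * twist K N s t) t := by
  have h := hasDerivAt_exp_freq K N (-s) t
  unfold twist
  refine (h.congr_deriv ?_).congr_of_eventuallyEq (Filter.Eventually.of_forall fun r => ?_)
  · push_cast; ring_nf
  · push_cast; ring_nf

theorem contDiff_twist (N : ℤ) (s : ℝ) : ContDiff ℝ ∞ (twist K N s) :=
  (contDiff_const.mul
    (Complex.ofRealCLM.contDiff.comp (contDiff_const.mul contDiff_id))).cexp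

theorem continuous_twist (N : ℤ) : Continuous fun y : ℝ × ℝ => twist K N y.1 y.2 := by
  unfold twist
  fun_prop

theorem iteratedDeriv_twist (N : ℤ) (s : ℝ) (j : ℕ) (t : ℝ) :
    iteratedDeriv j (twist K N s) t = (-(freq K N * s)) ^ j * twist K N s t := by
  induction j generalizing t with
  | zero => simp
  | succ j ih =>
    rw [iteratedDeriv_succ, funext ih, ((hasDerivAt_twist N s t).const_mul _).deriv]
    ring

theorem derivBound_twist (q : ℕ) (N : ℤ) (s : ℝ) :
    DerivBound q ((1 + ‖freq K N‖ * |s|) ^ q) (twist K N s) := by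
  intro j hj t
  have h0 : 0 ≤ ‖freq K N‖ * |s| := by positivity
  rw [iteratedDeriv_twist, norm_mul, norm_twist, mul_one, norm_pow, norm_neg, norm_mul,
    Complex.norm_real, Real.norm_eq_abs]
  exact (pow_le_pow_left₀ h0 (by linarith) j).trans (pow_le_pow_right₀ (by linarith) hj)

/-- The translation by `exp(sv)` on `C_N^∞`. -/
noncomputable def transl (v : ℝ × ℝ × ℝ) (N : ℤ) (s : ℝ) : CN K N →ₗ[ℂ] CN K N :=
  LinearMap.id + lieOp v N ∘ₗ flowIntOp v (contDiff_const (c := (1 : ℂ))) 0 s N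

/-- Fundamental theorem of calculus along the orbit. Defining the translation as identity plus the
derivative of an orbit integral keeps it inside C_N^∞ and exhibits `transl v N s h - h` as an
element of the range of `lieOp v N`. -/
theorem transl_apply (v : ℝ × ℝ × ℝ) {N : ℤ} (s : ℝ) (h : CN K N) (m : Nil K) :
    (transl v N s h).1 m = h.1 (flow v s m) := by
  change h.1 m + (lieOp v N (flowIntOp v _ 0 s N h)).1 m = _
  rw [lieOp_flowIntOp_self, flowIntOp_lieOp_self v contDiff_const contDiff_const
    (w' := fun _ => 0) fun t => hasDerivAt_const t 1, flowIntOp_apply, flow_zero]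
  simp

theorem lieOp_transl (v : ℝ × ℝ × ℝ) {N : ℤ} (s : ℝ) (h : CN K N) :
    lieOp v N (transl v N s h) = transl v N s (lieOp v N h) := by
  change lieOp v N (h + lieOp v N (flowIntOp v _ 0 s N h)) =
    lieOp v N h + lieOp v N (flowIntOp v _ 0 s N (lieOp v N h))
  rw [map_add, lieOp_flowIntOp_self]

theorem lieOp_pow_transl (v : ℝ × ℝ × ℝ) {N : ℤ} (s : ℝ) (h : CN K N) (j : ℕ) :
    (lieOp v N)^[j] (transl v N s h) = transl v N s ((lieOp v N)^[j] h) :=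
  (Function.Commute.iterate_left (f := lieOp v N) (g := transl v N s) (lieOp_transl v s) j) h

end Nil

namespace PHAut

open Nil MeasureTheory

variable {K : ℕ+} (S : PHAut K)

theorem flow_V_flow_W {N : ℤ} (h : CN K N) (s t : ℝ) (m : Nil K) :
    h.1 (flow S.V s (flow S.W t m)) = twist K N s t * h.1 (flow S.W t (flow S.V s m)) := by
  rw [flow_comm S.bracket_VW, CN.map_flow_dz h.2, ← mul_assoc]
  unfold twist
  rw [← Complex.exp_add]
  have : freq K N * ((-s * t : ℝ) : ℂ) + freq K N * ((s * t : ℝ) : ℂ) = 0 := by push_cast; ring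
  rw [this, Complex.exp_zero, one_mul]

theorem pair_transl {N : ℤ} (ψ : ℝ → ℂ) (s : ℝ) (h : CN K N) (m : Nil K) :
    S.pair ψ m (transl S.V N s h).1 = S.pair (fun t => ψ t * twist K N s t) (flow S.V s m) h.1 := by
  unfold pair
  congr 1
  funext t
  rw [transl_apply, flow_V_flow_W, mul_assoc]

/-- By `pair_transl` a translation along V modulates the test function by a character of frequency
proportional to s, whose derivatives up to order q cause the polynomial growth. -/
theorem exists_norm_pair_transl_le {δ : ℝ} (hδ : 0 < δ) (q : ℕ) (N : ℤ) {R : ℝ}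
    (hR : 0 ≤ R) : ∃ C : ℝ, 0 ≤ C ∧ ∀ {ψ : ℝ → ℂ} {B : ℝ}, ContDiff ℝ ∞ ψ →
      tsupport ψ ⊆ Set.Ioo (-R) R → DerivBound q B ψ → ∀ {p : ℕ} (s : ℝ) (h : CN K N) (m : Nil K),
      ‖S.pair ψ m (transl S.V N s h).1‖ ≤
        C * B * (1 + ‖freq K N‖ * |s|) ^ q * S.aNorm δ N p q h := by
  obtain ⟨C, hC0, hC⟩ := S.exists_norm_pair_le hδ q
  refine ⟨C * (R + δ) * 2 ^ q, by positivity, fun {ψ B} hψ hs hB {p} s h m => ?_⟩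
  rw [pair_transl]
  have hs' := tsupport_mul_subset_Ioo (φ := twist K N s) hs
  exact (hC hR (hψ.mul (contDiff_twist N s))
    (fun t ht => eq_zero_of_tsupport_subset_Ioo hs' ht.le)
    (hB.mul hψ (contDiff_twist N s) (derivBound_twist q N s)) h (j := 0) (Nat.zero_le p) _).trans
    (le_of_eq (by ring))

theorem hasDerivAt_pair_transl {N : ℤ} {ψ : ℝ → ℂ} {R : ℝ} (hψ : ContDiff ℝ ∞ ψ)
    (hs : tsupport ψ ⊆ Set.Ioo (-R) R) (h : CN K N) (m : Nil K) (s : ℝ) :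
    HasDerivAt (fun s => S.pair ψ m (transl S.V N s h).1)
      (S.pair ψ m (transl S.V N s (lieOp S.V N h)).1) s := by
  simp only [← S.ell_eq_pair_of_tsupport hs]
  refine hasDerivAt_intervalIntegral_param
    (f := fun y : ℝ × ℝ => ψ y.2 * (transl S.V N y.1 h).1 (flow S.W y.2 m)) ?_ _ _ fun t => ?_
  · simp only [transl_apply]
    exact (hψ.comp contDiff_snd).mul
      ((h.2.1.contDiff_flow_flow S.W S.V m).comp (contDiff_snd.prodMk contDiff_fst))
  · simp only [transl_apply]
    exact (hasDerivAt_flow S.V h (flow S.W t m) s).const_mul (ψ t)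

/-- Mean value inequality in s: the derivative is the pairing with a translate of Vh. In the limit,
elements of ker V are invariant under translation along V. -/
theorem exists_norm_pair_transl_sub_le {δ : ℝ} (hδ : 0 < δ) (q : ℕ) (N : ℤ) {R : ℝ}
    (hR : 0 ≤ R) : ∃ C : ℝ, 0 ≤ C ∧ ∀ {ψ : ℝ → ℂ} {B : ℝ}, ContDiff ℝ ∞ ψ →
      tsupport ψ ⊆ Set.Ioo (-R) R → DerivBound q B ψ → ∀ {p : ℕ} (s : ℝ) (h : CN K N) (m : Nil K),
      ‖S.pair ψ m (transl S.V N s h).1 - S.pair ψ m h.1‖ ≤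
        C * B * (1 + ‖freq K N‖ * |s|) ^ q * S.aNorm δ N p q (lieOp S.V N h) * |s| := by
  obtain ⟨C, hC0, hC⟩ := S.exists_norm_pair_transl_le hδ q N hR
  refine ⟨C, hC0, fun {ψ B} hψ hs hB {p} s h m => ?_⟩
  have hB0 := hB.nonneg
  have hn := S.aNorm_nonneg δ N p q (lieOp S.V N h)
  have h1 := (convex_Icc (-|s|) |s|).norm_image_sub_le_of_norm_hasDerivWithin_le
    (f := fun r => S.pair ψ m (transl S.V N r h).1)
    (f' := fun r => S.pair ψ m (transl S.V N r (lieOp S.V N h)).1)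
    (C := C * B * (1 + ‖freq K N‖ * |s|) ^ q * S.aNorm δ N p q (lieOp S.V N h))
    (fun r _ => (S.hasDerivAt_pair_transl hψ hs h m r).hasDerivWithinAt)
    (fun r hr => by
      refine (hC hψ hs hB (p := p) r _ m).trans ?_
      have := abs_le.2 hr
      gcongr) (x := 0) (y := s)
    ⟨neg_nonpos.2 (abs_nonneg s), abs_nonneg s⟩ (abs_le.1 le_rfl)
  have h2 : S.pair ψ m (transl S.V N 0 h).1 = S.pair ψ m h.1 := by
    unfold pair
    simp only [transl_apply, flow_zero]
  rw [h2, sub_zero, Real.norm_eq_abs] at h1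
  exact h1

section Range

/-- Translates by `exp(TV)` tend to zero. -/
theorem exists_norm_pair_transl_le_inv {N : ℤ} (hN : N ≠ 0) (h : CN K N) {δ : ℝ} (hδ : 0 < δ)
    {q : ℕ} (hq : 1 ≤ q) : ∃ C : ℝ, 0 ≤ C ∧ ∀ s : ℝ, 0 < s → ∀ m, ∀ η ∈ testFns δ q,
      ‖S.pair η m (transl S.V N s h).1‖ ≤ C / s := by
  obtain ⟨A, hA⟩ := h.2.1.bounded
  obtain ⟨B, hB⟩ := (lieOp S.W N h).2.1.bounded
  have hA0 : 0 ≤ A := (norm_nonneg _).trans (hA (gridPt K 1 0))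
  have hB0 : 0 ≤ B := (norm_nonneg _).trans (hB (gridPt K 1 0))
  have hc := freq_ne_zero K hN
  have hc' : 0 < ‖freq K N‖ := norm_pos_iff.2 hc
  refine ⟨2 * δ * (A + B) / ‖freq K N‖, by positivity, fun s hs m η hη => ?_⟩
  rw [pair_transl]
  set m' := flow S.V s m
  have hs' := tsupport_mul_subset_Ioo (φ := twist K N s) hη.2.2.1
  have hη1 := contDiff_deriv_infty hη.1
  have hD := DerivBound_of_mem_testFns hη
  have hd : ∀ t, HasDerivAt η (deriv η t) t := fun t =>
    (hη.1.differentiable (by simp) t).hasDerivAt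
  have hu : ∀ t, HasDerivAt (fun t => η t * h.1 (flow S.W t m'))
      (deriv η t * h.1 (flow S.W t m') + η t * (lieOp S.W N h).1 (flow S.W t m')) t :=
    fun t => (hd t).mul (hasDerivAt_flow S.W h m' t)
  have hη0 : ∀ t, δ ≤ |t| → η t = 0 := fun t ht => eq_zero_of_tsupport_subset_Ioo hη.2.2.1 ht
  have hcont : Continuous fun t => deriv η t * h.1 (flow S.W t m') +
      η t * (lieOp S.W N h).1 (flow S.W t m') :=
    (hη1.continuous.mul (h.2.1.comp_flow S.W m').continuous).add
      (hη.1.continuous.mul ((lieOp S.W N h).2.1.comp_flow S.W m').continuous)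
  -- The character has derivative -`freq` s times itself, so integrating by parts gains 1/s.
  -- Boundary terms vanish by the support of η, and q ≥ 1 bounds its first derivative.
  have hibp := intervalIntegral.integral_mul_deriv_eq_deriv_mul (a := -δ) (b := δ)
    (fun t _ => hu t) (fun t _ => hasDerivAt_twist (K := K) N s t)
    (hcont.intervalIntegrable _ _)
    ((continuous_const.mul (contDiff_twist N s).continuous).intervalIntegrable _ _)
  rw [hη0 δ (le_abs_self δ), hη0 (-δ) (by rw [abs_neg]; exact le_abs_self δ)] at hibp
  simp only [zero_mul, sub_zero, zero_sub] at hibp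
  have h1 : freq K N * s * S.pair (fun t => η t * twist K N s t) m' h.1 =
      ∫ t in (-δ)..δ, (deriv η t * h.1 (flow S.W t m') +
        η t * (lieOp S.W N h).1 (flow S.W t m')) * twist K N s t := by
    rw [← neg_inj, ← hibp, ← S.ell_eq_pair_of_tsupport hs']
    unfold ell
    rw [← intervalIntegral.integral_const_mul, ← intervalIntegral.integral_neg]
    refine intervalIntegral.integral_congr fun t _ => ?_
    beta_reduce
    ring
  have h2 : ‖∫ t in (-δ)..δ, (deriv η t * h.1 (flow S.W t m') +
        η t * (lieOp S.W N h).1 (flow S.W t m')) * twist K N s t‖ ≤ (A + B) * |δ - -δ| := by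
    refine intervalIntegral.norm_integral_le_of_norm_le_const fun t _ => ?_
    rw [norm_mul, norm_twist, mul_one]
    refine (norm_add_le _ _).trans (add_le_add ?_ ?_)
    · rw [norm_mul]
      have h3 := hD 1 hq t
      rw [iteratedDeriv_one] at h3
      exact (mul_le_mul h3 (hA _) (norm_nonneg _) zero_le_one).trans (one_mul _).le
    · rw [norm_mul]
      exact (mul_le_mul (hD.norm_le t) (hB _) (norm_nonneg _) zero_le_one).trans (one_mul _).le
  rw [← h1, norm_mul, norm_mul, Complex.norm_of_nonneg hs.le, sub_neg_eq_add,
    abs_of_pos (by linarith)] at h2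
  rw [div_div, le_div_iff₀ (by positivity)]
  linarith

variable {δ : ℝ} {N : ℤ} {p q : ℕ}

theorem exists_aNorm_transl_le_inv (hN : N ≠ 0) (hδ : 0 < δ) (hq : 1 ≤ q) (h : CN K N) :
    ∃ C : ℝ, ∀ s : ℝ, 0 < s → S.aNorm δ N p q (transl S.V N s h) ≤ C / s := by
  choose C hC0 hC using fun j => S.exists_norm_pair_transl_le_inv hN ((lieOp S.V N)^[j] h) hδ hq
  have h0 : 0 ≤ ∑ j ∈ Finset.range (p + 1), C j := Finset.sum_nonneg fun j _ => hC0 j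
  refine ⟨∑ j ∈ Finset.range (p + 1), C j, fun s hs => ?_⟩
  refine S.aNorm_le δ N p q _ (by positivity) fun j hj m η hη => ?_
  rw [S.ell_eq_pair_of_tsupport hη.2.2.1, lieOp_pow_transl]
  refine (hC j s hs m η hη).trans ?_
  gcongr
  exact Finset.single_le_sum (f := C) (fun i _ => hC0 i) (Finset.mem_range.2 (by omega))

/-- V maps minus the orbit integral of f over [0, s] to f minus its translate by s, and that
translate has norm O(1/s). -/
theorem denseRange_VOp (hN : N ≠ 0) (hδ : 0 < δ) (hq : 1 ≤ q) (hp : 1 ≤ p) :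
    DenseRange (S.VOp δ N q hp) := by
  have h1 : ∀ f : CN K N, S.emb δ N (p - 1) q f ∈ closure (Set.range (S.VOp δ N q hp)) := by
    intro f
    obtain ⟨C, hC⟩ := S.exists_aNorm_transl_le_inv (p := p - 1) hN hδ hq f
    refine Metric.mem_closure_iff.2 fun ε hε => ?_
    obtain ⟨n, hn⟩ := exists_nat_gt (C / ε)
    have hs : (0 : ℝ) < n + 1 := by positivity
    refine ⟨_, ⟨S.emb δ N p q
      (-(flowIntOp S.V (contDiff_const (c := (1 : ℂ))) 0 ((n : ℝ) + 1) N f)), rfl⟩, ?_⟩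
    rw [VOp_emb, dist_eq_norm, ← emb_sub, norm_emb, map_neg, sub_neg_eq_add]
    refine (hC _ hs).trans_lt ?_
    rw [div_lt_iff₀ hs, ← div_lt_iff₀' hε]
    linarith
  intro x
  refine closure_minimal ?_ isClosed_closure (S.denseRange_emb x)
  rintro _ ⟨f, rfl⟩
  exact h1 f

theorem denseRange_VPow (hN : N ≠ 0) (hδ : 0 < δ) (hq : 1 ≤ q) (j : ℕ) :
    ∀ {p p' : ℕ} (hj : p' + j = p), DenseRange (S.VPow N δ q j hj.le) := by
  induction j with
  | zero =>
    rintro p p' rfl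
    have : (S.VPow N δ q 0 (le_refl (p' + 0)) : S.B δ N (p' + 0) q → S.B δ N p' q) = id :=
      funext fun x => S.VPow_zero_self N (p := p') x
    rw [this]
    exact denseRange_id
  | succ j ih =>
    rintro p p' rfl
    have h1 : ∀ x, S.VPow N δ q j (le_refl (p' + j)) (S.VOp δ N q (p := p' + (j + 1)) (by omega) x) =
        S.VPow N δ q (j + 1) (le_refl (p' + (j + 1))) x := by
      intro x
      rw [VOp_eq_VPow]
      exact S.VPow_VPow N j 1 _ _ x
    have h2 := (ih (p := p' + j) (p' := p') rfl).comp
      (S.denseRange_VOp hN hδ hq (p := p' + (j + 1)) (by omega))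
      (S.VPow N δ q j (le_refl (p' + j))).continuous
    have h3 : (S.VPow N δ q (j + 1) (le_refl (p' + (j + 1))) : _ → _) =
      S.VPow N δ q j (le_refl (p' + j)) ∘ S.VOp δ N q (p := p' + (j + 1)) (by omega) :=
        funext fun x => (h1 x).symm
    rw [h3]
    exact h2

end Range

end PHAut

/-! ### Smoothing along V and independence of ker V from p -/

namespace PHAut

open Nil MeasureTheory

variable {K : ℕ+} (S : PHAut K)

/-- Smoothing along the orbits of `V`. -/
noncomputable def smoothV {ρ : ℝ → ℂ} (hρ : ContDiff ℝ ∞ ρ) (N : ℤ) : CN K N →ₗ[ℂ] CN K N :=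
  flowIntOp S.V hρ (-1) 1 N

theorem pair_smoothV {N : ℤ} {ρ ψ : ℝ → ℂ} {R : ℝ} (hρ : ContDiff ℝ ∞ ρ)
    (hρs : tsupport ρ ⊆ Set.Ioo (-1) 1) (hψ : ContDiff ℝ ∞ ψ)
    (hs : tsupport ψ ⊆ Set.Ioo (-R) R) (h : CN K N) (m : Nil K) :
    S.pair ψ m (S.smoothV hρ N h).1 = ∫ s, ρ s * S.pair ψ m (transl S.V N s h).1 := by
  have h1 : ∀ m', (S.smoothV hρ N h).1 m' = ∫ s, ρ s * h.1 (flow S.V s m') := by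
    intro m'
    refine (intervalIntegral.integral_of_le (by norm_num)).trans ?_
    rw [← integral_Icc_eq_integral_Ioc]
    refine setIntegral_eq_integral_of_forall_compl_eq_zero fun t ht => ?_
    rw [Set.mem_Icc, ← abs_le] at ht
    rw [eq_zero_of_tsupport_subset_Ioo hρs (not_le.1 ht).le, zero_mul]
  unfold pair
  simp only [h1, transl_apply, ← integral_const_mul]
  have hcont : Continuous (Function.uncurry fun t s => ψ t * (ρ s * h.1 (flow S.V s (flow S.W t m)))) :=
    (hψ.continuous.comp continuous_fst).mul ((hρ.continuous.comp continuous_snd).mul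
      (h.2.1.contDiff_flow_flow S.W S.V m).continuous)
  have hsupp : HasCompactSupport
      (Function.uncurry fun t s => ψ t * (ρ s * h.1 (flow S.V s (flow S.W t m)))) := by
    refine HasCompactSupport.intro ((isCompact_Icc (a := -R) (b := R)).prod
      (isCompact_Icc (a := (-1 : ℝ)) (b := 1))) ?_
    rintro ⟨t, s⟩ hts
    change ψ t * (ρ s * _) = 0
    by_cases ht : |t| ≤ R
    · have hs' : ¬ |s| ≤ 1 := fun h => hts ⟨abs_le.1 ht, abs_le.1 h⟩
      rw [eq_zero_of_tsupport_subset_Ioo hρs (not_le.1 hs').le, zero_mul, mul_zero]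
    · rw [eq_zero_of_tsupport_subset_Ioo hs (not_le.1 ht).le, zero_mul]
  rw [integral_integral_swap_of_hasCompactSupport hcont hsupp]
  congr 1
  funext s
  congr 1
  funext t
  ring

variable {δ : ℝ} (N : ℤ) (q : ℕ)

theorem exists_norm_pair_smoothV_le (hδ : 0 < δ) {ρ : ℝ → ℂ} (hρ : ContDiff ℝ ∞ ρ)
    (hρs : tsupport ρ ⊆ Set.Ioo (-1) 1) : ∃ C : ℝ, 0 ≤ C ∧ ∀ {p : ℕ} (h : CN K N) (m : Nil K),
      ∀ η ∈ testFns δ q, ‖S.pair η m (S.smoothV hρ N h).1‖ ≤ C * S.aNorm δ N p q h := by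
  obtain ⟨C, hC0, hC⟩ := S.exists_norm_pair_transl_le hδ q N hδ.le
  obtain ⟨B, hB⟩ := DerivBound.exists_of_hasCompactSupport hρ
    (hasCompactSupport_of_tsupport_subset_Ioo hρs) 0
  have hB0 := hB.nonneg
  refine ⟨2 * 1 * (B * (C * 1 * (1 + ‖freq K N‖ * 1) ^ q)), by positivity, fun {p} h m η hη => ?_⟩
  rw [S.pair_smoothV hρ hρs hη.1 hη.2.2.1, mul_assoc]
  have hn := S.aNorm_nonneg δ N p q h
  refine norm_integral_le_of_eq_zero zero_le_one (fun s => ?_) fun s hs => by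
    rw [eq_zero_of_tsupport_subset_Ioo hρs hs.le, zero_mul]
  by_cases hs : |s| ≤ 1
  · rw [norm_mul, mul_assoc]
    refine mul_le_mul (hB.norm_le s) ?_ (norm_nonneg _) hB0
    refine (hC hη.1 hη.2.2.1 (DerivBound_of_mem_testFns hη) (p := p) s h m).trans ?_
    gcongr
  · rw [eq_zero_of_tsupport_subset_Ioo hρs (not_le.1 hs).le, zero_mul, norm_zero]
    positivity

theorem lieOp_smoothV {ρ : ℝ → ℂ} (hρ : ContDiff ℝ ∞ ρ) (hρs : tsupport ρ ⊆ Set.Ioo (-1) 1)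
    (h : CN K N) :
    lieOp S.V N (S.smoothV hρ N h) = -S.smoothV (contDiff_deriv_infty hρ) N h := by
  ext m
  unfold smoothV
  rw [lieOp_flowIntOp_self, flowIntOp_lieOp_self S.V hρ (contDiff_deriv_infty hρ)
    (fun t => (hρ.differentiable (by simp) t).hasDerivAt),
    eq_zero_of_tsupport_subset_Ioo hρs (t := 1) (by simp),
    eq_zero_of_tsupport_subset_Ioo hρs (t := -1) (by simp)]
  simp

/-- All j derivatives fall on ρ, each with a sign. No V-derivative of h is used, so smoothing maps
B^{p,q} to B^{p',q} for every p'. -/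
theorem exists_norm_pair_lieOp_pow_smoothV_le (hδ : 0 < δ) (j : ℕ) : ∀ {ρ : ℝ → ℂ} (hρ : ContDiff ℝ ∞ ρ)
    (_ : tsupport ρ ⊆ Set.Ioo (-1) 1), ∃ C : ℝ, 0 ≤ C ∧ ∀ {p : ℕ} (h : CN K N) (m : Nil K),
      ∀ η ∈ testFns δ q,
        ‖S.ell δ η m ((lieOp S.V N)^[j] (S.smoothV hρ N h) : CN K N).1‖ ≤
          C * S.aNorm δ N p q h := by
  induction j with
  | zero =>
    intro ρ hρ hρs
    obtain ⟨C, hC0, hC⟩ := S.exists_norm_pair_smoothV_le N q hδ hρ hρs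
    refine ⟨C, hC0, fun h m η hη => ?_⟩
    rw [S.ell_eq_pair_of_tsupport hη.2.2.1]
    exact hC h m η hη
  | succ j ih =>
    intro ρ hρ hρs
    obtain ⟨C, hC0, hC⟩ := ih (contDiff_deriv_infty hρ) (tsupport_deriv_subset_Ioo hρs)
    refine ⟨C, hC0, fun h m η hη => ?_⟩
    have h1 : (lieOp S.V N)^[j + 1] (S.smoothV hρ N h) =
        (-1 : ℂ) • (lieOp S.V N)^[j] (S.smoothV (contDiff_deriv_infty hρ) N h) := by
      rw [Function.iterate_succ_apply, S.lieOp_smoothV N hρ hρs, ← Module.End.pow_apply, map_neg,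
        Module.End.pow_apply]
      exact (neg_one_smul ℂ _).symm
    rw [h1, ell_smul, norm_mul, norm_neg, norm_one, one_mul]
    exact hC h m η hη

theorem exists_aNorm_smoothV_le (hδ : 0 < δ) {ρ : ℝ → ℂ} (hρ : ContDiff ℝ ∞ ρ)
    (hρs : tsupport ρ ⊆ Set.Ioo (-1) 1) (p p' : ℕ) :
    ∃ C : ℝ, ∀ h : CN K N, S.aNorm δ N p' q (S.smoothV hρ N h) ≤ C * S.aNorm δ N p q h := by
  choose C hC0 hC using fun j => S.exists_norm_pair_lieOp_pow_smoothV_le N q hδ j hρ hρs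
  have h0 : 0 ≤ ∑ j ∈ Finset.range (p' + 1), C j := Finset.sum_nonneg fun j _ => hC0 j
  refine ⟨∑ j ∈ Finset.range (p' + 1), C j, fun h => ?_⟩
  have hn := S.aNorm_nonneg δ N p q h
  refine S.aNorm_le δ N p' q _ (by positivity) fun j hj m η hη => ?_
  refine (hC j (p := p) h m η hη).trans ?_
  gcongr
  exact Finset.single_le_sum (f := C) (fun i _ => hC0 i) (Finset.mem_range.2 (by omega))

/-- As ρ has integral one, the difference is a ρ-average of translate minus identity over |s| ≤ 1.
Smoothing thus acts as the identity on ker V. -/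
theorem exists_aNorm_smoothV_sub_le (hδ : 0 < δ) {ρ : ℝ → ℂ} (hρ : ContDiff ℝ ∞ ρ)
    (hρs : tsupport ρ ⊆ Set.Ioo (-1) 1) (hρ1 : ∫ s, ρ s = 1) :
    ∃ C : ℝ, ∀ (p : ℕ) (h : CN K N),
      S.aNorm δ N 0 q (S.smoothV hρ N h - h) ≤ C * S.aNorm δ N p q (lieOp S.V N h) := by
  obtain ⟨C, hC0, hC⟩ := S.exists_norm_pair_transl_sub_le hδ q N hδ.le
  have hρc := hasCompactSupport_of_tsupport_subset_Ioo hρs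
  obtain ⟨B, hB⟩ := DerivBound.exists_of_hasCompactSupport hρ hρc 0
  have hB0 := hB.nonneg
  refine ⟨2 * 1 * (B * (C * 1 * (1 + ‖freq K N‖ * 1) ^ q)), fun p h => ?_⟩
  have hn := S.aNorm_nonneg δ N p q (lieOp S.V N h)
  refine S.aNorm_le δ N 0 q _ (by positivity) fun j hj m η hη => ?_
  obtain rfl : j = 0 := by omega
  have h1 : S.ell δ η m (S.smoothV hρ N h - h : CN K N).1 =
      ∫ s, ρ s * (S.pair η m (transl S.V N s h).1 - S.pair η m h.1) := by
    rw [sub_eq_add_neg, S.ell_add N hη, ← neg_one_smul ℂ h, S.ell_smul, neg_one_mul,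
      ← sub_eq_add_neg, S.ell_eq_pair_of_tsupport hη.2.2.1, S.ell_eq_pair_of_tsupport hη.2.2.1,
      S.pair_smoothV hρ hρs hη.1 hη.2.2.1]
    simp only [mul_sub]
    rw [integral_sub, integral_mul_const, hρ1, one_mul]
    · have hc : Continuous fun s => S.pair η m (transl S.V N s h).1 :=
        continuous_iff_continuousAt.2 fun s =>
          (S.hasDerivAt_pair_transl hη.1 hη.2.2.1 h m s).continuousAt
      exact (hρ.continuous.mul hc).integrable_of_hasCompactSupport hρc.mul_right
    · exact (hρ.continuous.mul continuous_const).integrable_of_hasCompactSupport hρc.mul_right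
  rw [Function.iterate_zero_apply, h1, mul_assoc]
  refine norm_integral_le_of_eq_zero zero_le_one (fun s => ?_) fun s hs => by
    rw [eq_zero_of_tsupport_subset_Ioo hρs hs.le, zero_mul]
  by_cases hs : |s| ≤ 1
  · rw [norm_mul, mul_assoc]
    refine mul_le_mul (hB.norm_le s) ?_ (norm_nonneg _) hB0
    refine (hC hη.1 hη.2.2.1 (DerivBound_of_mem_testFns hη) (p := p) s h m).trans ?_
    have h2 : ‖freq K N‖ * |s| ≤ ‖freq K N‖ * 1 := by gcongr
    have h3 : 0 ≤ C * 1 * (1 + ‖freq K N‖ * 1) ^ q * S.aNorm δ N p q (lieOp S.V N h) := by positivity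
    calc C * 1 * (1 + ‖freq K N‖ * |s|) ^ q * S.aNorm δ N p q (lieOp S.V N h) * |s|
        ≤ C * 1 * (1 + ‖freq K N‖ * 1) ^ q * S.aNorm δ N p q (lieOp S.V N h) * 1 := by gcongr
      _ = _ := mul_one _
  · rw [eq_zero_of_tsupport_subset_Ioo hρs (not_le.1 hs).le, zero_mul, norm_zero]
    positivity

variable {N q}

/-- Elements of the kernel of `V` are infinitely regular in the direction of `V`. -/
theorem exists_mem_kerV_lift (hδ : 0 < δ) {p p' : ℕ} (hp : 1 ≤ p) (hp' : 1 ≤ p') {x : S.B δ N p q}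
    (hx : x ∈ S.kerV δ N q hp) : ∃ y ∈ S.kerV δ N q hp',
      S.VPow N δ q 0 (Nat.zero_le p') y = S.VPow N δ q 0 (Nat.zero_le p) x := by
  obtain ⟨ρ, hρ, -, hρs, hρ1⟩ := exists_smooth_bump one_pos
  let T := S.extOp (S.smoothV hρ N) (S.exists_aNorm_smoothV_le N q hδ hρ hρs p p')
  have hT : ∀ h, T (S.emb δ N p q h) = S.emb δ N p' q (S.smoothV hρ N h) := S.extOp_emb _ _
  -- The same smoothing one order lower; V T = T1 V shows that T preserves the kernels.
  let T1 := S.extOp (S.smoothV hρ N) (S.exists_aNorm_smoothV_le N q hδ hρ hρs (p - 1) (p' - 1))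
  have hT1 : ∀ h, T1 (S.emb δ N (p - 1) q h) = S.emb δ N (p' - 1) q (S.smoothV hρ N h) :=
    S.extOp_emb _ _
  refine ⟨T x, ?_, ?_⟩
  · rw [mem_kerV] at hx ⊢
    have h1 := S.ext_emb (f := fun x => S.VOp δ N q hp' (T x)) (g := fun x => T1 (S.VOp δ N q hp x))
      (by fun_prop) (by fun_prop) (fun h => by
        rw [hT, VOp_emb, VOp_emb, hT1]
        exact congrArg _ (lieOp_flowIntOp_self S.V hρ (-1) 1 h)) x
    beta_reduce at h1
    rw [h1, hx, map_zero]
  · obtain ⟨C, hC⟩ := S.exists_aNorm_smoothV_sub_le N q hδ hρ hρs hρ1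
    have h1 := S.le_of_mem_kerV (f := fun x => ‖S.VPow N δ q 0 (Nat.zero_le p') (T x) -
      S.VPow N δ q 0 (Nat.zero_le p) x‖) (g := fun _ => 0) (by fun_prop) continuous_const (C := C)
      (fun h => by
        rw [hT, VPow_emb, VPow_emb, ← emb_sub, norm_emb, zero_add]
        exact hC (p - 1) h) hx
    exact sub_eq_zero.1 (norm_le_zero_iff.1 h1)

/-- By `norm_le_max` the natural map to B^{0,q} is injective on ker V; this is how kernels for
different p are compared. -/
theorem eq_of_VPow_zero_eq {p : ℕ} {hp : 1 ≤ p} {x y : S.B δ N p q} (hx : x ∈ S.kerV δ N q hp)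
    (hy : y ∈ S.kerV δ N q hp)
    (h : S.VPow N δ q 0 (Nat.zero_le p) x = S.VPow N δ q 0 (Nat.zero_le p) y) : x = y := by
  have h1 := S.norm_le_max hp (x - y)
  rw [map_sub, h, sub_self, (S.mem_kerV N hp _).1 (Submodule.sub_mem _ hx hy), norm_zero,
    norm_zero, max_self] at h1
  exact sub_eq_zero.1 (norm_le_zero_iff.1 h1)

/-- Eigenvectors in the kernel of `V` can be moved between the spaces `B^{p,q}`. -/
theorem exists_eigen_kerV_lift (hδ : 0 < δ) {p p' : ℕ} (hp : 1 ≤ p) (hp' : 1 ≤ p') {x : S.B δ N p q}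
    (hx : x ∈ S.kerV δ N q hp) (hx0 : x ≠ 0) {z : ℂ} (hz : S.koop hδ N p q x = z • x) :
    ∃ y ∈ S.kerV δ N q hp', y ≠ 0 ∧ S.koop hδ N p' q y = z • y := by
  obtain ⟨y, hy, hyx⟩ := S.exists_mem_kerV_lift hδ hp hp' hx
  have hcomm : ∀ (r : ℕ) (w : S.B δ N r q), S.VPow N δ q 0 (Nat.zero_le r) (S.koop hδ N r q w) =
      S.koop hδ N 0 q (S.VPow N δ q 0 (Nat.zero_le r) w) := by
    intro r w
    rw [VPow_koop, pow_zero, one_smul]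
  refine ⟨y, hy, ?_, ?_⟩
  · rintro rfl
    rw [map_zero] at hyx
    exact hx0 (S.eq_of_VPow_zero_eq hx (Submodule.zero_mem _) (by rw [map_zero, hyx]))
  · refine S.eq_of_VPow_zero_eq (S.koop_mem_kerV hδ hp' y hy) (Submodule.smul_mem _ z hy) ?_
    rw [hcomm, hyx, ← hcomm, hz, map_smul, map_smul, hyx]

end PHAut

/-! ### Fourier transforms of test functions -/

section FourierBounds

open MeasureTheory FourierTransform

variable {η : ℝ → ℂ}

theorem continuous_fourier_of_contDiff (hη : ContDiff ℝ ∞ η) (hc : HasCompactSupport η) :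
    Continuous (𝓕 η) := by
  have h := (𝓕 (hc.toSchwartzMap hη)).continuous
  rwa [SchwartzMap.fourier_coe] at h

theorem integrable_pow_mul_fourier (hη : ContDiff ℝ ∞ η) (hc : HasCompactSupport η) (k : ℕ) :
    Integrable fun ξ : ℝ => |ξ| ^ k * ‖𝓕 η ξ‖ := by
  have h := (𝓕 (hc.toSchwartzMap hη)).integrable_pow_mul volume k
  rwa [SchwartzMap.fourier_coe] at h

theorem integrable_norm_fourier (hη : ContDiff ℝ ∞ η) (hc : HasCompactSupport η) :
    Integrable fun ξ : ℝ => ‖𝓕 η ξ‖ := by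
  simpa using integrable_pow_mul_fourier hη hc 0

theorem integrable_fourier (hη : ContDiff ℝ ∞ η) (hc : HasCompactSupport η) :
    Integrable (𝓕 η) :=
  (integrable_norm_iff (continuous_fourier_of_contDiff hη hc).aestronglyMeasurable).1
    (integrable_norm_fourier hη hc)

theorem fourier_inversion (hη : ContDiff ℝ ∞ η) (hc : HasCompactSupport η) (t : ℝ) :
    η t = ∫ ξ, 𝓕 η ξ * Complex.exp (2 * Real.pi * Complex.I * (ξ * t)) := by
  have h := hη.continuous.fourierInv_fourier_eq
    (hη.continuous.integrable_of_hasCompactSupport hc) (integrable_fourier hη hc)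
  conv_lhs => rw [← h]
  rw [Real.fourierInv_eq']
  congr 1
  funext ξ
  rw [smul_eq_mul, mul_comm]
  congr 2
  simp only [RCLike.inner_apply, conj_trivial]
  push_cast
  ring

theorem norm_fourier_le (η : ℝ → ℂ) (ξ : ℝ) : ‖𝓕 η ξ‖ ≤ ∫ t, ‖η t‖ :=
  VectorFourier.norm_fourierIntegral_le_integral_norm _ _ _ _ _

theorem fourier_comp_mul (η : ℝ → ℂ) {a : ℝ} (ha : 0 < a) (ξ : ℝ) :
    𝓕 (fun t => η (a * t)) ξ = (a⁻¹ : ℝ) • 𝓕 η (a⁻¹ * ξ) := by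
  rw [Real.fourier_real_eq, Real.fourier_real_eq]
  have h := Measure.integral_comp_mul_left
    (fun v : ℝ => Real.fourierChar (-(v * (a⁻¹ * ξ))) • η v) a
  rw [abs_of_pos (inv_pos.2 ha)] at h
  rw [← h]
  congr 1
  funext t
  congr 3
  field_simp

theorem integral_norm_fourier_comp_mul (η : ℝ → ℂ) {a : ℝ} (ha : 0 < a) :
    ∫ ξ, ‖𝓕 (fun t => η (a * t)) ξ‖ = ∫ ξ, ‖𝓕 η ξ‖ := by
  simp only [fourier_comp_mul η ha, norm_smul, Real.norm_of_nonneg (inv_pos.2 ha).le]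
  rw [integral_const_mul, Measure.integral_comp_mul_left (fun ξ => ‖𝓕 η ξ‖), inv_inv, abs_of_pos ha,
    smul_eq_mul, inv_mul_cancel_left₀ ha.ne']

theorem integral_norm_sq_fourier_le {A R : ℝ} (hη : ContDiff ℝ ∞ η)
    (hs : tsupport η ⊆ Set.Ioo (-R) R) (hR : 0 ≤ R) (hA : ∀ t, ‖η t‖ ≤ A) :
    ∫ ξ, ‖𝓕 η ξ‖ ^ 2 ≤ 2 * R * A ^ 2 := by
  have h := SchwartzMap.integral_norm_sq_fourier
    ((hasCompactSupport_of_tsupport_subset_Ioo hs).toSchwartzMap hη)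
  rw [SchwartzMap.fourier_coe] at h
  refine h.le.trans ?_
  have h1 := norm_integral_le_of_eq_zero (f := fun t => ((‖η t‖ ^ 2 : ℝ) : ℂ)) (C := A ^ 2) hR
    (fun t => by
      rw [Complex.norm_of_nonneg (by positivity)]
      exact pow_le_pow_left₀ (norm_nonneg _) (hA t) 2)
    (fun t ht => by rw [eq_zero_of_tsupport_subset_Ioo hs ht.le]; simp)
  rw [integral_complex_ofReal, Complex.norm_real] at h1
  exact (le_abs_self _).trans h1

/-- The Fourier transforms of functions bounded in `C^1` with supports in a fixed interval are
bounded in `L^1`. -/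
theorem exists_integral_norm_fourier_le {R : ℝ} (hR : 0 ≤ R) : ∃ C : ℝ, 0 ≤ C ∧ ∀ η : ℝ → ℂ,
    ContDiff ℝ ∞ η → tsupport η ⊆ Set.Ioo (-R) R → DerivBound 1 1 η → ∫ ξ, ‖𝓕 η ξ‖ ≤ C := by
  refine ⟨(∫ ξ : ℝ, (1 + ξ ^ 2)⁻¹) + (2 * R * 1 ^ 2 + 2 * R * 1 ^ 2), ?_, fun η hη hs hB => ?_⟩
  · refine add_nonneg (integral_nonneg fun ξ => by positivity) (by positivity)
  have hc := hasCompactSupport_of_tsupport_subset_Ioo hs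
  have h1 := integral_norm_sq_fourier_le hη hs hR hB.norm_le
  have hη' := PHAut.contDiff_deriv_infty hη
  have hs' := PHAut.tsupport_deriv_subset_Ioo hs
  have h2 := integral_norm_sq_fourier_le hη' hs' hR
    (fun t => by simpa [iteratedDeriv_one] using hB 1 le_rfl t)
  have hint : ∀ {f : ℝ → ℂ}, ContDiff ℝ ∞ f → HasCompactSupport f →
      Integrable fun ξ => ‖𝓕 f ξ‖ ^ 2 := by
    intro f hf hfc
    refine ((integrable_norm_fourier hf hfc).bdd_mul (f := fun ξ => ‖𝓕 f ξ‖)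
      (c := ∫ t, ‖f t‖) (continuous_fourier_of_contDiff hf hfc).norm.aestronglyMeasurable
      (Filter.Eventually.of_forall fun ξ => ?_)).congr
      (Filter.Eventually.of_forall fun ξ => (sq _).symm)
    rw [norm_norm]
    exact norm_fourier_le f ξ
  have hd := Real.fourier_deriv (hη.continuous.integrable_of_hasCompactSupport hc)
    (hη.differentiable (by simp)) (hη'.continuous.integrable_of_hasCompactSupport hc.deriv)
  -- With w = 1 + ξ², the inequality x ≤ 1/w + w x² reduces the L¹ bound to Plancherel for η and η'.
  have hpt : ∀ ξ : ℝ, ‖𝓕 η ξ‖ ≤ (1 + ξ ^ 2)⁻¹ + (‖𝓕 η ξ‖ ^ 2 + ‖𝓕 (deriv η) ξ‖ ^ 2) := by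
    intro ξ
    have h3 : ‖𝓕 (deriv η) ξ‖ = 2 * Real.pi * |ξ| * ‖𝓕 η ξ‖ := by
      rw [hd, norm_smul]
      simp [abs_of_pos Real.pi_pos]
    rw [h3]
    set x := ‖𝓕 η ξ‖
    have hx : 0 ≤ x := norm_nonneg _
    have hp : (1 : ℝ) ≤ 2 * Real.pi := by linarith [Real.pi_gt_three]
    have h4 : x ^ 2 + (2 * Real.pi * |ξ| * x) ^ 2 ≥ (1 + ξ ^ 2) * x ^ 2 := by
      have h5 : (2 * Real.pi * |ξ| * x) ^ 2 = (2 * Real.pi) ^ 2 * (ξ ^ 2 * x ^ 2) := by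
        rw [← sq_abs ξ]; ring
      have h6 : (1 : ℝ) ≤ (2 * Real.pi) ^ 2 := one_le_pow₀ hp
      rw [h5]
      nlinarith [mul_nonneg (sq_nonneg ξ) (sq_nonneg x)]
    have h7 : 0 < 1 + ξ ^ 2 := by positivity
    have h8 : x ≤ (1 + ξ ^ 2)⁻¹ + (1 + ξ ^ 2) * x ^ 2 := by
      rw [← sub_nonneg]
      have h9 : (1 + ξ ^ 2)⁻¹ + (1 + ξ ^ 2) * x ^ 2 - x =
          (1 + ξ ^ 2)⁻¹ * ((1 - (1 + ξ ^ 2) * x) ^ 2 + (1 + ξ ^ 2) * x) := by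
        field_simp
        ring
      rw [h9]
      positivity
    linarith
  have hi1 := hint hη hc
  have hi2 := hint hη' hc.deriv
  calc ∫ ξ, ‖𝓕 η ξ‖ ≤ ∫ ξ : ℝ, ((1 + ξ ^ 2)⁻¹ + (‖𝓕 η ξ‖ ^ 2 + ‖𝓕 (deriv η) ξ‖ ^ 2)) :=
        integral_mono (integrable_norm_fourier hη hc)
          (integrable_inv_one_add_sq.add (hi1.add hi2)) hpt
    _ = (∫ ξ : ℝ, (1 + ξ ^ 2)⁻¹) + ((∫ ξ, ‖𝓕 η ξ‖ ^ 2) + ∫ ξ, ‖𝓕 (deriv η) ξ‖ ^ 2) := by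
        rw [← integral_add hi1 hi2]
        exact integral_add integrable_inv_one_add_sq (hi1.add hi2)
    _ ≤ _ := by gcongr

end FourierBounds

/-! ### Pairings as superpositions of translates -/

namespace PHAut

open Nil MeasureTheory FourierTransform

variable {K : ℕ+} (S : PHAut K)

/-- As NK ≠ 0, every Fourier mode on a W-orbit is the character of some translation along V. -/
theorem exp_eq_twist {N : ℤ} (hN : N ≠ 0) (ξ t : ℝ) :
    Complex.exp (2 * Real.pi * Complex.I * (ξ * t)) = twist K N (-(ξ / (N * (K : ℕ)))) t := by
  unfold twist freq
  congr 1
  have h1 : ((K : ℕ) : ℂ) ≠ 0 := by exact_mod_cast K.ne_zero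
  have h2 : (N : ℂ) ≠ 0 := by exact_mod_cast hN
  push_cast
  field_simp

theorem pair_twist {N : ℤ} (χ : ℝ → ℂ) (s : ℝ) (h : CN K N) (m : Nil K) :
    S.pair (fun t => χ t * twist K N (-s) t) m h.1 =
      S.pair χ (flow S.V s m) (transl S.V N (-s) h).1 := by
  rw [pair_transl, ← flow_add, add_neg_cancel, flow_zero]

/-- The superposition of translates of `f` along `V` with weight `𝓕 η`. -/
noncomputable def superpos (N : ℤ) (η : ℝ → ℂ) (f : Nil K → ℂ) (m : Nil K) : ℂ :=
  ∫ ξ, 𝓕 η ξ * f (flow S.V (ξ / (N * (K : ℕ))) m)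

/-- Fourier inversion of η followed by Fubini. The cutoff χ, harmless since η = χη, turns each mode
into a compactly supported test function, and `pair_twist` trades the mode for a translation. -/
theorem pair_eq_integral_fourier {N : ℤ} (hN : N ≠ 0) {η χ : ℝ → ℂ} (hη : ContDiff ℝ ∞ η)
    (hc : HasCompactSupport η) (hχ : ContDiff ℝ ∞ χ) (hχc : HasCompactSupport χ)
    (hχη : ∀ t, η t = χ t * η t) (h : CN K N) (m : Nil K) :
    Integrable (fun ξ => 𝓕 η ξ * S.pair χ (flow S.V (ξ / (N * (K : ℕ))) m)
      (transl S.V N (-(ξ / (N * (K : ℕ)))) h).1) ∧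
    S.pair η m h.1 = ∫ ξ, 𝓕 η ξ * S.pair χ (flow S.V (ξ / (N * (K : ℕ))) m)
      (transl S.V N (-(ξ / (N * (K : ℕ)))) h).1 := by
  have hg : Continuous fun t => χ t * h.1 (flow S.W t m) :=
    hχ.continuous.mul (h.2.1.comp_flow S.W m).continuous
  have hgi : Integrable fun t => χ t * h.1 (flow S.W t m) :=
    hg.integrable_of_hasCompactSupport hχc.mul_right
  have htw : Continuous fun y : ℝ × ℝ => twist K N (-(y.2 / (N * (K : ℕ)))) y.1 :=
    (continuous_twist N).comp (by fun_prop : Continuous fun y : ℝ × ℝ =>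
      (-(y.2 / (N * (K : ℕ))), y.1))
  have hF := continuous_fourier_of_contDiff hη hc
  have hint : Integrable (Function.uncurry fun t ξ => 𝓕 η ξ *
      (χ t * h.1 (flow S.W t m) * twist K N (-(ξ / (N * (K : ℕ)))) t)) (volume.prod volume) := by
    refine ((hgi.mul_prod (integrable_fourier hη hc))).mono ?_ ?_
    · refine Continuous.aestronglyMeasurable ?_
      exact (hF.comp continuous_snd).mul ((hg.comp continuous_fst).mul htw)
    · refine Filter.Eventually.of_forall fun y => ?_
      change ‖𝓕 η y.2 * (χ y.1 * h.1 (flow S.W y.1 m) * twist K N (-(y.2 / (N * (K : ℕ)))) y.1)‖ ≤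
        ‖χ y.1 * h.1 (flow S.W y.1 m) * 𝓕 η y.2‖
      rw [norm_mul, norm_mul (χ y.1 * h.1 (flow S.W y.1 m)), norm_twist, mul_one, norm_mul _ (𝓕 η y.2),
        mul_comm]
  have h1 : ∀ t, η t * h.1 (flow S.W t m) = ∫ ξ, 𝓕 η ξ *
      (χ t * h.1 (flow S.W t m) * twist K N (-(ξ / (N * (K : ℕ)))) t) := by
    intro t
    have h2 : η t = ∫ ξ, 𝓕 η ξ * twist K N (-(ξ / (N * (K : ℕ)))) t := by
      simp only [← exp_eq_twist hN]
      exact fourier_inversion hη hc t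
    rw [hχη t, mul_right_comm]
    conv_lhs => rw [h2]
    rw [← integral_const_mul]
    congr 1
    funext ξ
    ring
  have h4 : ∀ ξ, ∫ t, 𝓕 η ξ * (χ t * h.1 (flow S.W t m) * twist K N (-(ξ / (N * (K : ℕ)))) t) =
      𝓕 η ξ * S.pair χ (flow S.V (ξ / (N * (K : ℕ))) m)
        (transl S.V N (-(ξ / (N * (K : ℕ)))) h).1 := by
    intro ξ
    rw [integral_const_mul, ← pair_twist]
    congr 1
    unfold pair
    congr 1
    funext t
    ring
  simp only [← h4]
  refine ⟨hint.integral_prod_right, ?_⟩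
  unfold pair
  simp only [h1]
  exact integral_integral_swap hint

/-- Up to errors controlled by `Vh`, the pairings with arbitrary test functions are superpositions
of translates of the pairing with a single test function. -/
theorem exists_norm_pair_sub_superpos_le {δ : ℝ} (hδ : 0 < δ) (q : ℕ) {N : ℤ} (hN : N ≠ 0) {R : ℝ}
    (hR : 0 ≤ R) {η χ : ℝ → ℂ} (hη : ContDiff ℝ ∞ η)
    (hc : HasCompactSupport η) (hχ : ContDiff ℝ ∞ χ) (hχs : tsupport χ ⊆ Set.Ioo (-R) R)
    (hχη : ∀ t, η t = χ t * η t) : ∃ C : ℝ, 0 ≤ C ∧ ∀ {p : ℕ} (h : CN K N) (m : Nil K),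
      ‖S.pair η m h.1 - S.superpos N η (S.smoothW hχ R N h).1 m‖ ≤
        C * S.aNorm δ N p q (lieOp S.V N h) := by
  have hχc := hasCompactSupport_of_tsupport_subset_Ioo hχs
  obtain ⟨C, hC0, hC⟩ := S.exists_norm_pair_transl_sub_le hδ q N hR
  obtain ⟨B, hB⟩ := DerivBound.exists_of_hasCompactSupport hχ hχc q
  have hB0 := hB.nonneg
  set b : ℝ := |(N * (K : ℕ) : ℝ)|⁻¹ with hb
  have hb0 : 0 ≤ b := by positivity
  have habs : ∀ ξ : ℝ, |-(ξ / (N * (K : ℕ)))| = b * |ξ| := by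
    intro ξ
    rw [abs_neg, abs_div, hb, div_eq_inv_mul]
  set a : ℝ := ‖freq K N‖ * b with ha
  have ha0 : 0 ≤ a := by positivity
  -- This weight comes from (1 + a|ξ|)^q ≤ 2^(q-1)(1 + (a|ξ|)^q) and the factor |ξ| of the
  -- translation estimate; it is integrable by rapid decay of 𝓕 η.
  set w : ℝ → ℝ := fun ξ => 2 ^ (q - 1) * b * (|ξ| ^ 1 * ‖𝓕 η ξ‖ + a ^ q * (|ξ| ^ (q + 1) * ‖𝓕 η ξ‖))
    with hw
  have hwi : Integrable w := ((integrable_pow_mul_fourier hη hc 1).add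
    ((integrable_pow_mul_fourier hη hc (q + 1)).const_mul _)).const_mul _
  have hw0 : ∀ ξ, 0 ≤ w ξ := fun ξ => by rw [hw]; positivity
  refine ⟨C * B * ∫ ξ, w ξ, mul_nonneg (by positivity) (integral_nonneg hw0), fun {p} h m => ?_⟩
  have hn := S.aNorm_nonneg δ N p q (lieOp S.V N h)
  set f := S.smoothW hχ R N h with hf
  obtain ⟨A, hA⟩ := f.2.1.bounded
  have hF := continuous_fourier_of_contDiff hη hc
  have hi2 : Integrable fun ξ => 𝓕 η ξ * f.1 (flow S.V (ξ / (N * (K : ℕ))) m) := by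
    refine ((integrable_fourier hη hc).bdd_mul (c := A)
      (f := fun ξ : ℝ => f.1 (flow S.V (ξ / (N * (K : ℕ))) m)) ?_
      (Filter.Eventually.of_forall fun ξ => hA _)).congr
      (Filter.Eventually.of_forall fun ξ => mul_comm _ _)
    exact ((f.2.1.comp_flow S.V m).continuous.comp (by fun_prop)).aestronglyMeasurable
  have hdiff : ∀ ξ : ℝ, ‖𝓕 η ξ * S.pair χ (flow S.V (ξ / (N * (K : ℕ))) m)
      (transl S.V N (-(ξ / (N * (K : ℕ)))) h).1 -
      𝓕 η ξ * f.1 (flow S.V (ξ / (N * (K : ℕ))) m)‖ ≤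
      C * B * S.aNorm δ N p q (lieOp S.V N h) * w ξ := by
    intro ξ
    rw [← mul_sub, norm_mul, hf, S.smoothW_apply hχ hχs]
    have h1 := hC hχ hχs hB (p := p) (-(ξ / (N * (K : ℕ)))) h (flow S.V (ξ / (N * (K : ℕ))) m)
    rw [habs, ← mul_assoc ‖freq K N‖, ← ha] at h1
    have h2 : (1 + a * |ξ|) ^ q ≤ 2 ^ (q - 1) * (1 ^ q + (a * |ξ|) ^ q) :=
      add_pow_le zero_le_one (by positivity) q
    calc _ ≤ ‖𝓕 η ξ‖ * (C * B * (2 ^ (q - 1) * (1 ^ q + (a * |ξ|) ^ q)) *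
          S.aNorm δ N p q (lieOp S.V N h) * (b * |ξ|)) := by
          refine mul_le_mul_of_nonneg_left (h1.trans ?_) (norm_nonneg _)
          gcongr
      _ = C * B * S.aNorm δ N p q (lieOp S.V N h) * w ξ := by
          rw [hw, one_pow, mul_pow]
          ring
  obtain ⟨hi1, heq⟩ := S.pair_eq_integral_fourier hN hη hc hχ hχc hχη h m
  rw [heq]
  unfold superpos
  rw [← integral_sub hi1 hi2]
  refine (norm_integral_le_of_norm_le (hwi.const_mul _)
    (Filter.Eventually.of_forall hdiff)).trans (le_of_eq ?_)
  rw [integral_const_mul]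
  ring

end PHAut

/-! ### Mean squares of almost orthogonal superpositions -/

section Swap

open MeasureTheory

theorem integrable_mul_bounded_prod {G : ℝ → ℂ} (hG : Integrable G)
    {φ : ℝ → ℝ → ℂ} (hφ : Continuous (Function.uncurry φ)) {D : ℝ} (hD : ∀ t ξ, ‖φ t ξ‖ ≤ D)
    (s : Set ℝ) (hs : volume s ≠ ⊤) :
    Integrable (Function.uncurry fun t ξ => G ξ * φ t ξ) ((volume.restrict s).prod volume) := by
  have : IsFiniteMeasure (volume.restrict s) := ⟨by simpa using hs.lt_top⟩
  have h1 : Integrable (fun z : ℝ × ℝ => (1 : ℂ) * G z.2) ((volume.restrict s).prod volume) :=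
    (integrable_const (1 : ℂ)).mul_prod hG
  simp only [one_mul] at h1
  refine (h1.bdd_mul (f := Function.uncurry φ) hφ.aestronglyMeasurable
    (Filter.Eventually.of_forall fun z => hD z.1 z.2)).congr
    (Filter.Eventually.of_forall fun z => mul_comm _ _)

theorem interval_integral_mul_swap {G : ℝ → ℂ} (hG : Integrable G)
    {φ : ℝ → ℝ → ℂ} (hφ : Continuous (Function.uncurry φ)) {D : ℝ} (hD : ∀ t ξ, ‖φ t ξ‖ ≤ D)
    (a b : ℝ) : ∫ t in a..b, ∫ ξ, G ξ * φ t ξ = ∫ ξ, G ξ * ∫ t in a..b, φ t ξ := by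
  rw [intervalIntegral_integral_swap
    (integrable_mul_bounded_prod hG hφ hD _ (by rw [Set.uIoc]; simp))]
  simp only [intervalIntegral.integral_const_mul]

theorem continuous_integral_mul {G : ℝ → ℂ} (hG : Integrable G)
    {φ : ℝ → ℝ → ℂ} (hφ : Continuous (Function.uncurry φ)) {D : ℝ} (hD : ∀ t ξ, ‖φ t ξ‖ ≤ D) :
    Continuous fun t => ∫ ξ, G ξ * φ t ξ := by
  refine continuous_of_dominated (bound := fun ξ => ‖G ξ‖ * D) (fun t => ?_) (fun t => ?_)
    (hG.norm.mul_const D) ?_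
  · exact hG.aestronglyMeasurable.mul
      (hφ.comp (continuous_const.prodMk continuous_id)).aestronglyMeasurable
  · exact Filter.Eventually.of_forall fun ξ => by
      rw [norm_mul]; exact mul_le_mul_of_nonneg_left (hD t ξ) (norm_nonneg _)
  · exact Filter.Eventually.of_forall fun ξ =>
      continuous_const.mul (hφ.comp (continuous_id.prodMk continuous_const))

/-- The `L²` norm of a superposition of almost orthogonal functions. -/
theorem integral_norm_sq_superposition_le {G : ℝ → ℂ} (hG : Integrable G)
    {φ : ℝ → ℝ → ℂ} (hφ : Continuous (Function.uncurry φ)) {D E r M : ℝ} (hD : ∀ t ξ, ‖φ t ξ‖ ≤ D)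
    (hM : ∀ ξ, ‖G ξ‖ ≤ M) (hr : 0 ≤ r) (hE : 0 ≤ E)
    (hκ : ∀ ξ ξ', r < |ξ - ξ'| → ‖∫ t in (0 : ℝ)..1, φ t ξ * starRingEnd ℂ (φ t ξ')‖ ≤ E) :
    ∫ t in (0 : ℝ)..1, ‖∫ ξ, G ξ * φ t ξ‖ ^ 2 ≤
      (∫ ξ, ‖G ξ‖) * (E * (∫ ξ, ‖G ξ‖) + D ^ 2 * M * (2 * r)) := by
  have hD0 : 0 ≤ D := (norm_nonneg _).trans (hD 0 0)
  have hM0 : 0 ≤ M := (norm_nonneg _).trans (hM 0)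
  set A := ∫ ξ, ‖G ξ‖ with hA
  have hA0 : 0 ≤ A := integral_nonneg fun ξ => norm_nonneg _
  set F : ℝ → ℂ := fun t => ∫ ξ, G ξ * φ t ξ with hF
  have hFc : Continuous F := continuous_integral_mul hG hφ hD
  have hFb : ∀ t, ‖F t‖ ≤ A * D := by
    intro t
    rw [hA, ← integral_mul_const]
    refine norm_integral_le_of_norm_le (hG.norm.mul_const D) (Filter.Eventually.of_forall fun ξ => ?_)
    rw [norm_mul]
    exact mul_le_mul_of_nonneg_left (hD t ξ) (norm_nonneg _)
  have hconj : Continuous (starRingEnd ℂ) := Complex.continuous_conj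
  -- Frequencies farther than r from ξ contribute at most E each; the remaining window of length 2r
  -- is estimated trivially.
  have hinner : ∀ ξ, ‖∫ t in (0 : ℝ)..1, φ t ξ * starRingEnd ℂ (F t)‖ ≤
      E * A + D ^ 2 * M * (2 * r) := by
    intro ξ
    have h1 : ∀ t, φ t ξ * starRingEnd ℂ (F t) =
        ∫ ξ', starRingEnd ℂ (G ξ') * (φ t ξ * starRingEnd ℂ (φ t ξ')) := by
      intro t
      rw [hF]
      simp only
      rw [← integral_conj, ← integral_const_mul]
      congr 1
      funext ξ'
      rw [map_mul]
      ring
    have hGc : Integrable fun ξ' => starRingEnd ℂ (G ξ') :=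
      (Complex.conjCLE : ℂ →L[ℝ] ℂ).integrable_comp hG
    simp only [h1]
    rw [interval_integral_mul_swap (D := D * D) hGc
      (φ := fun t ξ' => φ t ξ * starRingEnd ℂ (φ t ξ'))]
    · have hbd : Integrable fun ξ' => E * ‖G ξ'‖ +
          (Set.Icc (ξ - r) (ξ + r)).indicator (fun _ => D ^ 2 * M) ξ' :=
        (hG.norm.const_mul E).add ((integrable_indicator_iff measurableSet_Icc).2 continuous_const.integrableOn_Icc)
      refine (norm_integral_le_of_norm_le hbd (Filter.Eventually.of_forall fun ξ' => ?_)).trans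
        (le_of_eq ?_)
      · rw [norm_mul, RCLike.norm_conj]
        by_cases hξ : r < |ξ - ξ'|
        · rw [Set.indicator_of_notMem, add_zero, mul_comm]
          · exact mul_le_mul_of_nonneg_right (hκ ξ ξ' hξ) (norm_nonneg _)
          · rintro ⟨h3, h4⟩
            exact absurd (abs_le.2 ⟨by linarith, by linarith⟩) (not_le.2 hξ)
        · have h2 := abs_le.1 (not_lt.1 hξ)
          rw [Set.indicator_of_mem (show ξ' ∈ Set.Icc (ξ - r) (ξ + r) from
            ⟨by linarith, by linarith⟩)]
          have h3 : ‖∫ t in (0 : ℝ)..1, φ t ξ * starRingEnd ℂ (φ t ξ')‖ ≤ D * D * |1 - 0| := by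
            refine intervalIntegral.norm_integral_le_of_norm_le_const fun t _ => ?_
            rw [norm_mul, RCLike.norm_conj]
            exact mul_le_mul (hD _ _) (hD _ _) (norm_nonneg _) hD0
          have h4 : 0 ≤ E * ‖G ξ'‖ := by positivity
          have h5 : ‖G ξ'‖ * ‖∫ t in (0 : ℝ)..1, φ t ξ * starRingEnd ℂ (φ t ξ')‖ ≤
              M * (D * D * |1 - 0|) := mul_le_mul (hM ξ') h3 (norm_nonneg _) hM0
          rw [sub_zero, abs_one, mul_one] at h5
          nlinarith
      · rw [integral_add (hG.norm.const_mul E)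
          ((integrable_indicator_iff measurableSet_Icc).2 continuous_const.integrableOn_Icc), integral_const_mul,
          integral_indicator measurableSet_Icc, setIntegral_const, measureReal_def,
          Real.volume_Icc, ENNReal.toReal_ofReal (by linarith), smul_eq_mul]
        ring
    · exact (hφ.comp (continuous_fst.prodMk continuous_const)).mul (hconj.comp hφ)
    · intro t ξ'
      rw [norm_mul, RCLike.norm_conj]
      exact mul_le_mul (hD _ _) (hD _ _) (norm_nonneg _) hD0
  -- Only one factor of |F|² is expanded; the other enters through `hinner`.
  have hsq : ((∫ t in (0 : ℝ)..1, ‖F t‖ ^ 2 : ℝ) : ℂ) =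
      ∫ ξ, G ξ * ∫ t in (0 : ℝ)..1, φ t ξ * starRingEnd ℂ (F t) := by
    rw [← interval_integral_mul_swap (D := D * (A * D)) hG
      (φ := fun t ξ => φ t ξ * starRingEnd ℂ (F t)), ← intervalIntegral.integral_ofReal]
    · refine intervalIntegral.integral_congr fun t _ => ?_
      have h1 : ((‖F t‖ ^ 2 : ℝ) : ℂ) = F t * starRingEnd ℂ (F t) := by
        rw [Complex.mul_conj', Complex.ofReal_pow]
      refine h1.trans ?_
      conv_lhs => enter [1]; rw [hF]
      beta_reduce
      rw [← integral_mul_const]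
      congr 1
      funext ξ
      rw [mul_assoc]
    · exact hφ.mul (hconj.comp (hFc.comp continuous_fst))
    · intro t ξ
      rw [norm_mul, RCLike.norm_conj]
      exact mul_le_mul (hD _ _) (hFb _) (norm_nonneg _) hD0
  have hpos : 0 ≤ ∫ t in (0 : ℝ)..1, ‖F t‖ ^ 2 :=
    intervalIntegral.integral_nonneg zero_le_one fun t _ => by positivity
  rw [← Complex.norm_of_nonneg hpos, hsq, hA, ← integral_mul_const]
  refine norm_integral_le_of_norm_le (hG.norm.mul_const _) (Filter.Eventually.of_forall fun ξ => ?_)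
  rw [norm_mul]
  exact mul_le_mul_of_nonneg_left (hinner ξ) (norm_nonneg _)

end Swap

/-! ### Finite dimension of ker V and almost orthogonality of translates -/

namespace PHAut

open Nil MeasureTheory FourierTransform

variable {K : ℕ+} (S : PHAut K)

theorem norm_superpos_le {η : ℝ → ℂ} (hη : ContDiff ℝ ∞ η) (hc : HasCompactSupport η) {N : ℤ}
    {f : Nil K → ℂ} {D : ℝ} (hD : ∀ m, ‖f m‖ ≤ D) (m : Nil K) :
    ‖S.superpos N η f m‖ ≤ (∫ ξ, ‖𝓕 η ξ‖) * D := by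
  unfold superpos
  rw [← integral_mul_const]
  refine norm_integral_le_of_norm_le ((integrable_norm_fourier hη hc).mul_const D)
    (Filter.Eventually.of_forall fun ξ => ?_)
  rw [norm_mul]
  exact mul_le_mul_of_nonneg_left (hD _) (norm_nonneg _)

/-- The kernel of `V` is finite-dimensional. -/
theorem finiteDimensional_kerV {δ : ℝ} (hδ : 0 < δ) {N : ℤ} (hN : N ≠ 0) {p q : ℕ} (hp : 1 ≤ p)
    (hq : 1 ≤ q) : FiniteDimensional ℂ (S.kerV δ N q hp) := by
  obtain ⟨χ, hχ, -, hχs, hχ1⟩ := exists_smooth_cutoff hδ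
  obtain ⟨C1, hC10, hC1⟩ := exists_integral_norm_fourier_le hδ.le
  obtain ⟨C2, hC20, hC2⟩ := S.exists_norm_pair_le_gridPt hδ q N (by positivity) hχ hχs
  -- With this grid C1 C2 / D < 1/2, so an element of ker V annihilated by all grid functionals is
  -- zero.
  obtain ⟨D, hD⟩ := exists_nat_gt (2 * (C1 * C2))
  have hDpos : (0 : ℝ) < D := lt_of_le_of_lt (by positivity) hD
  have hD0 : 0 < D := by exact_mod_cast hDpos
  let l : S.B δ N p q →L[ℂ] (Fin D × Fin D → ℂ) :=
    ContinuousLinearMap.pi fun i => S.pairB hδ N p q hχ hχs (gridPt K D i)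
  -- On ker V every pairing is a superposition, of uniformly bounded L¹ weight, of pairings with the
  -- single cutoff χ; those are controlled on the grid.
  have key : ∀ x ∈ S.kerV δ N q hp, ‖x‖ ≤ C1 * (‖l x‖ + C2 / D * ‖x‖) := by
    intro x hx
    refine S.norm_le_of_mem_kerV hδ hx (by positivity) fun m η hη => ?_
    have hχη : ∀ t, η t = χ t * η t := by
      intro t
      by_cases ht : |t| ≤ δ
      · rw [hχ1 t ht, one_mul]
      · rw [eq_zero_of_tsupport_subset_Ioo hη.2.2.1 (not_le.1 ht).le, mul_zero]
    obtain ⟨C, -, hC⟩ := S.exists_norm_pair_sub_superpos_le hδ q hN (by positivity) hη.1 hη.2.1 hχ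
      hχs hχη
    refine S.le_of_mem_kerV (f := fun x => ‖S.pairB hδ N p q hη.1 hη.2.2.1 m x‖)
      (g := fun x => C1 * (‖l x‖ + C2 / D * ‖x‖)) (by fun_prop) (by fun_prop) (C := C)
      (fun h => ?_) hx
    rw [pairB_emb, norm_emb]
    have hn := S.aNorm_nonneg δ N p q h
    have hf : ∀ m, ‖(S.smoothW hχ (2 * δ) N h).1 m‖ ≤
        ‖l (S.emb δ N p q h)‖ + C2 / D * S.aNorm δ N p q h := by
      intro m
      rw [S.smoothW_apply hχ hχs]
      obtain ⟨i, hi⟩ := hC2 h (j := 0) (p := p) (by omega) hD0 m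
      refine hi.trans (add_le_add ?_ le_rfl)
      have h1 := norm_le_pi_norm (l (S.emb δ N p q h)) i
      have h2 : l (S.emb δ N p q h) i = S.pair χ (gridPt K D i) h.1 := S.pairB_emb hδ N p q hχ hχs _ h
      rwa [h2] at h1
    have h1 := hC (p := p - 1) h m
    have h2 := S.norm_superpos_le hη.1 hη.2.1 (N := N) hf m
    have h3 := hC1 η hη.1 hη.2.2.1
      (fun j hj t => DerivBound_of_mem_testFns hη j (hj.trans hq) t)
    have h4 : (∫ ξ, ‖𝓕 η ξ‖) * (‖l (S.emb δ N p q h)‖ + C2 / D * S.aNorm δ N p q h) ≤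
        C1 * (‖l (S.emb δ N p q h)‖ + C2 / D * S.aNorm δ N p q h) := by gcongr
    have h5 := norm_le_norm_add_norm_sub' (S.pair η m h.1)
      (S.superpos N η (S.smoothW hχ (2 * δ) N h).1 m)
    linarith
  have hinj : Function.Injective ((l : S.B δ N p q →ₗ[ℂ] (Fin D × Fin D → ℂ)) ∘ₗ
      (S.kerV δ N q hp).subtype) := by
    rw [← LinearMap.ker_eq_bot, LinearMap.ker_eq_bot']
    rintro ⟨x, hx⟩ hlx
    have hlx' : l x = 0 := hlx
    have h1 := key x hx
    rw [hlx', norm_zero, zero_add] at h1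
    have h2 : C1 * (C2 / D * ‖x‖) ≤ 1 / 2 * ‖x‖ := by
      rw [← mul_assoc]
      refine mul_le_mul_of_nonneg_right ?_ (norm_nonneg x)
      rw [← mul_div_assoc, div_le_iff₀ hDpos]
      linarith
    have h3 : ‖x‖ = 0 := by linarith [norm_nonneg x]
    exact Subtype.ext (norm_eq_zero.1 h3)
  exact FiniteDimensional.of_injective _ hinj

theorem norm_freq_mul {N : ℤ} (hN : N ≠ 0) (x : ℝ) :
    ‖freq K N‖ * |x / (N * (K : ℕ))| = 2 * Real.pi * |x| := by
  have h1 : (0 : ℝ) < (K : ℕ) := by exact_mod_cast K.pos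
  have h2 : |(N : ℝ)| ≠ 0 := abs_ne_zero.2 (by exact_mod_cast hN)
  unfold freq
  simp only [norm_mul, Complex.norm_real, Complex.norm_I, Complex.norm_intCast,
    Complex.norm_natCast, Complex.norm_ofNat, abs_div, abs_mul, Real.norm_eq_abs,
    abs_of_pos Real.pi_pos, abs_of_pos h1, mul_one]
  field_simp

/-- Almost orthogonality of different translates along `V`, on short orbits of `W`. -/
theorem norm_integral_mul_conj_le {N : ℤ} (hN : N ≠ 0) (f : CN K N) {D : ℝ} (hD : ∀ m, ‖f.1 m‖ ≤ D)
    (hDW : ∀ m, ‖(lieOp S.W N f).1 m‖ ≤ D) (m : Nil K) {r : ℝ} (hr : 0 < r) (ξ ξ' : ℝ)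
    (h : r < |ξ - ξ'|) :
    ‖∫ t in (0 : ℝ)..1, f.1 (flow S.V (ξ / (N * (K : ℕ))) (flow S.W t m)) *
      starRingEnd ℂ (f.1 (flow S.V (ξ' / (N * (K : ℕ))) (flow S.W t m)))‖ ≤ 4 * D ^ 2 / r := by
  have hD0 : 0 ≤ D := (norm_nonneg _).trans (hD m)
  set s := ξ / (N * (K : ℕ)) with hs
  set s' := ξ' / (N * (K : ℕ)) with hs'
  set m1 := flow S.V s m
  set m2 := flow S.V s' m
  set u : ℝ → ℂ := fun t => f.1 (flow S.W t m1) * starRingEnd ℂ (f.1 (flow S.W t m2)) with hu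
  set u' : ℝ → ℂ := fun t => (lieOp S.W N f).1 (flow S.W t m1) * starRingEnd ℂ (f.1 (flow S.W t m2)) +
    f.1 (flow S.W t m1) * starRingEnd ℂ ((lieOp S.W N f).1 (flow S.W t m2)) with hu'
  have hdu : ∀ t, HasDerivAt u (u' t) t := fun t =>
    (hasDerivAt_flow S.W f m1 t).mul ((hasDerivAt_flow S.W f m2 t).star)
  have hconj : Continuous (starRingEnd ℂ) := Complex.continuous_conj
  have hf : ∀ (g : CN K N) m, Continuous fun t => g.1 (flow S.W t m) :=
    fun g m => (g.2.1.comp_flow S.W m).continuous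
  have hu'c : Continuous u' :=
    ((hf _ _).mul (hconj.comp (hf _ _))).add ((hf _ _).mul (hconj.comp (hf _ _)))
  -- The two translates carry characters along the W-orbit; their product oscillates at frequency
  -- 2π|ξ - ξ'|, and integration by parts gains its inverse. The boundary and the integral cost 2D²
  -- each.
  have htw : ∀ t, f.1 (flow S.V s (flow S.W t m)) * starRingEnd ℂ (f.1 (flow S.V s' (flow S.W t m))) =
      u t * twist K N (s - s') t := by
    intro t
    have h1 : starRingEnd ℂ (twist K N s' t) = twist K N (-s') t := by
      unfold twist freq
      rw [← Complex.exp_conj]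
      congr 1
      simp only [map_mul, Complex.conj_ofReal, Complex.conj_I, map_ofNat, map_intCast, map_natCast]
      push_cast
      ring
    have h2 : twist K N s t * twist K N (-s') t = twist K N (s - s') t := by
      unfold twist
      rw [← Complex.exp_add]
      congr 1
      push_cast
      ring
    rw [S.flow_V_flow_W, S.flow_V_flow_W, map_mul, h1, ← h2, hu]
    ring
  simp only [htw]
  set y := s - s' with hy
  have hibp := intervalIntegral.integral_mul_deriv_eq_deriv_mul (a := (0 : ℝ)) (b := 1)
    (fun t _ => hdu t) (fun t _ => hasDerivAt_twist (K := K) N y t)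
    (hu'c.intervalIntegrable _ _)
    ((continuous_const.mul (contDiff_twist N y).continuous).intervalIntegrable _ _)
  have hub : ∀ t, ‖u t‖ ≤ D * D := fun t => by
    rw [hu, norm_mul, RCLike.norm_conj]
    exact mul_le_mul (hD _) (hD _) (norm_nonneg _) hD0
  have hub' : ∀ t, ‖u' t‖ ≤ D * D + D * D := fun t => by
    refine (norm_add_le _ _).trans (add_le_add ?_ ?_)
    · rw [norm_mul, RCLike.norm_conj]
      exact mul_le_mul (hDW _) (hD _) (norm_nonneg _) hD0
    · rw [norm_mul, RCLike.norm_conj]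
      exact mul_le_mul (hD _) (hDW _) (norm_nonneg _) hD0
  have h1 : ∫ t in (0 : ℝ)..1, u t * (-(freq K N * y) * twist K N y t) =
      -(freq K N * y) * ∫ t in (0 : ℝ)..1, u t * twist K N y t := by
    rw [← intervalIntegral.integral_const_mul]
    refine intervalIntegral.integral_congr fun t _ => ?_
    ring
  rw [h1] at hibp
  have h2 : ‖∫ t in (0 : ℝ)..1, u' t * twist K N y t‖ ≤ (D * D + D * D) * |1 - 0| := by
    refine intervalIntegral.norm_integral_le_of_norm_le_const fun t _ => ?_
    rw [norm_mul, norm_twist, mul_one]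
    exact hub' t
  have h3 : ‖u 1 * twist K N y 1 - u 0 * twist K N y 0‖ ≤ D * D + D * D := by
    refine (norm_sub_le _ _).trans (add_le_add ?_ ?_)
    · rw [norm_mul, norm_twist, mul_one]; exact hub 1
    · rw [norm_mul, norm_twist, mul_one]; exact hub 0
  have h4 := norm_sub_le (u 1 * twist K N y 1 - u 0 * twist K N y 0)
    (∫ t in (0 : ℝ)..1, u' t * twist K N y t)
  have hyy : ‖freq K N‖ * |y| = 2 * Real.pi * |ξ - ξ'| := by
    rw [hy, hs, hs', ← sub_div, norm_freq_mul hN]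
  rw [← hibp, norm_mul, norm_neg, norm_mul, Complex.norm_real, Real.norm_eq_abs, hyy] at h4
  rw [le_div_iff₀ hr]
  rw [sub_zero, abs_one, mul_one] at h2
  have h5 : r ≤ 2 * Real.pi * |ξ - ξ'| := by nlinarith [Real.pi_gt_three, abs_nonneg (ξ - ξ')]
  have h6 := mul_le_mul_of_nonneg_right h5
    (norm_nonneg (∫ t in (0 : ℝ)..1, u t * twist K N y t))
  linarith

theorem integral_norm_sq_superpos_le {N : ℤ} (hN : N ≠ 0) {η : ℝ → ℂ} (hη : ContDiff ℝ ∞ η)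
    (hc : HasCompactSupport η) (f : CN K N) {D : ℝ} (hD : ∀ m, ‖f.1 m‖ ≤ D)
    (hDW : ∀ m, ‖(lieOp S.W N f).1 m‖ ≤ D) (m : Nil K) {r M : ℝ} (hr : 0 < r)
    (hM : ∀ ξ, ‖𝓕 η ξ‖ ≤ M) :
    Continuous (fun t => S.superpos N η f.1 (flow S.W t m)) ∧
    ∫ t in (0 : ℝ)..1, ‖S.superpos N η f.1 (flow S.W t m)‖ ^ 2 ≤
      (∫ ξ, ‖𝓕 η ξ‖) * (4 * D ^ 2 / r * (∫ ξ, ‖𝓕 η ξ‖) + D ^ 2 * M * (2 * r)) := by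
  have hφ : Continuous (Function.uncurry fun t ξ : ℝ =>
      f.1 (flow S.V (ξ / (N * (K : ℕ))) (flow S.W t m))) :=
    (f.2.1.contDiff_flow_flow S.W S.V m).continuous.comp
      (by fun_prop : Continuous fun y : ℝ × ℝ => (y.1, y.2 / (N * (K : ℕ))))
  exact ⟨continuous_integral_mul (integrable_fourier hη hc) hφ fun _ _ => hD _,
    integral_norm_sq_superposition_le (integrable_fourier hη hc) hφ (fun _ _ => hD _) hM hr.le
      (by positivity) (S.norm_integral_mul_conj_le hN f hD hDW m hr)⟩

end PHAut

/-! ### Averages over the base torus -/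

namespace Nil

open MeasureTheory

variable {K : ℕ+}

theorem mk_eq_flow_dz (x y z : ℝ) :
    (mk (Heis.ofCoords (x, y, z)) : Nil K) = flow Heis.dz z (mk (Heis.ofCoords (x, y, 0))) := by
  rw [flow_mk]
  congr 2
  ext <;> simp [flowCoords, Heis.dz]

variable {g : Nil K → ℝ}

theorem map_mk_eq (hg : ∀ s m, g (flow Heis.dz s m) = g m) (x y z : ℝ) :
    g (mk (Heis.ofCoords (x, y, z))) = g (mk (Heis.ofCoords (x, y, 0))) := by
  rw [mk_eq_flow_dz, hg]

/-- The lattice element (1, 0, 0) shifts the height by y; starting from height -y, allowed by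
invariance along Z, compensates for this. -/
theorem periodic_fst (hg : ∀ s m, g (flow Heis.dz s m) = g m) (y : ℝ) :
    Function.Periodic (fun x : ℝ => g (mk (Heis.ofCoords (x, y, 0)))) 1 := by
  intro x
  beta_reduce
  rw [← map_mk_eq hg x y (-y)]
  have hmem : (⟨(1 : ℤ), (0 : ℤ), (0 : ℤ) / ((K : ℕ) : ℝ)⟩ : Heis) ∈ Heis.lattice K := ⟨_, _, _, rfl⟩
  rw [← mk_mul_left hmem (Heis.ofCoords (x, y, -y))]
  congr 2
  ext <;> simp [Heis.ofCoords, add_comm]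

theorem periodic_snd (x : ℝ) :
    Function.Periodic (fun y : ℝ => g (mk (Heis.ofCoords (x, y, 0)))) 1 := by
  intro y
  beta_reduce
  have hmem : (⟨(0 : ℤ), (1 : ℤ), (0 : ℤ) / ((K : ℕ) : ℝ)⟩ : Heis) ∈ Heis.lattice K := ⟨_, _, _, rfl⟩
  rw [← mk_mul_left hmem (Heis.ofCoords (x, y, 0))]
  congr 2
  ext <;> simp [Heis.ofCoords, add_comm]

theorem integral_integral_translate (hg : ∀ s m, g (flow Heis.dz s m) = g m) (a b : ℝ) :
    ∫ x in (0 : ℝ)..1, ∫ y in (0 : ℝ)..1, g (mk (Heis.ofCoords (x + a, y + b, 0))) =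
      ∫ x in (0 : ℝ)..1, ∫ y in (0 : ℝ)..1, g (mk (Heis.ofCoords (x, y, 0))) := by
  have h1 : ∀ x : ℝ, ∫ y in (0 : ℝ)..1, g (mk (Heis.ofCoords (x, y + b, 0))) =
      ∫ y in (0 : ℝ)..1, g (mk (Heis.ofCoords (x, y, 0))) := by
    intro x
    rw [intervalIntegral.integral_comp_add_right
      (fun y => g (mk (Heis.ofCoords (x, y, 0)))), add_comm 1 b, zero_add]
    simpa using (periodic_snd (g := g) x).intervalIntegral_add_eq b 0
  have h2 : Function.Periodic
      (fun x : ℝ => ∫ y in (0 : ℝ)..1, g (mk (Heis.ofCoords (x, y, 0)))) 1 := by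
    intro x
    exact intervalIntegral.integral_congr fun y _ => periodic_fst hg y x
  simp only [h1]
  rw [intervalIntegral.integral_comp_add_right
    (fun x => ∫ y in (0 : ℝ)..1, g (mk (Heis.ofCoords (x, y, 0)))), add_comm 1 a, zero_add]
  simpa using h2.intervalIntegral_add_eq a 0

theorem intervalIntegral_swap_of_continuous {F : ℝ → ℝ → ℝ} (hF : Continuous (Function.uncurry F))
    (a b c d : ℝ) :
    ∫ x in a..b, ∫ y in c..d, F x y = ∫ y in c..d, ∫ x in a..b, F x y :=
  intervalIntegral_intervalIntegral_swap
    ((hF.continuousOn.integrableOn_compact (isCompact_uIcc.prod isCompact_uIcc)).mono_set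
      (Set.prod_mono Set.uIoc_subset_uIcc Set.uIoc_subset_uIcc))

/-- A nonnegative continuous function on the torus with small averages along a flow vanishes. -/
theorem eq_zero_of_integral_flow_le (hg : ∀ s m, g (flow Heis.dz s m) = g m) (hg0 : ∀ m, 0 ≤ g m)
    (hc : Continuous fun y : ℝ × ℝ => g (mk (Heis.ofCoords (y.1, y.2, 0)))) (v : ℝ × ℝ × ℝ)
    (h : ∀ ε > 0, ∃ T : ℝ, ∀ m, ∫ t in (0 : ℝ)..1, g (flow v (T * t) m) ≤ ε) (m : Nil K) :
    g m = 0 := by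
  set Γ : ℝ → ℝ → ℝ := fun x y => g (mk (Heis.ofCoords (x, y, 0))) with hΓ
  have hΓc : Continuous (Function.uncurry Γ) := hc
  have hΓ2 : ∀ {X : Type} [TopologicalSpace X] {a b : X → ℝ}, Continuous a → Continuous b →
      Continuous fun x => Γ (a x) (b x) := fun ha hb => hΓc.comp (ha.prodMk hb)
  have hΓ0 : ∀ x y, 0 ≤ Γ x y := fun x y => hg0 _
  set E := ∫ x in (0 : ℝ)..1, ∫ y in (0 : ℝ)..1, Γ x y with hE
  have hH : Continuous fun x => ∫ y in (0 : ℝ)..1, Γ x y :=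
    intervalIntegral.continuous_parametric_intervalIntegral_of_continuous' hΓc 0 1
  have hE1 : ∀ ε > 0, E ≤ ε := by
    intro ε hε
    obtain ⟨T, hT⟩ := h ε hε
    have hfl : ∀ x y t, g (flow v (T * t) (mk (Heis.ofCoords (x, y, 0)))) =
        Γ (x + T * t * v.1) (y + T * t * v.2.1) := by
      intro x y t
      rw [flow_mk]
      exact map_mk_eq hg _ _ _
    -- The torus integral is invariant under every horizontal translation, hence equals its average
    -- over t; after Fubini it is an integral of orbit averages.
    have h1 : E = ∫ t in (0 : ℝ)..1, ∫ x in (0 : ℝ)..1, ∫ y in (0 : ℝ)..1,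
        Γ (x + T * t * v.1) (y + T * t * v.2.1) := by
      rw [intervalIntegral.integral_congr (g := fun _ => E)]
      · simp
      · intro t _
        exact integral_integral_translate hg _ _
    have h2 : ∀ x, ∫ t in (0 : ℝ)..1, ∫ y in (0 : ℝ)..1, Γ (x + T * t * v.1) (y + T * t * v.2.1) =
        ∫ y in (0 : ℝ)..1, ∫ t in (0 : ℝ)..1, Γ (x + T * t * v.1) (y + T * t * v.2.1) := by
      intro x
      refine intervalIntegral_swap_of_continuous ?_ _ _ _ _
      change Continuous fun z : ℝ × ℝ => Γ (x + T * z.1 * v.1) (z.2 + T * z.1 * v.2.1)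
      exact hΓ2 (by fun_prop) (by fun_prop)
    have h3c : Continuous (Function.uncurry fun t x : ℝ => ∫ y in (0 : ℝ)..1,
        Γ (x + T * t * v.1) (y + T * t * v.2.1)) := by
      refine intervalIntegral.continuous_parametric_intervalIntegral_of_continuous'
        (f := fun (z : ℝ × ℝ) (y : ℝ) => Γ (z.2 + T * z.1 * v.1) (y + T * z.1 * v.2.1)) ?_ 0 1
      change Continuous fun w : (ℝ × ℝ) × ℝ =>
        Γ (w.1.2 + T * w.1.1 * v.1) (w.2 + T * w.1.1 * v.2.1)
      exact hΓ2 (by fun_prop) (by fun_prop)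
    rw [h1, intervalIntegral_swap_of_continuous h3c]
    simp only [h2]
    have h4c : Continuous fun z : ℝ × ℝ => ∫ t in (0 : ℝ)..1,
        Γ (z.1 + T * t * v.1) (z.2 + T * t * v.2.1) := by
      refine intervalIntegral.continuous_parametric_intervalIntegral_of_continuous'
        (f := fun (z : ℝ × ℝ) (t : ℝ) => Γ (z.1 + T * t * v.1) (z.2 + T * t * v.2.1)) ?_ 0 1
      change Continuous fun w : (ℝ × ℝ) × ℝ =>
        Γ (w.1.1 + T * w.2 * v.1) (w.1.2 + T * w.2 * v.2.1)
      exact hΓ2 (by fun_prop) (by fun_prop)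
    have h5 : ∀ x, ∫ y in (0 : ℝ)..1, ∫ t in (0 : ℝ)..1,
        Γ (x + T * t * v.1) (y + T * t * v.2.1) ≤ ε := by
      intro x
      calc _ ≤ ∫ y in (0 : ℝ)..1, ε := by
            refine intervalIntegral.integral_mono_on zero_le_one
              (Continuous.intervalIntegrable (h4c.comp (continuous_const.prodMk continuous_id)) _ _)
              (by simp) fun y _ => ?_
            simp only [← hfl]
            exact hT _
        _ = ε := by simp
    calc _ ≤ ∫ x in (0 : ℝ)..1, ε := by
          refine intervalIntegral.integral_mono_on zero_le_one
            (Continuous.intervalIntegrable ?_ _ _) (by simp) fun x _ => h5 x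
          exact intervalIntegral.continuous_parametric_intervalIntegral_of_continuous'
            (f := fun x y => ∫ t in (0 : ℝ)..1, Γ (x + T * t * v.1) (y + T * t * v.2.1)) h4c 0 1
      _ = ε := by simp
  have hH0 : ∀ x, 0 ≤ ∫ y in (0 : ℝ)..1, Γ x y := fun x =>
    intervalIntegral.integral_nonneg zero_le_one fun y _ => hΓ0 x y
  have hE0 : E ≤ 0 := le_of_forall_pos_le_add fun ε hε => by rw [zero_add]; exact hE1 ε hε
  have hH1 : ∀ x ∈ Set.Icc (0 : ℝ) 1, ∫ y in (0 : ℝ)..1, Γ x y ≤ 0 := by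
    intro x hx
    by_contra hpos
    exact absurd (intervalIntegral.integral_pos zero_lt_one hH.continuousOn (fun x _ => hH0 x)
      ⟨x, hx, not_le.1 hpos⟩) (not_lt.2 hE0)
  have hΓ1 : ∀ x ∈ Set.Icc (0 : ℝ) 1, ∀ y ∈ Set.Icc (0 : ℝ) 1, Γ x y ≤ 0 := by
    intro x hx y hy
    by_contra hpos
    exact absurd (intervalIntegral.integral_pos zero_lt_one
      (hΓ2 continuous_const continuous_id).continuousOn (fun y _ => hΓ0 x y)
      ⟨y, hy, not_le.1 hpos⟩) (not_lt.2 (hH1 x hx))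
  obtain ⟨x, y, z, hx0, hx1, hy0, hy1, rfl⟩ := PHAut.exists_fract m
  rw [map_mk_eq hg]
  exact le_antisymm (hΓ1 x ⟨hx0, hx1.le⟩ y ⟨hy0, hy1.le⟩) (hg0 _)

end Nil

/-! ### The lower bound for eigenvalues on ker V -/

namespace PHAut

open Nil MeasureTheory FourierTransform

variable {K : ℕ+} (S : PHAut K)

theorem integral_two_mul_add_const {f : ℝ → ℝ} (hf : Continuous f) (c : ℝ) :
    ∫ t in (0 : ℝ)..1, (2 * f t + c) = 2 * (∫ t in (0 : ℝ)..1, f t) + c := by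
  have h : IntervalIntegrable (fun t => 2 * f t) volume 0 1 :=
    (continuous_const.mul hf).intervalIntegrable _ _
  rw [intervalIntegral.integral_add h (by simp), intervalIntegral.integral_const_mul]
  simp

theorem tsupport_comp_mul_subset {ψ : ℝ → ℂ} {R a : ℝ} (hs : tsupport ψ ⊆ Set.Ioo (-R) R)
    (ha : 1 ≤ a) : tsupport (fun t => ψ (a * t)) ⊆ Set.Ioo (-R) R := by
  intro t ht
  have h1 : a * t ∈ tsupport ψ :=
    tsupport_comp_subset_preimage ψ (f := fun t : ℝ => a * t) (by fun_prop) ht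
  have h2 := abs_lt.2 (hs h1)
  rw [abs_mul, abs_of_pos (by linarith)] at h2
  exact abs_lt.1 (by nlinarith [abs_nonneg t])

theorem contDiff_comp_mul {ψ : ℝ → ℂ} (hψ : ContDiff ℝ ∞ ψ) (a : ℝ) :
    ContDiff ℝ ∞ (fun t => ψ (a * t)) := hψ.comp (contDiff_const.mul contDiff_id)

/-- Pairings with concentrated test functions are small in mean square. -/
theorem exists_integral_norm_sq_pair_le {δ : ℝ} (hδ : 0 < δ) {N : ℤ} (hN : N ≠ 0) {p : ℕ}
    (hp : 1 ≤ p) (q : ℕ) {ψ : ℝ → ℂ} (hψ : ContDiff ℝ ∞ ψ) (hs : tsupport ψ ⊆ Set.Ioo (-δ) δ) :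
    ∃ C : ℝ, ∀ a : ℝ, 1 ≤ a → ∃ C' : ℝ, ∀ (h : CN K N) (m : Nil K),
      ∫ t in (0 : ℝ)..1, ‖S.pair (fun t => ψ (a * t)) (flow S.W t m) h.1‖ ^ 2 ≤
        C / √a * S.aNorm δ N p q h ^ 2 + C' * S.aNorm δ N (p - 1) q (lieOp S.V N h) ^ 2 := by
  obtain ⟨χ, hχ, -, hχs, hχ1⟩ := exists_smooth_cutoff hδ
  obtain ⟨C1, hC10, hC1⟩ := S.exists_norm_pair_const_le hδ q hχ hχs
  obtain ⟨C2, hC20, hC2⟩ := S.exists_norm_lieOp_smoothW_le hδ q N (by positivity) hχ hχs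
  set A := ∫ ξ, ‖𝓕 ψ ξ‖ with hA
  have hA0 : 0 ≤ A := integral_nonneg fun _ => norm_nonneg _
  set I := ∫ t, ‖ψ t‖ with hI
  refine ⟨2 * (A * (4 * A + 2 * I) * (C1 + C2) ^ 2), fun a ha => ?_⟩
  have ha0 : 0 < a := by linarith
  have hsa := tsupport_comp_mul_subset hs ha
  have hψa := contDiff_comp_mul hψ a
  have hca := hasCompactSupport_of_tsupport_subset_Ioo hsa
  have hχη : ∀ t, ψ (a * t) = χ t * ψ (a * t) := by
    intro t
    by_cases ht : |t| ≤ δ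
    · rw [hχ1 t ht, one_mul]
    · rw [eq_zero_of_tsupport_subset_Ioo hsa (not_le.1 ht).le, mul_zero]
  obtain ⟨C3, hC30, hC3⟩ := S.exists_norm_pair_sub_superpos_le hδ q hN (by positivity) hψa hca hχ
    hχs hχη
  refine ⟨2 * C3 ^ 2, fun h m => ?_⟩
  have hn := S.aNorm_nonneg δ N p q h
  have hn' := S.aNorm_nonneg δ N (p - 1) q (lieOp S.V N h)
  set f := S.smoothW hχ (2 * δ) N h with hf
  set D := (C1 + C2) * S.aNorm δ N p q h with hD
  have hD1 : ∀ m, ‖f.1 m‖ ≤ D := by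
    intro m
    rw [hf, S.smoothW_apply hχ hχs]
    refine (hC1 (p := p) h m).trans ?_
    rw [hD, add_mul]
    exact le_add_of_nonneg_right (by positivity)
  have hD2 : ∀ m, ‖(lieOp S.W N f).1 m‖ ≤ D := by
    intro m
    refine (hC2 h (j := 0) (p := p) (by omega) m).2.trans ?_
    rw [hD, add_mul]
    exact le_add_of_nonneg_left (by positivity)
  have hsq : 0 < √a := Real.sqrt_pos.2 ha0
  have hM : ∀ ξ, ‖𝓕 (fun t => ψ (a * t)) ξ‖ ≤ a⁻¹ * I := by
    intro ξ
    rw [fourier_comp_mul ψ ha0, norm_smul, Real.norm_of_nonneg (inv_pos.2 ha0).le]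
    exact mul_le_mul_of_nonneg_left (norm_fourier_le ψ _) (inv_pos.2 ha0).le
  -- The choice r = √a balances the off-diagonal part, of order 1/r, against the diagonal part, of
  -- order r/a. Scaling ψ leaves the L¹ norm of its Fourier transform unchanged and divides the
  -- bound on its supremum by a.
  obtain ⟨hcont, hJ⟩ := S.integral_norm_sq_superpos_le hN hψa hca f hD1 hD2 m hsq hM
  rw [integral_norm_fourier_comp_mul ψ ha0, ← hA] at hJ
  have hJ' : A * (4 * D ^ 2 / √a * A + D ^ 2 * (a⁻¹ * I) * (2 * √a)) =
      A * (4 * A + 2 * I) * (C1 + C2) ^ 2 / √a * S.aNorm δ N p q h ^ 2 := by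
    have h1 : a⁻¹ * √a = (√a)⁻¹ := by
      nth_rw 1 [← Real.mul_self_sqrt ha0.le]
      field_simp
    calc A * (4 * D ^ 2 / √a * A + D ^ 2 * (a⁻¹ * I) * (2 * √a)) =
          A * (4 * D ^ 2 / √a * A + D ^ 2 * I * 2 * (a⁻¹ * √a)) := by ring
      _ = _ := by rw [h1, hD]; ring
  rw [hJ'] at hJ
  have hpt : ∀ t, ‖S.pair (fun t => ψ (a * t)) (flow S.W t m) h.1‖ ^ 2 ≤
      2 * ‖S.superpos N (fun t => ψ (a * t)) f.1 (flow S.W t m)‖ ^ 2 +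
        2 * (C3 * S.aNorm δ N (p - 1) q (lieOp S.V N h)) ^ 2 := by
    intro t
    have h1 := hC3 (p := p - 1) h (flow S.W t m)
    have h2 := norm_le_norm_add_norm_sub' (S.pair (fun t => ψ (a * t)) (flow S.W t m) h.1)
      (S.superpos N (fun t => ψ (a * t)) f.1 (flow S.W t m))
    have h3 := norm_nonneg (S.pair (fun t => ψ (a * t)) (flow S.W t m) h.1)
    have h4 := h2.trans (add_le_add le_rfl h1)
    refine (pow_le_pow_left₀ h3 h4 2).trans ?_
    rw [← mul_add]
    exact add_sq_le
  have hpc : Continuous fun t => S.pair (fun t => ψ (a * t)) (flow S.W t m) h.1 := by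
    simp only [← S.smoothW_apply hψa hsa]
    exact ((S.smoothW hψa δ N h).2.1.comp_flow S.W m).continuous
  calc _ ≤ ∫ t in (0 : ℝ)..1, (2 * ‖S.superpos N (fun t => ψ (a * t)) f.1 (flow S.W t m)‖ ^ 2 +
        2 * (C3 * S.aNorm δ N (p - 1) q (lieOp S.V N h)) ^ 2) :=
        intervalIntegral.integral_mono_on zero_le_one ((hpc.norm.pow 2).intervalIntegrable _ _)
          (((continuous_const.mul (hcont.norm.pow 2)).add continuous_const).intervalIntegrable _ _)
          fun t _ => hpt t
    _ = 2 * (∫ t in (0 : ℝ)..1, ‖S.superpos N (fun t => ψ (a * t)) f.1 (flow S.W t m)‖ ^ 2) +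
        2 * (C3 * S.aNorm δ N (p - 1) q (lieOp S.V N h)) ^ 2 := by
        exact integral_two_mul_add_const (hcont.norm.pow 2) _
    _ ≤ 2 * (A * (4 * A + 2 * I) * (C1 + C2) ^ 2 / √a * S.aNorm δ N p q h ^ 2) +
        2 * (C3 * S.aNorm δ N (p - 1) q (lieOp S.V N h)) ^ 2 := by gcongr
    _ = _ := by ring

section Kernel

variable {δ : ℝ} (hδ : 0 < δ) {N : ℤ} {p q : ℕ}

theorem exists_norm_pairB_le {ψ : ℝ → ℂ} {R : ℝ} (hψ : ContDiff ℝ ∞ ψ)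
    (hs : tsupport ψ ⊆ Set.Ioo (-R) R) : ∃ C : ℝ, 0 ≤ C ∧ ∀ (m : Nil K) (x : S.B δ N p q),
      ‖S.pairB hδ N p q hψ hs m x‖ ≤ C * ‖x‖ := by
  obtain ⟨C, hC0, hC⟩ := S.exists_norm_pair_const_le hδ q hψ hs
  refine ⟨C, hC0, fun m x => S.le_of_emb (f := fun x => ‖S.pairB hδ N p q hψ hs m x‖)
    (g := fun x => C * ‖x‖) (by fun_prop) (by fun_prop) (fun h => ?_) x⟩
  rw [pairB_emb, norm_emb]
  exact hC h m

theorem norm_pairB_flow_dz {ψ : ℝ → ℂ} {R : ℝ} (hψ : ContDiff ℝ ∞ ψ)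
    (hs : tsupport ψ ⊆ Set.Ioo (-R) R) (s : ℝ) (m : Nil K) (x : S.B δ N p q) :
    ‖S.pairB hδ N p q hψ hs (flow Heis.dz s m) x‖ = ‖S.pairB hδ N p q hψ hs m x‖ :=
  S.ext_emb (f := fun x => ‖S.pairB hδ N p q hψ hs (flow Heis.dz s m) x‖)
    (g := fun x => ‖S.pairB hδ N p q hψ hs m x‖) (by fun_prop) (by fun_prop) (fun h => by
      rw [pairB_emb, pairB_emb, ← S.smoothW_apply hψ hs, ← S.smoothW_apply hψ hs, norm_flow_dz]) x

/-- A limit of smooth functions, uniform because the functionals are bounded uniformly in m. -/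
theorem continuous_pairB {ψ : ℝ → ℂ} {R : ℝ} (hψ : ContDiff ℝ ∞ ψ)
    (hs : tsupport ψ ⊆ Set.Ioo (-R) R) (x : S.B δ N p q) :
    Continuous fun u : ℝ × ℝ × ℝ => S.pairB hδ N p q hψ hs (Nil.mk (Heis.ofCoords u)) x := by
  obtain ⟨C, hC0, hC⟩ := S.exists_norm_pairB_le hδ (N := N) (p := p) (q := q) hψ hs
  refine continuous_of_uniform_approx_of_continuous fun U hU => ?_
  obtain ⟨ε, hε, hU⟩ := Metric.mem_uniformity_dist.1 hU
  obtain ⟨h, hh⟩ := S.denseRange_emb.exists_dist_lt x (show 0 < ε / (C + 1) by positivity)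
  refine ⟨fun u => S.pairB hδ N p q hψ hs (Nil.mk (Heis.ofCoords u)) (S.emb δ N p q h), ?_,
    fun u => hU ?_⟩
  · simp only [pairB_emb, ← S.smoothW_apply hψ hs]
    exact (S.smoothW hψ R N h).2.1.continuous
  · rw [dist_eq_norm, ← map_sub]
    rw [dist_eq_norm] at hh
    refine (hC _ _).trans_lt ?_
    have h1 := norm_nonneg (x - S.emb δ N p q h)
    rw [lt_div_iff₀ (by positivity)] at hh
    nlinarith

theorem continuous_pairB_flow {ψ : ℝ → ℂ} {R : ℝ} (hψ : ContDiff ℝ ∞ ψ)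
    (hs : tsupport ψ ⊆ Set.Ioo (-R) R) (x : S.B δ N p q) (v : ℝ × ℝ × ℝ) (m : Nil K) :
    Continuous fun t : ℝ => S.pairB hδ N p q hψ hs (flow v t m) x := by
  obtain ⟨u, rfl⟩ := exists_coords m
  have h1 : (fun t : ℝ => S.pairB hδ N p q hψ hs (flow v t (Nil.mk (Heis.ofCoords u))) x) =
      fun t => S.pairB hδ N p q hψ hs (Nil.mk (Heis.ofCoords (flowCoords v u t))) x := by
    funext t
    rw [flow_mk]
  rw [h1]
  exact Continuous.comp (g := fun u => S.pairB hδ N p q hψ hs (Nil.mk (Heis.ofCoords u)) x)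
    (f := flowCoords v u) (S.continuous_pairB hδ hψ hs x) (contDiff_flowCoords v u).continuous

/-- A smooth h within ε of x has ‖Vh‖ ≤ ε because Vx = 0. The constants multiplying ε depend on a
but not on ε, and disappear as ε tends to zero. -/
theorem exists_integral_norm_sq_pairB_le (hN : N ≠ 0) (hp : 1 ≤ p) {ψ : ℝ → ℂ}
    (hψ : ContDiff ℝ ∞ ψ) (hs : tsupport ψ ⊆ Set.Ioo (-δ) δ) :
    ∃ C : ℝ, ∀ a : ℝ, (ha : 1 ≤ a) → ∀ x ∈ S.kerV δ N q hp, ∀ m,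
      ∫ t in (0 : ℝ)..1, ‖S.pairB hδ N p q (contDiff_comp_mul hψ a)
        (tsupport_comp_mul_subset hs ha) (flow S.W t m) x‖ ^ 2 ≤ C / √a * ‖x‖ ^ 2 := by
  obtain ⟨C, hC⟩ := S.exists_integral_norm_sq_pair_le hδ hN hp q hψ hs
  refine ⟨2 * |C|, fun a ha x hx m => ?_⟩
  obtain ⟨C', hC'⟩ := hC a ha
  have hsa := tsupport_comp_mul_subset hs ha
  have hψa := contDiff_comp_mul hψ a
  obtain ⟨B, hB0, hB⟩ := S.exists_norm_pairB_le hδ (N := N) (p := p) (q := q) hψa hsa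
  have key : ∀ ε > 0, ∫ t in (0 : ℝ)..1, ‖S.pairB hδ N p q hψa hsa (flow S.W t m) x‖ ^ 2 ≤
      2 * (|C| / √a * (‖x‖ + ε) ^ 2 + |C'| * ε ^ 2) + 2 * (B * ε) ^ 2 := by
    intro ε hε
    obtain ⟨h, hh⟩ := S.denseRange_emb.exists_dist_lt x hε
    rw [dist_eq_norm] at hh
    have hpt : ∀ t, ‖S.pairB hδ N p q hψa hsa (flow S.W t m) x‖ ^ 2 ≤
        2 * ‖S.pair (fun t => ψ (a * t)) (flow S.W t m) h.1‖ ^ 2 + 2 * (B * ε) ^ 2 := by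
      intro t
      have h1 := hB (flow S.W t m) (x - S.emb δ N p q h)
      rw [map_sub, pairB_emb] at h1
      have h2 := norm_le_norm_add_norm_sub' (S.pairB hδ N p q hψa hsa (flow S.W t m) x)
        (S.pair (fun t => ψ (a * t)) (flow S.W t m) h.1)
      have h3 : B * ‖x - S.emb δ N p q h‖ ≤ B * ε := by gcongr
      have h4 := h2.trans (add_le_add le_rfl (h1.trans h3))
      refine (pow_le_pow_left₀ (norm_nonneg _) h4 2).trans ?_
      rw [← mul_add]
      exact add_sq_le
    have hpc : Continuous fun t => S.pair (fun t => ψ (a * t)) (flow S.W t m) h.1 := by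
      simp only [← S.smoothW_apply hψa hsa]
      exact ((S.smoothW hψa δ N h).2.1.comp_flow S.W m).continuous
    have hxc := S.continuous_pairB_flow hδ hψa hsa x S.W m
    have hV : S.aNorm δ N (p - 1) q (lieOp S.V N h) ≤ ε := by
      have h1 := S.norm_VPow_le N (δ := δ) (q := q) (p' := p - 1) (p := p) 1 (by omega)
        (x - S.emb δ N p q h)
      rw [← VOp_eq_VPow S N hp, map_sub, (S.mem_kerV N hp x).1 hx, VOp_emb, zero_sub, norm_neg,
        norm_emb] at h1
      exact h1.trans hh.le
    have hn : S.aNorm δ N p q h ≤ ‖x‖ + ε := by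
      have h1 := norm_le_norm_add_norm_sub (S.emb δ N p q h) x
      rw [norm_emb] at h1
      have h2 := norm_le_norm_add_norm_sub' (S.emb δ N p q h) x
      rw [norm_emb, norm_sub_rev] at h2
      linarith
    have h5 : C / √a * S.aNorm δ N p q h ^ 2 ≤ |C| / √a * (‖x‖ + ε) ^ 2 := by
      have h0 := S.aNorm_nonneg δ N p q h
      have := le_abs_self C
      gcongr
    have h6 : C' * S.aNorm δ N (p - 1) q (lieOp S.V N h) ^ 2 ≤ |C'| * ε ^ 2 := by
      have h0 := S.aNorm_nonneg δ N (p - 1) q (lieOp S.V N h)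
      have := le_abs_self C'
      gcongr
    calc _ ≤ ∫ t in (0 : ℝ)..1, (2 * ‖S.pair (fun t => ψ (a * t)) (flow S.W t m) h.1‖ ^ 2 +
          2 * (B * ε) ^ 2) :=
          intervalIntegral.integral_mono_on zero_le_one ((hxc.norm.pow 2).intervalIntegrable _ _)
            (((continuous_const.mul (hpc.norm.pow 2)).add continuous_const).intervalIntegrable _ _)
            fun t _ => hpt t
      _ = 2 * (∫ t in (0 : ℝ)..1, ‖S.pair (fun t => ψ (a * t)) (flow S.W t m) h.1‖ ^ 2) +
          2 * (B * ε) ^ 2 := by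
          exact integral_two_mul_add_const (hpc.norm.pow 2) _
      _ ≤ _ := by
          have := hC' h m
          linarith
  have hcont : Continuous fun ε : ℝ =>
      2 * (|C| / √a * (‖x‖ + ε) ^ 2 + |C'| * ε ^ 2) + 2 * (B * ε) ^ 2 := by fun_prop
  have hlim := (hcont.tendsto 0).mono_left (nhdsWithin_le_nhds (s := Set.Ioi 0))
  refine (ge_of_tendsto hlim (eventually_nhdsWithin_of_forall fun ε hε => key ε hε)).trans
    (le_of_eq ?_)
  ring

theorem pairB_koop_pow {ψ : ℝ → ℂ} (hψ : ContDiff ℝ ∞ ψ) (hs : tsupport ψ ⊆ Set.Ioo (-δ) δ) (n : ℕ)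
    (m : Nil K) (x : S.B δ N p q) :
    S.pairB hδ N p q (contDiff_comp_mul hψ (S.lam ^ n))
      (tsupport_comp_mul_subset hs (one_le_pow₀ S.one_lt_lam.le)) m ((S.koop hδ N p q ^ n) x) =
      ((S.lam ^ n)⁻¹ : ℝ) * S.pairB hδ N p q hψ hs (S.Phi^[n] m) x :=
  S.ext_emb (f := fun x => S.pairB hδ N p q (contDiff_comp_mul hψ (S.lam ^ n))
      (tsupport_comp_mul_subset hs (one_le_pow₀ S.one_lt_lam.le)) m ((S.koop hδ N p q ^ n) x))
    (g := fun x => (((S.lam ^ n)⁻¹ : ℝ) : ℂ) * S.pairB hδ N p q hψ hs (S.Phi^[n] m) x)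
    (by fun_prop) (by fun_prop) (fun h => by
      rw [koop_pow_emb, pairB_emb, pairB_emb, pair_transfer_pow]
      simp only [mul_inv_cancel_left₀ (pow_ne_zero n S.lam_pos.ne')]) x

/-- Eigenvalues on the kernel of `V` have modulus larger than `λ⁻¹`. -/
theorem inv_lam_lt_norm_of_eigen (hN : N ≠ 0) {hp : 1 ≤ p} {x : S.B δ N p q}
    (hx : x ∈ S.kerV δ N q hp) (hx0 : x ≠ 0) {z : ℂ} (hz : S.koop hδ N p q x = z • x) :
    S.lam⁻¹ < ‖z‖ := by
  by_contra hle
  rw [not_lt] at hle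
  refine hx0 (norm_le_zero_iff.1 (S.norm_le_of_mem_kerV hδ hx le_rfl fun m η hη => ?_))
  set g : Nil K → ℝ := fun m => ‖S.pairB hδ N p q hη.1 hη.2.2.1 m x‖ ^ 2 with hg
  suffices h : g m = 0 by
    rw [hg] at h
    exact (pow_eq_zero_iff two_ne_zero).1 h |>.le
  have hgc : Continuous fun y : ℝ × ℝ => g (Nil.mk (Heis.ofCoords (y.1, y.2, 0))) :=
    (((S.continuous_pairB hδ hη.1 hη.2.2.1 x).comp
      (by fun_prop : Continuous fun y : ℝ × ℝ => (y.1, y.2, (0 : ℝ)))).norm.pow 2)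
  refine eq_zero_of_integral_flow_le (fun s m => ?_) (fun m => by positivity) hgc S.W
    (fun ε hε => ?_) m
  · rw [hg]
    simp only [norm_pairB_flow_dz]
  obtain ⟨C, hC⟩ := S.exists_integral_norm_sq_pairB_le hδ hN (q := q) hp hη.1 hη.2.2.1
  have hlim : Filter.Tendsto (fun n : ℕ => C / √(S.lam ^ n) * ‖x‖ ^ 2) Filter.atTop (nhds 0) := by
    have h1 : Filter.Tendsto (fun n : ℕ => √(S.lam ^ n)) Filter.atTop Filter.atTop :=
      Real.tendsto_sqrt_atTop.comp (tendsto_pow_atTop_atTop_of_one_lt S.one_lt_lam)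
    simpa using (h1.const_div_atTop C).mul_const (‖x‖ ^ 2)
  obtain ⟨n, hn⟩ := (hlim.eventually (gt_mem_nhds hε)).exists
  -- Φⁿ maps unit W-segments to segments of length λⁿ, and every base point is in its image.
  refine ⟨S.lam ^ n, fun m' => ?_⟩
  obtain ⟨m, rfl⟩ := S.Phi_surjective.iterate n m'
  have hl : 0 < S.lam ^ n := pow_pos S.lam_pos n
  have h1 : 1 ≤ S.lam ^ n := one_le_pow₀ S.one_lt_lam.le
  refine le_trans ?_ hn.le
  refine le_trans ?_ (hC (S.lam ^ n) h1 x hx m)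
  have hc1 : Continuous fun t : ℝ => g (flow S.W (S.lam ^ n * t) (S.Phi^[n] m)) :=
    ((S.continuous_pairB_flow hδ hη.1 hη.2.2.1 x S.W (S.Phi^[n] m)).comp
      (continuous_const.mul continuous_id)).norm.pow 2
  have hc2 := (S.continuous_pairB_flow hδ (contDiff_comp_mul hη.1 (S.lam ^ n))
    (tsupport_comp_mul_subset hη.2.2.1 h1) x S.W m).norm.pow 2
  refine intervalIntegral.integral_mono_on zero_le_one (hc1.intervalIntegrable _ _)
    (hc2.intervalIntegrable _ _) fun t _ => ?_
  rw [hg]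
  simp only
  rw [← S.Phi_iterate_flow_W]
  refine pow_le_pow_left₀ (norm_nonneg _) ?_ 2
  have h2 := S.pairB_koop_pow hδ hη.1 hη.2.2.1 n (flow S.W t m) x
  rw [S.koop_pow_eigen N hδ hz, map_smul, smul_eq_mul] at h2
  have h3 := congrArg norm h2
  rw [norm_mul, norm_mul, norm_pow, Complex.norm_of_nonneg (inv_pos.2 hl).le] at h3
  -- The assumption |z| ≤ λ⁻¹ is what cancels the Jacobian: pairings of x at Φⁿ-images are bounded
  -- by pairings with η(λⁿt), whose mean square is small.
  have h4 : ‖z‖ ^ n ≤ (S.lam ^ n)⁻¹ := by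
    rw [← inv_pow]
    exact pow_le_pow_left₀ (norm_nonneg z) hle n
  have h5 := mul_le_mul_of_nonneg_right h4 (norm_nonneg (S.pairB hδ N p q
    (contDiff_comp_mul hη.1 (S.lam ^ n)) (tsupport_comp_mul_subset hη.2.2.1 h1) (flow S.W t m) x))
  rw [h3] at h5
  exact le_of_mul_le_mul_left h5 (inv_pos.2 hl)

end Kernel

end PHAut

/-! ### Comparison of the two spectra -/

theorem ContinuousLinearMap.mem_spectrum_of_apply_eq_smul {X : Type*} [NormedAddCommGroup X]
    [NormedSpace ℂ X] {L : X →L[ℂ] X} {x : X} {z : ℂ} (hx : x ≠ 0) (h : L x = z • x) :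
    z ∈ spectrum ℂ L := by
  rw [spectrum.mem_iff]
  rintro ⟨u, hu⟩
  have h1 : (u : X →L[ℂ] X) x = 0 := by
    rw [hu, Algebra.algebraMap_eq_smul_one]
    simp [h]
  have h2 : ((↑u⁻¹ : X →L[ℂ] X) * (u : X →L[ℂ] X)) x = 0 := by
    rw [mul_apply_eq_comp, h1, map_zero]
  rw [Units.inv_mul] at h2
  exact hx h2

theorem ContinuousLinearMap.exists_eigenvector_of_finiteDimensional {X : Type*}
    [NormedAddCommGroup X] [NormedSpace ℂ X] [FiniteDimensional ℂ X] {L : X →L[ℂ] X} {z : ℂ}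
    (h : z ∈ spectrum ℂ L) : ∃ x ≠ 0, L x = z • x := by
  have := FiniteDimensional.complete ℂ X
  rw [ContinuousLinearMap.spectrum_eq, ← Module.End.hasEigenvalue_iff_mem_spectrum] at h
  obtain ⟨x, hx⟩ := h.exists_hasEigenvector
  exact ⟨x, hx.2, hx.apply_eq_smul⟩

namespace PHAut

variable {K : ℕ+} (S : PHAut K) {δ : ℝ} (hδ : 0 < δ) {N : ℤ} {p q : ℕ}

theorem koop_VPow_eigen {p' : ℕ} {x : S.B δ N p q} {z : ℂ} (hz : S.koop hδ N p q x = z • x) (j : ℕ)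
    (hj : p' + j ≤ p) : S.koop hδ N p' q (S.VPow N δ q j hj x) =
      ((S.lam : ℂ) ^ j * z) • S.VPow N δ q j hj x := by
  have h := S.VPow_koop N hδ j hj x
  have hl : (S.lam : ℂ) ≠ 0 := Complex.ofReal_ne_zero.2 S.lam_pos.ne'
  rw [hz, map_smul] at h
  rw [mul_smul, h, smul_smul, ← mul_pow, mul_inv_cancel₀ hl, one_pow, one_smul]

theorem norm_lam_pow_mul (j : ℕ) (z : ℂ) : ‖(S.lam : ℂ) ^ j * z‖ = S.lam ^ j * ‖z‖ := by
  rw [norm_mul, norm_pow, Complex.norm_of_nonneg S.lam_pos.le]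

/-- An eigenvector whose eigenvalue lies in the `k`-th annulus is mapped by `V ^ k` to a nonzero
element of the kernel of `V`. -/
theorem VPow_mem_kerV_of_eigen (hN : N ≠ 0) {x : S.B δ N p q} (hx0 : x ≠ 0) {z : ℂ}
    (hz : S.koop hδ N p q x = z • x) {k : ℕ} (hk : k < p) (h1 : (S.lam ^ (k + 1))⁻¹ < ‖z‖)
    (h2 : ‖z‖ ≤ (S.lam ^ k)⁻¹) :
    S.VPow N δ q k (p' := p - k) (by omega) x ≠ 0 ∧
      S.VPow N δ q k (p' := p - k) (by omega) x ∈ S.kerV δ N q (p := p - k) (by omega) := by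
  classical
  have hl := S.lam_pos
  have hl1 := S.one_lt_lam
  have hz0 : 0 < ‖z‖ := lt_trans (by positivity) h1
  -- Otherwise λ^(k+1) z would be an eigenvalue of modulus greater than one.
  have hvan : ∃ hi : k + 1 ≤ p, S.VPow N δ q (k + 1) (p' := p - (k + 1)) (by omega) x = 0 := by
    refine ⟨hk, ?_⟩
    by_contra hne
    have h3 := S.norm_le_one_of_eigen N hδ (S.koop_VPow_eigen hδ hz (k + 1) _) hne
    rw [norm_lam_pow_mul] at h3
    rw [inv_lt_iff_one_lt_mul₀ (by positivity)] at h1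
    linarith
  have hex : ∃ i : ℕ, ∃ hi : i ≤ p, S.VPow N δ q i (p' := p - i) (by omega) x = 0 := ⟨_, hvan⟩
  -- The least i with V^i x = 0 is j + 1 for some j ≤ k, and V^j x is a nonzero element of ker V.
  obtain ⟨i, ⟨hi, hi0⟩, hmin, hik⟩ : ∃ i : ℕ,
      (∃ hi : i ≤ p, S.VPow N δ q i (p' := p - i) (by omega) x = 0) ∧
      (∀ j < i, ¬ ∃ hj : j ≤ p, S.VPow N δ q j (p' := p - j) (by omega) x = 0) ∧ i ≤ k + 1 :=
    ⟨Nat.find hex, Nat.find_spec hex, fun j hj => Nat.find_min hex hj, Nat.find_min' hex hvan⟩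
  rcases i with _ | j
  · exact absurd ((S.VPow_zero_self N x).symm.trans hi0) hx0
  have hj0 : S.VPow N δ q j (p' := p - j) (by omega) x ≠ 0 := fun h =>
    hmin j (Nat.lt_succ_self j) ⟨by omega, h⟩
  have hjk : S.VPow N δ q j (p' := p - j) (by omega) x ∈ S.kerV δ N q (p := p - j) (by omega) := by
    rw [mem_kerV, VOp_eq_VPow, VPow_VPow, ← hi0]
    congr 2
    omega
  have h3 := S.inv_lam_lt_norm_of_eigen hδ hN hjk hj0 (S.koop_VPow_eigen hδ hz j _)
  rw [norm_lam_pow_mul] at h3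
  -- The lower bound λ⁻¹ < λ^j |z| ≤ λ^(j-k) forces j ≥ k.
  have h4 : S.lam⁻¹ < S.lam ^ j * (S.lam ^ k)⁻¹ :=
    h3.trans_le (mul_le_mul_of_nonneg_left h2 (by positivity))
  rw [← div_eq_mul_inv, lt_div_iff₀ (by positivity), inv_mul_lt_iff₀ hl, ← pow_succ',
    pow_lt_pow_iff_right₀ hl1] at h4
  obtain rfl : j = k := by omega
  exact ⟨hj0, hjk⟩

/-- The annulus lies outside the essential radius because k + 1 ≤ min(p, q), so z has an
eigenvector. Its image under V^k lies in the kernel for p - k and is lifted back to the one for p.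
-/
theorem mem_spectrum_restrict_of_mem_spectrum (hN : N ≠ 0) (hp : 1 ≤ p)
    (hL : ∀ u ∈ S.kerV δ N q hp, S.koop hδ N p q u ∈ S.kerV δ N q hp) {k : ℕ} (hkp : k < p)
    (hkq : k < q) {z : ℂ} (hz : z ∈ spectrum ℂ (S.koop hδ N p q))
    (h1 : (S.lam ^ (k + 1))⁻¹ < ‖z‖) (h2 : ‖z‖ ≤ (S.lam ^ k)⁻¹) :
    (S.lam : ℂ) ^ k * z ∈ spectrum ℂ ((S.koop hδ N p q).restrict hL) := by
  have hl := S.lam_pos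
  have hr : S.lam⁻¹ ^ min p q < ‖z‖ := by
    refine lt_of_le_of_lt ?_ h1
    rw [← inv_pow]
    exact pow_le_pow_of_le_one (inv_pos.2 hl).le (inv_le_one_of_one_le₀ S.one_lt_lam.le)
      (by omega)
  obtain ⟨x, hx0, hx⟩ := (S.quasiCompact_koop N hδ).exists_eigenvector (by positivity) hr hz
  obtain ⟨h3, h4⟩ := S.VPow_mem_kerV_of_eigen hδ hN hx0 hx hkp h1 h2
  obtain ⟨y, hy, hy0, hyz⟩ :=
    S.exists_eigen_kerV_lift hδ _ hp h4 h3 (S.koop_VPow_eigen hδ hx k _)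
  refine ContinuousLinearMap.mem_spectrum_of_apply_eq_smul (x := ⟨y, hy⟩) ?_ (Subtype.ext ?_)
  · exact fun h => hy0 (congrArg Subtype.val h)
  · exact hyz

/-- The annulus is forced by λ⁻¹ < |λ^k z| ≤ 1. Membership in the spectrum is proved without solving
V^k v = x: density of the range of V^k and the Fredholm alternative replace it. -/
theorem mem_spectrum_of_mem_spectrum_restrict (hN : N ≠ 0) (hp : 1 ≤ p) (hq : 1 ≤ q)
    (hL : ∀ u ∈ S.kerV δ N q hp, S.koop hδ N p q u ∈ S.kerV δ N q hp) {k : ℕ} (hkp : k < p)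
    {z : ℂ} (hz : (S.lam : ℂ) ^ k * z ∈ spectrum ℂ ((S.koop hδ N p q).restrict hL)) :
    z ∈ spectrum ℂ (S.koop hδ N p q) ∧ (S.lam ^ (k + 1))⁻¹ < ‖z‖ ∧ ‖z‖ ≤ (S.lam ^ k)⁻¹ := by
  have hl := S.lam_pos
  have hlC : (S.lam : ℂ) ≠ 0 := Complex.ofReal_ne_zero.2 hl.ne'
  have := S.finiteDimensional_kerV hδ hN hp hq
  obtain ⟨⟨x, hx⟩, hx0, hxz⟩ := ContinuousLinearMap.exists_eigenvector_of_finiteDimensional hz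
  replace hx0 : x ≠ 0 := fun h => hx0 (Subtype.ext h)
  replace hxz : S.koop hδ N p q x = ((S.lam : ℂ) ^ k * z) • x := congrArg Subtype.val hxz
  have h1 := S.inv_lam_lt_norm_of_eigen hδ hN hx hx0 hxz
  have h2 := S.norm_le_one_of_eigen N hδ hxz hx0
  refine ⟨?_, ?_, ?_⟩
  · by_contra hns
    rw [spectrum.notMem_iff, ← IsUnit.neg_iff, ContinuousLinearMap.isUnit_iff_bijective] at hns
    obtain ⟨y, hy, hy0, hyz⟩ := S.exists_eigen_kerV_lift hδ hp (p' := p - k) (by omega) hx hx0 hxz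
    -- If L - z is onto, then V^k(L - z) = λ^(-k)(L - λ^k z)V^k places the dense range of V^k inside
    -- that of L - λ^k z.
    have hd : DenseRange (S.koop hδ N (p - k) q -
        ((S.lam : ℂ) ^ k * z) • (1 : S.B δ N (p - k) q →L[ℂ] S.B δ N (p - k) q)) := by
      refine (S.denseRange_VPow hN hδ hq k (show p - k + k = p by omega)).mono ?_
      rintro _ ⟨u, rfl⟩
      obtain ⟨v, rfl⟩ := hns.2 u
      refine ⟨((S.lam : ℂ)⁻¹ ^ k) • S.VPow N δ q k (by omega) v, ?_⟩
      have h3 : (-(algebraMap ℂ (S.B δ N p q →L[ℂ] S.B δ N p q) z - S.koop hδ N p q)) v =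
          S.koop hδ N p q v - z • v := by
        rw [neg_sub, Algebra.algebraMap_eq_smul_one]
        rfl
      rw [h3, map_sub, VPow_koop, map_smul, map_smul]
      change (S.lam : ℂ)⁻¹ ^ k • (S.koop hδ N (p - k) q _ -
        ((S.lam : ℂ) ^ k * z) • (_ : S.B δ N (p - k) q)) = _
      rw [smul_sub, smul_smul, ← mul_assoc, ← mul_pow, inv_mul_cancel₀ hlC, one_pow, one_mul]
      rfl
    have hinj := (S.quasiCompact_koop N hδ (p := p - k)).injective_of_dense (by positivity) ?_ hd
    · refine hy0 (hinj ?_)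
      rw [map_zero]
      change S.koop hδ N (p - k) q y - ((S.lam : ℂ) ^ k * z) • y = 0
      rw [hyz, sub_self]
    -- Since k < p, min(p - k, q) ≥ 1, and the essential radius on B^{p-k,q} is at most λ⁻¹ < |λ^k
    -- z|.
    · refine lt_of_le_of_lt ?_ h1
      exact pow_le_of_le_one (inv_pos.2 hl).le (inv_le_one_of_one_le₀ S.one_lt_lam.le) (by omega)
  · rw [norm_lam_pow_mul] at h1
    rw [inv_lt_iff_one_lt_mul₀ hl] at h1
    rw [inv_lt_iff_one_lt_mul₀ (by positivity)]
    convert h1 using 1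
    ring
  · rw [norm_lam_pow_mul] at h2
    rwa [← one_div, le_div_iff₀' (by positivity)]

end PHAut

/-- The first clause determines the bounded operator L, since the image of C_N^∞ is dense. -/
theorem lemma5p3 (K : ℕ+) (S : PHAut K) (δ : ℝ) (hδ : 0 < δ) (N : ℤ) (hN : N ≠ 0)
    (p q : ℕ) (hp : 1 ≤ p) (hq : 1 ≤ q) :
    ∃ L : S.B δ N p q →L[ℂ] S.B δ N p q,
      (∀ h : Nil.CN K N, L (S.emb δ N p q h) = S.emb δ N p q (S.transfer N h)) ∧
      ∃ hL : ∀ u ∈ S.kerV δ N q hp, L u ∈ S.kerV δ N q hp,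
        ∀ k : ℕ, k < p → k < q →
          {z : ℂ | z ∈ spectrum ℂ L ∧ (S.lam ^ (k + 1))⁻¹ < ‖z‖ ∧ ‖z‖ ≤ (S.lam ^ k)⁻¹} =
            {z : ℂ | ((S.lam ^ k : ℝ) : ℂ) * z ∈ spectrum ℂ (L.restrict hL)} := by
  refine ⟨S.koop hδ N p q, fun h => S.koop_emb N hδ h, S.koop_mem_kerV hδ hp, fun k hkp hkq => ?_⟩
  ext z
  simp only [Set.mem_ofPred_eq, Complex.ofReal_pow]
  exact ⟨fun ⟨hz, h1, h2⟩ =>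
      S.mem_spectrum_restrict_of_mem_spectrum hδ hN hp _ hkp hkq hz h1 h2,
    fun hz => S.mem_spectrum_of_mem_spectrum_restrict hδ hN hp hq _ hkp hz⟩
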